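/- **Setting.** Let $T>0$, $\lambda>0$, let $E^{\mathtt c},E^{\mathtt i}$ be Polish spaces with Borel probability measures $\nu^{\mathtt c},\nu^{\mathtt i}$. On a probability space there are independent standard Brownian motions $W^0,W^1,W^2,\dots$ and an independent Poisson random measure $N(dt,de)$ on $[0,\infty)\times E$, $E=E^{\mathtt c}\times\prod_{j\ge1}E^{\mathtt i}$, $e=(e^{\mathtt c},e^{\mathtt i,1},e^{\mathtt i,2},\dots)$, with intensity $dt\otimes\lambda\,(\nu^{\mathtt c}\otimes\bigotimes_{j\ge1}\nu^{\mathtt i})(de)$. Independently of these, investor types $\mathtt t^1,\mathtt t^2,\dots$ are drawn i.i.d. from a type distribution $\mathbb T$. A type carries a vector $(x_0^{\mathtt t},r^{\mathtt t},\kappa^{\mathtt t},\sigma^{\mathtt t},\sigma^{0\mathtt t},\eta^{\mathtt t},\zeta^{\mathtt t},\alpha^{\mathtt t},\theta^{\mathtt t})$ with $x_0^{\mathtt t}>0$, $r^{\mathtt t},\kappa^{\mathtt t}\in\mathbb R$, $\sigma^{\mathtt t},\sigma^{0\mathtt t}\ge0$ not both zero, measurable jump and signal maps $\eta^{\mathtt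 t},\zeta^{\mathtt t}:E^{\mathtt c}\times E^{\mathtt i}\to\mathbb R$, $\alpha^{\mathtt t}\in(0,\infty)\setminus\{1\}$, $\theta^{\mathtt t}\in[0,1]$; everything is (jointly) measurable in the type. Put $\nu=\lambda\,\nu^{\mathtt c}\otimes\nu^{\mathtt i}$ on $E^{\mathtt c}\times E^{\mathtt i}$. For $z\ne0$ with $\nu(\zeta^{\mathtt t}=z)>0$ let $\underline\eta^{\mathtt t}(z),\bar\eta^{\mathtt t}(z)$ be the $\nu(\cdot\mid\zeta^{\mathtt t}=z)$-essential infimum and supremum of $\eta^{\mathtt t}$, and let $\underline\eta^{\mathtt t}(0),\bar\eta^{\mathtt t}(0)$ be those under $\nu(\cdot\cap\{\zeta^{\mathtt t}=0,\eta^{\mathtt t}\ne0\})$. Assume that for $\mathbb T$-a.e. $\mathtt t$: $\nu(\eta^{\mathtt t}<-1)=0$; $\underline\eta^{\mathtt t}(z)<0<\bar\eta^{\mathtt t}(z)$ for $\nu\circ(\zeta^{\mathtt t})^{-1}$-a.e. $z\neq0$; $\zeta^{\mathtt t}$ takes finitely many values; $\int(1+\eta^{\mathtt t})^p\,d\nu<\infty$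 for all $p>0$. Let $\Phi^{\mathtt t}(z)=[-1/\bar\eta^{\mathtt t}(z),-1/\underline\eta^{\mathtt t}(z)]$ for $z\ne0$. Let $\Phi^{\mathtt t}(0)=\mathbb R$ if $\nu(\zeta^{\mathtt t}=0,\eta^{\mathtt t}\ne0)=0$; otherwise $\Phi^{\mathtt t}(0)$ is the same interval at $z=0$, with its right end replaced by $+\infty$ if $\underline\eta^{\mathtt t}(0)\ge0$ and its left end replaced by $-\infty$ if $\bar\eta^{\mathtt t}(0)\le0$. Each investor $j$ uses a signal-driven strategy $\pi^{\mathtt t^j}$ determined by her type, where $(\mathtt t,z)\mapsto\pi^{\mathtt t}(z)$ is measurable and, for $\mathbb T$-a.e. $\mathtt t$, admissible: for $z=0$ and for every $z$ with $\nu(\zeta^{\mathtt t}=z)>0$, $\pi^{\mathtt t}(z)$ lies in a compact interval contained in $\{0\}\cup\operatorname{int}\Phi^{\mathtt t}(z)$. Her wealth $X^j$ is the adapted càdlàg solution on $[0,T]$ of $X^j_0=x_0^{\mathtt t^j}$ and, with parameters and $\pi$ taken at $\mathtt t^j$, $$\frac{dX^j_t}{X^j_{t-}}=\big(r+\pi(0)(\kappa-r)\big)dt+\sigma\pi(0)\,dW^j_t+\sigma^0\pi(0)\,dW^0_t+\int_E\eta(e^{\mathtt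 c},e^{\mathtt i,j})\,\pi\big(\zeta(e^{\mathtt c},e^{\mathtt i,j})\big)N(dt,de).$$ **Lemma.** Suppose that $$\int|\log x_0^{\mathtt t}|\,d\mathbb T<\infty,\qquad \int\big|r^{\mathtt t}+\pi^{\mathtt t}(0)(\kappa^{\mathtt t}-r^{\mathtt t})-\tfrac12\big((\sigma^{\mathtt t})^2+(\sigma^{0\mathtt t})^2\big)\pi^{\mathtt t}(0)^2\big|\,d\mathbb T<\infty,$$ $$\int|\sigma^{\mathtt t}\pi^{\mathtt t}(0)|\,d\mathbb T<\infty,\qquad \int|\sigma^{0\mathtt t}\pi^{\mathtt t}(0)|\,d\mathbb T<\infty,$$ and, for $\nu^{\mathtt c}$-a.e. $e^{\mathtt c}$, $$\int\big|\log\big(1+\pi^{\mathtt t}(\zeta^{\mathtt t}(e^{\mathtt c},e^{\mathtt i}))\,\eta^{\mathtt t}(e^{\mathtt c},e^{\mathtt i})\big)\big|\,(\mathbb T\otimes\nu^{\mathtt i})(d\mathtt t,de^{\mathtt i})<\infty .$$ Then, almost surely, for every investor $i$ and every $t\in[0,T]$, the geometric average wealth $\bar X^{-i}_t=\big(\prod_{j\le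 n+1,\,j\ne i}X^j_t\big)^{1/n}$ of her $n$ peers satisfies $$\lim_{n\to\infty}\bar X^{-i}_t=\bar x_0\exp\Big\{\overline{\tau\pi}\,t+\overline{\sigma^0\pi}\,W^0_t+\int_{[0,t]\times E^{\mathtt c}}\log m(e^{\mathtt c})\,N\big(ds,de^{\mathtt c},\textstyle\prod_jE^{\mathtt i}\big)\Big\},$$ where $\bar x_0=\exp\int\log x_0^{\mathtt t}\,d\mathbb T$, $\overline{\tau\pi}=\int\big(r^{\mathtt t}+\pi^{\mathtt t}(0)(\kappa^{\mathtt t}-r^{\mathtt t})-\frac12((\sigma^{\mathtt t})^2+(\sigma^{0\mathtt t})^2)\pi^{\mathtt t}(0)^2\big)d\mathbb T$, $\overline{\sigma^0\pi}=\int\sigma^{0\mathtt t}\pi^{\mathtt t}(0)\,d\mathbb T$ and $$m(e^{\mathtt c})=\exp\int\log\big(1+\pi^{\mathtt t}(\zeta^{\mathtt t}(e^{\mathtt c},e^{\mathtt i}))\,\eta^{\mathtt t}(e^{\mathtt c},e^{\mathtt i})\big)\,(\mathbb T\otimes\nu^{\mathtt i})(d\mathtt t,de^{\mathtt i}).$$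 -/

import Mathlib

open MeasureTheory ProbabilityTheory Filter Topology
open scoped NNReal ENNReal

noncomputable section

namespace JumpSignalGame

/-! ### Investor types -/

/-- A type vector `(x₀, r, κ, σ, σ⁰, η, ζ, α, θ)`, with jump map `η` and signal map `ζ` on the mark
space `E` of a single investor. -/
structure InvestorType (E : Type*) [MeasurableSpace E] where
  x0 : ℝ
  r : ℝ
  kappa : ℝ
  sigma : ℝ
  sigma0 : ℝ
  eta : E → ℝ
  zeta : E → ℝ
  alpha : ℝ
  theta : ℝ
  x0_pos : 0 < x0
  sigma_nonneg : 0 ≤ sigma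
  sigma0_nonneg : 0 ≤ sigma0
  sigma_add_pos : 0 < sigma + sigma0
  measurable_eta : Measurable eta
  measurable_zeta : Measurable zeta
  alpha_pos : 0 < alpha
  alpha_ne_one : alpha ≠ 1
  theta_mem : theta ∈ Set.Icc (0 : ℝ) 1

/-- The types `ty s` depend measurably on the parameter `s` of the measurable space `S` carrying the
type distribution: all real components are measurable, and `η`, `ζ` are jointly measurable in the
type and the mark. -/
structure IsMeasurableTypeFamily {S E : Type*} [MeasurableSpace S] [MeasurableSpace E]
    (ty : S → InvestorType E) : Prop where
  x0 : Measurable fun s => (ty s).x0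
  r : Measurable fun s => (ty s).r
  kappa : Measurable fun s => (ty s).kappa
  sigma : Measurable fun s => (ty s).sigma
  sigma0 : Measurable fun s => (ty s).sigma0
  eta : Measurable fun p : S × E => (ty p.1).eta p.2
  zeta : Measurable fun p : S × E => (ty p.1).zeta p.2
  alpha : Measurable fun s => (ty s).alpha
  theta : Measurable fun s => (ty s).theta

/-! ### Jump bounds and admissible positions -/

section Admissible

variable {E : Type*} [MeasurableSpace E]

/-- The marks that may be set without a signal and that move the stock price: `{ζ = 0, η ≠ 0}`. -/
def unsignaledShocks (θ : InvestorType E) : Set E := {e | θ.zeta e = 0 ∧ θ.eta e ≠ 0}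

/-- For `z ≠ 0`, the a posteriori law `K(z, ·)` of the mark given the signal `z`. The signal maps
take finitely many values, so the disintegration of `ν` along `ζ` is elementary conditioning on
`{ζ = z}` (for the values `z` of positive mass, the only ones where it is determined).
For `z = 0`, the restriction of `ν` to the unsignaled shocks. -/
def signalKernel (ν : Measure E) (θ : InvestorType E) (z : ℝ) : Measure E :=
  open Classical in
  if z = 0 then ν.restrict (unsignaledShocks θ) else ProbabilityTheory.cond ν (θ.zeta ⁻¹' {z})

/-- The lower jump bound: the essential infimum of `η` under `signalKernel`. -/
def lowerJump (ν : Measure E) (θ : InvestorType E) (z : ℝ) : EReal :=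
  essInf (fun e => (θ.eta e : EReal)) (signalKernel ν θ z)

/-- The upper jump bound: the essential supremum of `η` under `signalKernel` (possibly `+∞`). -/
def upperJump (ν : Measure E) (θ : InvestorType E) (z : ℝ) : EReal :=
  essSup (fun e => (θ.eta e : EReal)) (signalKernel ν θ z)

/-- The positions `Φ(z)` that keep wealth nonnegative given the signal `z`
(`-1/η̄` is `0` when `η̄ = +∞`, as it is in `EReal`). -/
def positions (ν : Measure E) (θ : InvestorType E) (z : ℝ) : Set ℝ :=
  open Classical in
  if z ≠ 0 then
    {x : ℝ | -(upperJump ν θ z)⁻¹ ≤ (x : EReal) ∧ (x : EReal) ≤ -(lowerJump ν θ z)⁻¹}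
  else if ν (unsignaledShocks θ) = 0 then Set.univ
  else if lowerJump ν θ 0 < 0 ∧ 0 < upperJump ν θ 0 then
    {x : ℝ | -(upperJump ν θ 0)⁻¹ ≤ (x : EReal) ∧ (x : EReal) ≤ -(lowerJump ν θ 0)⁻¹}
  else if 0 ≤ lowerJump ν θ 0 then
    {x : ℝ | -(upperJump ν θ 0)⁻¹ ≤ (x : EReal)}
  else
    {x : ℝ | (x : EReal) ≤ -(lowerJump ν θ 0)⁻¹}

/-- The standing assumptions on a type: nonnegative stock price, no arbitrage given a nonzero
signal, finitely many signals, and integrability of jump sizes. -/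
structure IsAdmissibleType (ν : Measure E) (θ : InvestorType E) : Prop where
  stock_nonneg : ν {e | θ.eta e < -1} = 0
  no_arbitrage : ∀ᵐ z ∂(ν.map θ.zeta), z ≠ 0 → lowerJump ν θ z < 0 ∧ 0 < upperJump ν θ z
  finite_signals : (Set.range θ.zeta).Finite
  jump_moments : ∀ p : ℝ, 0 < p → Integrable (fun e => (1 + θ.eta e) ^ p) ν

/-- The values that the signal process `Z` takes with positive probability: `0` (no signal), and
the values of `ζ` of positive mass. -/
def IsPossibleSignal (ν : Measure E) (θ : InvestorType E) (z : ℝ) : Prop :=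
  z = 0 ∨ ν (θ.zeta ⁻¹' {z}) ≠ 0

/-- `φ` gives an admissible signal-driven strategy `φ(Z)` of an investor of type `θ`: it is
measurable, and for some choice of compact intervals contained in `{0} ∪ interior Φ(z)` the position
taken at each possible signal `z` lies in the corresponding interval. -/
def IsAdmissibleSignalStrategy (ν : Measure E) (θ : InvestorType E) (φ : ℝ → ℝ) : Prop :=
  Measurable φ ∧ ∃ lo hi : ℝ → ℝ, ∀ z, IsPossibleSignal ν θ z →
    Set.Icc (lo z) (hi z) ⊆ {0} ∪ interior (positions ν θ z) ∧ φ z ∈ Set.Icc (lo z) (hi z)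

end Admissible

/-! ### Poisson random measures -/

/-- `N` is a Poisson random measure with intensity `μ`: an integer-valued random measure
such that `N(B)` is Poisson distributed with parameter `μ(B)` and `N(B₁), …, N(Bₙ)` are independent
for pairwise disjoint `B₁, …, Bₙ`. -/
structure IsPoissonRandomMeasure {Ω F : Type*} [MeasurableSpace Ω] [MeasurableSpace F]
    (N : Ω → Measure F) (μ : Measure F) (P : Measure Ω) : Prop where
  measurable : Measurable N
  integer_valued : ∀ᵐ ω ∂P, ∀ B, MeasurableSet B → N ω B = ⊤ ∨ ∃ k : ℕ, N ω B = k
  law : ∀ B, MeasurableSet B → μ B ≠ ⊤ →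
    P.map (fun ω => N ω B) = (poissonMeasure (μ B).toNNReal).map (fun k : ℕ => (k : ℝ≥0∞))
  law_top : ∀ B, MeasurableSet B → μ B = ⊤ → ∀ᵐ ω ∂P, N ω B = ⊤
  indep : ∀ (n : ℕ) (B : Fin n → Set F), (∀ i, MeasurableSet (B i)) →
    Pairwise (fun i j => Disjoint (B i) (B j)) → iIndepFun (fun i ω => N ω (B i)) P

/-! ### Stochastic integrals and the wealth equation -/

section Wealth

variable {Ω : Type*} [MeasurableSpace Ω]

/-- A sequence of partitions `0 = p n 0 ≤ … ≤ p n (m n) = t` whose mesh tends to `0`. -/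
structure IsPartitionSequence (t : ℝ≥0) (p : ℕ → ℕ → ℝ≥0) (m : ℕ → ℕ) : Prop where
  mono : ∀ n, Monotone (p n)
  left : ∀ n, p n 0 = 0
  right : ∀ n, p n (m n) = t
  mesh : ∀ δ : ℝ≥0, 0 < δ → ∀ᶠ n in atTop, ∀ k < m n, p n (k + 1) < p n k + δ

/-- Lebesgue measure on the time axis `[0, ∞)`. -/
def timeMeasure : Measure ℝ≥0 := (volume : Measure ℝ).comap (fun t : ℝ≥0 => (t : ℝ))

/-- `I` is the stochastic integral `∫₀ᵗ H_{s-} dB_s` of an adapted process `H` with right-continuous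
paths with left limits: the limit in probability of the left-point Riemann sums, along every
sequence of partitions of `[0, t]` with mesh tending to `0`. -/
def IsItoIntegral (P : Measure Ω) (H B : ℝ≥0 → Ω → ℝ) (t : ℝ≥0) (I : Ω → ℝ) : Prop :=
  ∀ (p : ℕ → ℕ → ℝ≥0) (m : ℕ → ℕ), IsPartitionSequence t p m →
    TendstoInMeasure P
      (fun n ω => ∑ k ∈ Finset.range (m n), H (p n k) ω * (B (p n (k + 1)) ω - B (p n k) ω))
      atTop I

/-- The path `x` is right-continuous with left limits on `[0, T]`. -/
def IsCadlagOn (T : ℝ≥0) (x : ℝ≥0 → ℝ) : Prop :=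
  (∀ t < T, ContinuousWithinAt x (Set.Ici t) t) ∧ ∀ t ≤ T, ∃ l, Tendsto x (𝓝[<] t) (𝓝 l)

/-- `X` is adapted on `[0, T]` to the right-continuous filtration induced by the completions of
the σ-fields `𝒢 s`: for all `s > t`, `X t` is a.s. equal to a `𝒢 s`-measurable variable. -/
def IsAdaptedOn (P : Measure Ω) (𝒢 : ℝ≥0 → MeasurableSpace Ω) (T : ℝ≥0)
    (X : ℝ≥0 → Ω → ℝ) : Prop :=
  ∀ t ≤ T, ∀ s > t, AEStronglyMeasurable[𝒢 s] (X t) P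

/-- `X` solves, on `[0, T]`,
`X₀ = x₀`, `dX_t / X_{t-} = a dt + b dB_t + c dB⁰_t + ∫_E g(e) N(dt, de)`
(with coefficients that may depend on `ω`), i.e. `X` is adapted, has right-continuous paths with
left limits, and satisfies the corresponding integral equation. -/
structure SolvesLinearSDE {E : Type*} [MeasurableSpace E] (P : Measure Ω)
    (𝒢 : ℝ≥0 → MeasurableSpace Ω) (T : ℝ≥0) (B B0 : ℝ≥0 → Ω → ℝ) (N : Ω → Measure (ℝ≥0 × E))
    (x0 a b c : Ω → ℝ) (g : Ω → E → ℝ) (X : ℝ≥0 → Ω → ℝ) : Prop where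
  adapted : IsAdaptedOn P 𝒢 T X
  cadlag : ∀ᵐ ω ∂P, IsCadlagOn T (fun t => X t ω)
  equation : ∀ t ≤ T, ∃ I I0 : Ω → ℝ, IsItoIntegral P X B t I ∧ IsItoIntegral P X B0 t I0 ∧
    ∀ᵐ ω ∂P, X t ω = x0 ω + a ω * (∫ s in (0 : ℝ)..t, X s.toNNReal ω) + b ω * I ω + c ω * I0 ω
      + ∫ q in Set.Icc 0 t ×ˢ Set.univ,
          Function.leftLim (fun s => X s ω) q.1 * g ω q.2 ∂(N ω)

end Wealth

/-! ### The market with infinitely many investors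

Investors are indexed by `ℕ`. The mark space is `Ec × (ℕ → Ei)`: a common mark and one idiosyncratic
mark for each investor. -/

section Market

variable {Ω S Ec Ei : Type*} [MeasurableSpace Ω] [MeasurableSpace S] [MeasurableSpace Ec]
  [MeasurableSpace Ei]

/-- The intensity `lam · (νᶜ ⊗ ⨂ⱼ νⁱ)` of marks. -/
def markIntensity (lam : ℝ≥0) (νc : Measure Ec) (νi : Measure Ei) [IsProbabilityMeasure νi] :
    Measure (Ec × (ℕ → Ei)) :=
  lam • νc.prod (Measure.infinitePi fun _ : ℕ => νi)

/-- The intensity `lam · (νᶜ ⊗ νⁱ)` of marks seen by a single investor. -/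
def investorIntensity (lam : ℝ≥0) (νc : Measure Ec) (νi : Measure Ei) : Measure (Ec × Ei) :=
  lam • νc.prod νi

/-- The sources of randomness. -/
inductive Source where
  | type (j : ℕ)
  | idiosyncratic (j : ℕ)
  | common
  | poisson

/-- The σ-field generated by a source of randomness. -/
@[reducible]
def sourceSigma (τ : ℕ → Ω → S) (W0 : ℝ≥0 → Ω → ℝ) (W : ℕ → ℝ≥0 → Ω → ℝ)
    (N : Ω → Measure (ℝ≥0 × Ec × (ℕ → Ei))) : Source → MeasurableSpace Ω
  | .type j => MeasurableSpace.comap (τ j) inferInstance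
  | .idiosyncratic j => ⨆ t, MeasurableSpace.comap (W j t) inferInstance
  | .common => ⨆ t, MeasurableSpace.comap (W0 t) inferInstance
  | .poisson => MeasurableSpace.comap N inferInstance

/-- The random inputs of the model: the types `τ j` of the investors are i.i.d. with law `𝕋`, `W0`
and the `W j` are standard Brownian motions, `N` is a Poisson random measure with intensity
`dt ⊗ lam (νᶜ ⊗ ⨂ⱼ νⁱ)`, and all of these are independent. -/
structure IsMarketNoise (P : Measure Ω) (𝕋 : Measure S) (lam : ℝ≥0) (νc : Measure Ec)
    (νi : Measure Ei) [IsProbabilityMeasure νi] (τ : ℕ → Ω → S) (W0 : ℝ≥0 → Ω → ℝ)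
    (W : ℕ → ℝ≥0 → Ω → ℝ) (N : Ω → Measure (ℝ≥0 × Ec × (ℕ → Ei))) : Prop where
  measurable_type : ∀ j, Measurable (τ j)
  type_law : ∀ j, P.map (τ j) = 𝕋
  measurable_common : ∀ t, Measurable (W0 t)
  brownian_common : IsBrownianReal W0 P
  measurable_idiosyncratic : ∀ j t, Measurable (W j t)
  brownian_idiosyncratic : ∀ j, IsBrownianReal (W j) P
  poisson : IsPoissonRandomMeasure N
    (timeMeasure.prod (markIntensity lam νc νi)) P
  indep : iIndep (sourceSigma τ W0 W N) P

/-- The information generated by the types and by the noise up to time `t`. -/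
@[reducible]
def information (τ : ℕ → Ω → S) (W0 : ℝ≥0 → Ω → ℝ) (W : ℕ → ℝ≥0 → Ω → ℝ)
    (N : Ω → Measure (ℝ≥0 × Ec × (ℕ → Ei))) (t : ℝ≥0) : MeasurableSpace Ω :=
  (⨆ j, MeasurableSpace.comap (τ j) inferInstance)
    ⊔ (⨆ s ∈ Set.Iic t, MeasurableSpace.comap (W0 s) inferInstance)
    ⊔ (⨆ j, ⨆ s ∈ Set.Iic t, MeasurableSpace.comap (W j s) inferInstance)
    ⊔ (⨆ s ∈ Set.Iic t, ⨆ A ∈ {A : Set (Ec × (ℕ → Ei)) | MeasurableSet A},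
        MeasurableSpace.comap (fun ω => N ω (Set.Icc 0 s ×ˢ A)) inferInstance)

/-- The relative wealth jump `φ(ζ(e)) η(e)` at the mark `e` of an investor of type `θ` with the
signal-driven strategy `φ`. -/
def jumpReturn {E : Type*} [MeasurableSpace E] (θ : InvestorType E) (φ : ℝ → ℝ) (e : E) : ℝ :=
  φ (θ.zeta e) * θ.eta e

/-- `X` is the wealth process of investor `j`, of the sampled type `ty (τ j ω)`, who uses the
signal-driven strategy `π (τ j ω)`: it starts from `x₀` and satisfies
`dX_t / X_{t-} = (r + π(0)(κ - r)) dt + σ π(0) dWʲ_t + σ⁰ π(0) dW⁰_t + ∫ η(e) π(ζ(e)) N(dt, de)`,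
where `η`, `ζ` are evaluated at the common mark and the `j`-th idiosyncratic mark. -/
def IsWealthProcess (P : Measure Ω) (T : ℝ≥0) (ty : S → InvestorType (Ec × Ei))
    (π : S → ℝ → ℝ) (τ : ℕ → Ω → S) (W0 : ℝ≥0 → Ω → ℝ) (W : ℕ → ℝ≥0 → Ω → ℝ)
    (N : Ω → Measure (ℝ≥0 × Ec × (ℕ → Ei))) (j : ℕ) (X : ℝ≥0 → Ω → ℝ) : Prop :=
  SolvesLinearSDE P (information τ W0 W N) T (W j) W0 N
    (fun ω => (ty (τ j ω)).x0)
    (fun ω => (ty (τ j ω)).r + π (τ j ω) 0 * ((ty (τ j ω)).kappa - (ty (τ j ω)).r))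
    (fun ω => (ty (τ j ω)).sigma * π (τ j ω) 0)
    (fun ω => (ty (τ j ω)).sigma0 * π (τ j ω) 0)
    (fun ω e => jumpReturn (ty (τ j ω)) (π (τ j ω)) (e.1, e.2 j))
    X

/-- The geometric average wealth `(∏_{j ≠ i} X^j_t)^{1/n}` of the `n` peers of investor `i` among
the `n + 1` investors `0, …, n`. -/
def peerAverage (X : ℕ → ℝ≥0 → Ω → ℝ) (i n : ℕ) (t : ℝ≥0) (ω : Ω) : ℝ :=
  (∏ j ∈ (Finset.range (n + 1)).erase i, X j t ω) ^ (1 / (n : ℝ))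

/-- `r + π(0)(κ - r) - ½ (σ² + (σ⁰)²) π(0)²` for the type `θ` and the strategy `φ`. -/
def logDrift {E : Type*} [MeasurableSpace E] (θ : InvestorType E) (φ : ℝ → ℝ) : ℝ :=
  θ.r + φ 0 * (θ.kappa - θ.r) - 1 / 2 * (θ.sigma ^ 2 + θ.sigma0 ^ 2) * φ 0 ^ 2

/-- The mean initial wealth `exp ∫ log x₀ d𝕋`. -/
def meanInitial {E : Type*} [MeasurableSpace E] (𝕋 : Measure S) (ty : S → InvestorType E) : ℝ :=
  Real.exp (∫ s, Real.log (ty s).x0 ∂𝕋)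

/-- The mean drift. -/
def meanDrift {E : Type*} [MeasurableSpace E] (𝕋 : Measure S) (ty : S → InvestorType E)
    (π : S → ℝ → ℝ) : ℝ :=
  ∫ s, logDrift (ty s) (π s) ∂𝕋

/-- The mean common volatility `∫ σ⁰ π(0) d𝕋`. -/
def meanCommonVol {E : Type*} [MeasurableSpace E] (𝕋 : Measure S) (ty : S → InvestorType E)
    (π : S → ℝ → ℝ) : ℝ :=
  ∫ s, (ty s).sigma0 * π s 0 ∂𝕋

/-- The mean jump factor at the common mark `ec`, the exponential of the average over types and
idiosyncratic marks of `log (1 + π(ζ(ec, ei)) η(ec, ei))`. -/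
def meanJump (𝕋 : Measure S) (νi : Measure Ei) (ty : S → InvestorType (Ec × Ei))
    (π : S → ℝ → ℝ) (ec : Ec) : ℝ :=
  Real.exp (∫ q : S × Ei, Real.log (1 + jumpReturn (ty q.1) (π q.1) (ec, q.2)) ∂(𝕋.prod νi))

/-- The random measure `N(ds, deᶜ, E^{⊗i})` of jump times and common marks. -/
def commonJumps (N : Ω → Measure (ℝ≥0 × Ec × (ℕ → Ei))) (ω : Ω) : Measure (ℝ≥0 × Ec) :=
  (N ω).map fun q => (q.1, q.2.1)

end Market

end JumpSignalGame

end

noncomputable section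

namespace JumpSignalGame

/-! ### Paths -/

/-! Write `a` for the drift `r + π(0)(κ - r)`, `b = σπ(0)` and `c = σ⁰π(0)` for the volatilities,
and `γ` for the relative jump. The wealth equation is linear, and almost surely its only solution is
the stochastic exponential `x₀ exp((a - (b² + c²)/2) t + b Wʲ + c W⁰) ∏ (1 + γ)`, the product
running over the finitely many atoms of `N` up to `t`. Admissibility makes every factor `1 + γ`
positive. The logarithm of the geometric average is then an arithmetic average of five terms, and
each of them obeys a strong law of large numbers.

Identification of the wealth (`IsNoiseFiltration.ae_eq_jumpSolution`). Stochastic integrals are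
known only as limits in probability of left-point sums. The filtration is enlarged so that all types
and `N` are known at time `0`. By independence `Wʲ` and `W⁰` stay Brownian, while coefficients and
jumps become initial data. The explicit process is handled by an Itô formula obtained from second
moments of dyadic sums (`IsNoiseFiltration.ae_tendsto_sum_expPath`). Between jumps, the difference
of two solutions is the limit of its own sums against `a dt + b dB + c dB⁰`, so a Gronwall argument
in L² makes it vanish (`IsNoiseFiltration.eq_zero_of_tendsto_sum`). Induction on the number of jumps
carries this across the jump times.

Laws of large numbers. One exceptional event has to serve all `t`. For the initial wealth, the drift
and the common noise this is immediate, since time enters only through a common factor. For the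
idiosyncratic noise, dyadic chaining with fourth moments bounds the oscillation of each path by an
integrable variable of small mean (`IsMarketNoise.strong_law_idiosyncratic`). For the jumps, the
pairs of type and idiosyncratic mark are i.i.d. once the common mark is fixed. By Fubini the marks
violating the law form a null set for almost every sequence of types, and `N`, being independent of
the types, does not charge this random null set (`IsMarketNoise.strong_law_jumps`,
`IsPoissonRandomMeasure.ae_ae_notMem`). -/

lemma IsCadlagOn.exists_bound {T : ℝ≥0} {x : ℝ≥0 → ℝ} (hx : IsCadlagOn T x) :
    ∃ C : ℝ, ∀ t ≤ T, |x t| ≤ C := by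
  have key : ∀ t ≤ T, ∃ C : ℝ, ∀ᶠ s in 𝓝 t, s ≤ T → |x s| ≤ C := by
    intro t ht
    obtain ⟨l, hl⟩ := hx.2 t ht
    have h1 : ∀ᶠ s in 𝓝[<] t, |x s| ≤ |l| + 1 :=
      (hl.abs.eventually (gt_mem_nhds (lt_add_one |l|))).mono fun s hs => hs.le
    have h2 : ∀ᶠ s in 𝓝[≥] t, s ≤ T → |x s| ≤ |x t| + 1 := by
      -- At `T` right-continuity is not part of the hypothesis, but `T` itself is then the only
      -- point to bound.
      rcases ht.lt_or_eq with h | h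
      · exact ((hx.1 t h).abs.eventually (gt_mem_nhds (lt_add_one |x t|))).mono
          fun s hs _ => hs.le
      · filter_upwards [self_mem_nhdsWithin] with s hs hsT
        have : s = t := le_antisymm (hsT.trans h.ge) hs
        rw [this]; linarith
    refine ⟨max (|l| + 1) (|x t| + 1), ?_⟩
    rw [← nhdsLT_sup_nhdsGE t]
    refine eventually_sup.2 ⟨h1.mono fun s hs _ => hs.trans (le_max_left _ _),
      h2.mono fun s hs hsT => (hs hsT).trans (le_max_right _ _)⟩
  have := (isCompact_Icc (a := (0 : ℝ≥0)) (b := T)).induction_on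
    (p := fun S => ∃ C : ℝ, ∀ s ∈ S, s ≤ T → |x s| ≤ C) ⟨0, by simp⟩
    (fun s t hst ⟨C, hC⟩ => ⟨C, fun u hu => hC u (hst hu)⟩)
    (fun s t ⟨C, hC⟩ ⟨D, hD⟩ => ⟨max C D, fun u hu huT => hu.elim
      (fun h => (hC u h huT).trans (le_max_left _ _))
      (fun h => (hD u h huT).trans (le_max_right _ _))⟩)
    (fun t ht => by
      obtain ⟨C, hC⟩ := key t ht.2
      exact ⟨_, mem_nhdsWithin_of_mem_nhds hC, C, fun s hs => hs⟩)
  obtain ⟨C, hC⟩ := this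
  exact ⟨C, fun t ht => hC t ⟨zero_le, ht⟩ ht⟩

/-- The point `k t / 2ⁿ` of the `n`-th dyadic partition of `[0, t]`. -/
def dyadicPoint (t : ℝ≥0) (n k : ℕ) : ℝ≥0 := t * (k / 2 ^ n)

lemma dyadicPoint_zero (t : ℝ≥0) (n : ℕ) : dyadicPoint t n 0 = 0 := by simp [dyadicPoint]

lemma dyadicPoint_last (t : ℝ≥0) (n : ℕ) : dyadicPoint t n (2 ^ n) = t := by simp [dyadicPoint]

lemma dyadicPoint_mono (t : ℝ≥0) (n : ℕ) : Monotone (dyadicPoint t n) := by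
  intro k l h
  unfold dyadicPoint
  gcongr

lemma dyadicPoint_le {t : ℝ≥0} {n k : ℕ} (h : k ≤ 2 ^ n) : dyadicPoint t n k ≤ t :=
  (dyadicPoint_mono t n h).trans_eq (dyadicPoint_last t n)

lemma dyadicPoint_succ (t : ℝ≥0) (n k : ℕ) :
    dyadicPoint t n (k + 1) = dyadicPoint t n k + t / 2 ^ n := by
  simp only [dyadicPoint, Nat.cast_add, Nat.cast_one]
  field_simp

lemma coe_dyadicPoint (t : ℝ≥0) (n k : ℕ) : (dyadicPoint t n k : ℝ) = t * (k / 2 ^ n) := by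
  simp [dyadicPoint]

lemma dyadicPoint_succ_sub (t : ℝ≥0) (n k : ℕ) :
    (dyadicPoint t n (k + 1) : ℝ) - dyadicPoint t n k = t / 2 ^ n := by
  rw [dyadicPoint_succ]; push_cast; ring

lemma tendsto_div_two_pow (t : ℝ) : Tendsto (fun n : ℕ => t / 2 ^ n) atTop (𝓝 0) :=
  tendsto_const_nhds.div_atTop (tendsto_pow_atTop_atTop_of_one_lt one_lt_two)

lemma isPartitionSequence_dyadicPoint (t : ℝ≥0) {ns : ℕ → ℕ} (hns : Tendsto ns atTop atTop) :
    IsPartitionSequence t (fun n => dyadicPoint t (ns n)) (fun n => 2 ^ ns n) where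
  mono n := dyadicPoint_mono t _
  left n := dyadicPoint_zero t _
  right n := dyadicPoint_last t _
  mesh δ hδ := by
    have h : ∀ᶠ n : ℕ in atTop, (t : ℝ) / 2 ^ n < δ :=
      (tendsto_div_two_pow t).eventually (gt_mem_nhds (by exact_mod_cast hδ))
    filter_upwards [hns.eventually h] with n hn k _
    rw [dyadicPoint_succ]
    have : t / 2 ^ ns n < δ := by exact_mod_cast hn
    gcongr

/-- The index of the first point of the `n`-th dyadic partition of `[0, t]` at or after `s`. -/
def dyadicIndex (t : ℝ) (n : ℕ) (s : ℝ) : ℕ := ⌈s * 2 ^ n / t⌉₊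

lemma dyadicIndex_eq {t : ℝ≥0} (ht : 0 < t) {n k : ℕ} {s : ℝ}
    (h1 : (dyadicPoint t n k : ℝ) < s) (h2 : s ≤ dyadicPoint t n (k + 1)) :
    dyadicIndex t n s = k + 1 := by
  have ht' : (0 : ℝ) < t := by exact_mod_cast ht
  rw [coe_dyadicPoint] at h1 h2
  rw [dyadicIndex, Nat.ceil_eq_iff (by omega)]
  constructor
  · rw [lt_div_iff₀ ht']
    field_simp at h1
    simp only [Nat.add_sub_cancel]
    linarith
  · rw [div_le_iff₀ ht']
    field_simp at h2
    push_cast at h2 ⊢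
    linarith

lemma le_dyadicPoint_dyadicIndex {t : ℝ≥0} (ht : 0 < t) (n : ℕ) (s : ℝ) :
    s ≤ dyadicPoint t n (dyadicIndex t n s) := by
  have ht' : (0 : ℝ) < t := by exact_mod_cast ht
  have := Nat.le_ceil (s * 2 ^ n / t)
  rw [coe_dyadicPoint, dyadicIndex]
  calc s = t * (s * 2 ^ n / t / 2 ^ n) := by field_simp
    _ ≤ _ := by gcongr

lemma dyadicPoint_dyadicIndex_lt {t : ℝ≥0} (ht : 0 < t) (n : ℕ) {s : ℝ} (hs : 0 < s) :
    (dyadicPoint t n (dyadicIndex t n s) : ℝ) < s + t / 2 ^ n := by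
  have ht' : (0 : ℝ) < t := by exact_mod_cast ht
  have := Nat.ceil_lt_add_one (a := s * 2 ^ n / t) (by positivity)
  rw [coe_dyadicPoint, dyadicIndex]
  calc _ < t * ((s * 2 ^ n / t + 1) / 2 ^ n) := by gcongr
    _ = s + t / 2 ^ n := by field_simp

lemma dyadicIndex_le {t : ℝ≥0} (ht : 0 < t) (n : ℕ) {s : ℝ} (hs : s ≤ t) :
    dyadicIndex t n s ≤ 2 ^ n := by
  have ht' : (0 : ℝ) < t := by exact_mod_cast ht
  rw [dyadicIndex, Nat.ceil_le, div_le_iff₀ ht']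
  push_cast
  rw [mul_comm]
  gcongr

lemma tendsto_dyadicPoint_dyadicIndex {t : ℝ≥0} (ht : 0 < t) {s : ℝ≥0} (hs : 0 < s) :
    Tendsto (fun n => dyadicPoint t n (dyadicIndex t n s)) atTop (𝓝[≥] s) := by
  refine tendsto_nhdsWithin_iff.2 ⟨?_, Eventually.of_forall fun n => ?_⟩
  · rw [← NNReal.tendsto_coe]
    refine tendsto_of_tendsto_of_tendsto_of_le_of_le (g := fun _ => (s : ℝ))
      (h := fun n => (s : ℝ) + t / 2 ^ n) tendsto_const_nhds ?_
      (fun n => le_dyadicPoint_dyadicIndex ht n s)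
      (fun n => (dyadicPoint_dyadicIndex_lt ht n (by exact_mod_cast hs)).le)
    simpa using (tendsto_div_two_pow (t : ℝ)).const_add (s : ℝ)
  · exact_mod_cast le_dyadicPoint_dyadicIndex ht n s

/-- Left Riemann sums of a càdlàg path converge to its integral. -/
lemma IsCadlagOn.tendsto_riemannSum {T : ℝ≥0} {x : ℝ≥0 → ℝ} (hx : IsCadlagOn T x) {t : ℝ≥0}
    (ht : t ≤ T) :
    Tendsto (fun n : ℕ => ∑ k ∈ Finset.range (2 ^ n), x (dyadicPoint t n k) * (t / 2 ^ n))
      atTop (𝓝 (∫ s in (0 : ℝ)..t, x s.toNNReal)) := by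
  rcases eq_or_ne t 0 with rfl | ht0
  · simp
  have htpos : 0 < t := pos_iff_ne_zero.2 ht0
  have htpos' : (0 : ℝ) < t := by exact_mod_cast htpos
  obtain ⟨C, hC⟩ := hx.exists_bound
  -- Right endpoints come first: they approach `s` from the right, where the path is continuous, so
  -- dominated convergence applies. Left and right sums differ by the telescoping term `(x t - x 0)
  -- * (t / 2 ^ n)`.
  set F : ℕ → ℝ → ℝ := fun n s => x (dyadicPoint t n (dyadicIndex t n s)) with hF
  have hFm : ∀ n, Measurable (F n) := fun n =>
    (measurable_from_nat (f := fun k => x (dyadicPoint t n k))).comp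
      (Nat.measurable_ceil.comp (by fun_prop))
  have hright : ∀ n : ℕ, ∑ k ∈ Finset.range (2 ^ n), x (dyadicPoint t n (k + 1)) * (t / 2 ^ n)
      = ∫ s in (0 : ℝ)..t, F n s := by
    intro n
    have hpiece : ∀ k : ℕ, Set.EqOn (fun _ => x (dyadicPoint t n (k + 1))) (F n)
        (Set.uIoc (dyadicPoint t n k : ℝ) (dyadicPoint t n (k + 1))) := by
      intro k s hs
      rw [Set.uIoc_of_le (by exact_mod_cast dyadicPoint_mono t n (Nat.le_succ k))] at hs
      simp only [hF, dyadicIndex_eq htpos hs.1 hs.2]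
    have hsum := intervalIntegral.sum_integral_adjacent_intervals (f := F n) (μ := volume)
      (a := fun k => (dyadicPoint t n k : ℝ)) (n := 2 ^ n) (fun k _ =>
        (intervalIntegrable_const (c := x (dyadicPoint t n (k + 1)))).congr (hpiece k))
    rw [dyadicPoint_zero, dyadicPoint_last] at hsum
    rw [NNReal.coe_zero] at hsum
    rw [← hsum]
    refine Finset.sum_congr rfl fun k _ => ?_
    rw [← intervalIntegral.integral_congr_ae (Eventually.of_forall fun s hs => hpiece k hs),
      intervalIntegral.integral_const,
      dyadicPoint_succ_sub, smul_eq_mul, mul_comm]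
  have hlim : Tendsto (fun n => ∫ s in (0 : ℝ)..t, F n s) atTop
      (𝓝 (∫ s in (0 : ℝ)..t, x s.toNNReal)) := by
    refine intervalIntegral.tendsto_integral_filter_of_dominated_convergence (fun _ => C)
      (Eventually.of_forall fun n => (hFm n).aestronglyMeasurable)
      (Eventually.of_forall fun n => Eventually.of_forall fun s hs => ?_)
      intervalIntegrable_const ?_
    · rw [Set.uIoc_of_le htpos'.le] at hs
      exact hC _ ((dyadicPoint_le (dyadicIndex_le htpos n hs.2)).trans ht)
    -- The point `s = t` is discarded because right-continuity may fail there when `t = T`.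
    · have : ∀ᵐ s : ℝ, s ≠ t := by simp [ae_iff]
      filter_upwards [this] with s hst hs
      rw [Set.uIoc_of_le htpos'.le] at hs
      have hs' : (s.toNNReal : ℝ) = s := Real.coe_toNNReal s hs.1.le
      have h := tendsto_dyadicPoint_dyadicIndex htpos (Real.toNNReal_pos.2 hs.1)
      rw [hs'] at h
      refine Tendsto.comp (hx.1 _ ?_) h
      rw [← NNReal.coe_lt_coe, hs']
      exact (lt_of_le_of_ne hs.2 hst).trans_le (by exact_mod_cast ht)
  have hdiff : Tendsto (fun n : ℕ => (x t - x 0) * ((t : ℝ) / 2 ^ n)) atTop (𝓝 0) := by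
    simpa using (tendsto_div_two_pow (t : ℝ)).const_mul (x t - x 0)
  have := hlim.sub hdiff
  rw [sub_zero] at this
  refine this.congr fun n => ?_
  rw [← hright n]
  have := Finset.sum_range_sub (fun k => x (dyadicPoint t n k)) (2 ^ n)
  rw [dyadicPoint_zero, dyadicPoint_last] at this
  rw [← this, Finset.sum_mul, ← Finset.sum_sub_distrib]
  exact Finset.sum_congr rfl fun k _ => by ring

/-- Riemann-Stieltjes sums against a path with finitely many jumps. -/
lemma tendsto_sum_jump_mul {t : ℝ≥0} (A : Finset ℝ≥0) (hA : ∀ u ∈ A, 0 < u) (h : ℝ≥0 → ℝ)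
    {e : ℝ≥0 → ℝ} (he : Continuous e) :
    Tendsto (fun n : ℕ => ∑ k ∈ Finset.range (2 ^ n),
        ((∏ u ∈ A with u ≤ dyadicPoint t n (k + 1), (1 + h u))
          - ∏ u ∈ A with u ≤ dyadicPoint t n k, (1 + h u)) * e (dyadicPoint t n (k + 1)))
      atTop (𝓝 (∑ u ∈ A with u ≤ t, h u * (∏ v ∈ A with v < u, (1 + h v)) * e u)) := by
  set J : ℝ≥0 → ℝ := fun u => h u * ∏ v ∈ A with v < u, (1 + h v) with hJ
  -- The product is a pure jump function of time whose jump at `u` is `J u`, so its increments split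
  -- into single jumps.
  have hprod : ∀ s : ℝ≥0, ∏ u ∈ A with u ≤ s, (1 + h u) = 1 + ∑ u ∈ A with u ≤ s, J u := by
    intro s
    rw [Finset.prod_one_add_ordered]
    congr 1
    refine Finset.sum_congr rfl fun u hu => ?_
    have hus := (Finset.mem_filter.1 hu).2
    rw [hJ]
    simp only
    congr 1
    refine Finset.prod_congr ?_ fun _ _ => rfl
    ext v
    simp only [Finset.mem_filter]
    exact ⟨fun hv => ⟨hv.1.1, hv.2⟩, fun hv => ⟨⟨hv.1, hv.2.le.trans hus⟩, hv.2⟩⟩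
  -- Exactly one interval of the partition, open on the left, contains a given `u ≤ t`. Its right
  -- end has index `dyadicIndex t n u` and tends to `u`.
  have hone : ∀ u ∈ A, Tendsto (fun n : ℕ => ∑ k ∈ Finset.range (2 ^ n),
      (if dyadicPoint t n k < u ∧ u ≤ dyadicPoint t n (k + 1) then
        e (dyadicPoint t n (k + 1)) else 0)) atTop (𝓝 (if u ≤ t then e u else 0)) := by
    intro u hu
    split_ifs with hut
    · have htpos : 0 < t := (hA u hu).trans_le hut
      have h1 := (he.tendsto u).comp
        ((tendsto_dyadicPoint_dyadicIndex htpos (hA u hu)).mono_right nhdsWithin_le_nhds)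
      refine h1.congr fun n => ?_
      have hpos : 0 < dyadicIndex t n u := by
        have htpos' : (0 : ℝ) < t := by exact_mod_cast htpos
        have hu' : (0 : ℝ) < u := by exact_mod_cast hA u hu
        rw [dyadicIndex, Nat.ceil_pos]
        positivity
      have hle := dyadicIndex_le htpos n (s := u) (by exact_mod_cast hut)
      obtain ⟨m, hm⟩ := Nat.exists_eq_succ_of_ne_zero hpos.ne'
      rw [Finset.sum_eq_single m]
      · have h2 := le_dyadicPoint_dyadicIndex htpos n u
        have h3 := dyadicPoint_dyadicIndex_lt htpos n (s := u) (by exact_mod_cast hA u hu)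
        rw [hm] at h2 h3
        have h4 := dyadicPoint_succ_sub t n m
        have h3' : dyadicPoint t n m < u := by
          rw [← NNReal.coe_lt_coe]
          simp only [Nat.succ_eq_add_one] at h3
          linarith
        rw [if_pos ⟨h3', by exact_mod_cast h2⟩]
        simp [hm]
      · intro k _ hkm
        rw [if_neg]
        rintro ⟨h2, h3⟩
        have := dyadicIndex_eq htpos (s := u) (by exact_mod_cast h2) (by exact_mod_cast h3)
        omega
      · intro hmem
        exact absurd (Finset.mem_range.2 (by omega)) hmem
    · refine tendsto_const_nhds.congr fun n => (Finset.sum_eq_zero fun k hk => ?_).symm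
      rw [if_neg]
      rintro ⟨-, h3⟩
      exact hut (h3.trans (dyadicPoint_le (Finset.mem_range.1 hk)))
  have hsum := tendsto_finsetSum A fun u hu => (hone u hu).const_mul (J u)
  have hfin : ∑ u ∈ A with u ≤ t, h u * (∏ v ∈ A with v < u, (1 + h v)) * e u
      = ∑ u ∈ A, J u * (if u ≤ t then e u else 0) := by
    rw [Finset.sum_filter]
    refine Finset.sum_congr rfl fun u _ => ?_
    split_ifs <;> simp [hJ]
  rw [hfin]
  refine hsum.congr fun n => ?_
  simp_rw [hprod, Finset.mul_sum]
  rw [Finset.sum_comm]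
  refine Finset.sum_congr rfl fun k _ => ?_
  simp only [Finset.sum_filter, add_sub_add_left_eq_sub]
  rw [← Finset.sum_sub_distrib, Finset.sum_mul]
  refine Finset.sum_congr rfl fun u _ => ?_
  have hmono := dyadicPoint_mono t n (Nat.le_succ k)
  by_cases h1 : u ≤ dyadicPoint t n k
  · simp [h1, h1.trans hmono, not_lt.2 h1]
  · by_cases h2 : u ≤ dyadicPoint t n (k + 1) <;> simp [h1, h2, not_le.1 h1]

/-- The left limit exists in the sense of `Function.leftLim` and is `l` as soon as `x` tends to `l`
from the left at a positive time. -/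
lemma leftLim_eq_of_tendsto_pos {x : ℝ≥0 → ℝ} {u : ℝ≥0} (hu : 0 < u) {l : ℝ}
    (h : Tendsto x (𝓝[<] u) (𝓝 l)) : Function.leftLim x u = l :=
  haveI := nhdsLT_neBot_of_exists_lt ⟨0, hu⟩
  leftLim_eq_of_tendsto h

/-! ### Geometric averages -/

/-- The omitted term contributes `y i / n → 0`, and the normalization changes by the factor `(n + 1)
/ n → 1`. -/
lemma tendsto_average_erase {y : ℕ → ℝ} {L : ℝ}
    (h : Tendsto (fun n : ℕ => (∑ j ∈ Finset.range n, y j) / n) atTop (𝓝 L)) (i : ℕ) :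
    Tendsto (fun n : ℕ => (∑ j ∈ (Finset.range (n + 1)).erase i, y j) / n) atTop (𝓝 L) := by
  have h1 := (tendsto_add_atTop_iff_nat 1).2 h
  have h2 : Tendsto (fun n : ℕ => ((n : ℝ) + 1) / n) atTop (𝓝 1) := by
    have := (tendsto_const_nhds (x := (1 : ℝ))).add (tendsto_one_div_atTop_nhds_zero_nat (𝕜 := ℝ))
    rw [add_zero] at this
    refine this.congr' ?_
    filter_upwards [eventually_gt_atTop 0] with n hn
    have : (n : ℝ) ≠ 0 := by positivity
    field_simp
  have h3 : Tendsto (fun n : ℕ => y i / n) atTop (𝓝 0) :=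
    tendsto_const_nhds.div_atTop tendsto_natCast_atTop_atTop
  have h4 := (h1.mul h2).sub h3
  rw [mul_one, sub_zero] at h4
  refine h4.congr' ?_
  filter_upwards [eventually_ge_atTop (i + 1)] with n hn
  have hi : i ∈ Finset.range (n + 1) := Finset.mem_range.2 (by omega)
  have : (n : ℝ) ≠ 0 := by
    have : 0 < n := by omega
    positivity
  have h5 : ((n : ℝ) + 1) ≠ 0 := by positivity
  rw [← Finset.sum_erase_add _ _ hi]
  push_cast
  field_simp
  ring

lemma tendsto_geometricAverage {y : ℕ → ℝ} (hy : ∀ j, 0 < y j) {L : ℝ}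
    (h : Tendsto (fun n : ℕ => (∑ j ∈ Finset.range n, Real.log (y j)) / n) atTop (𝓝 L)) (i : ℕ) :
    Tendsto (fun n : ℕ => (∏ j ∈ (Finset.range (n + 1)).erase i, y j) ^ (1 / (n : ℝ))) atTop
      (𝓝 (Real.exp L)) := by
  refine ((Real.continuous_exp.tendsto L).comp (tendsto_average_erase h i)).congr fun n => ?_
  rw [Real.rpow_def_of_pos (Finset.prod_pos fun j _ => hy j),
    Real.log_prod (fun j _ => (hy j).ne')]
  simp [div_eq_mul_inv]

/-! ### Independence -/

section Independence

variable {Ω : Type*} {mΩ : MeasurableSpace Ω} {P : Measure Ω} [IsProbabilityMeasure P]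

/-- If the `m i` are independent and contain independent `A i`, `B i`, then the suprema of the `A i`
and of the `B i` are independent. -/
lemma indep_iSup_iSup {ι : Type*} {m A B : ι → MeasurableSpace Ω} (hm : iIndep m P)
    (hmle : ∀ i, m i ≤ mΩ) (hA : ∀ i, A i ≤ m i) (hB : ∀ i, B i ≤ m i)
    (hAB : ∀ i, Indep (A i) (B i) P) : Indep (⨆ i, A i) (⨆ i, B i) P := by
  classical
  have hgen : ∀ m' : ι → MeasurableSpace Ω, ⨆ i, m' i
      = MeasurableSpace.generateFrom
        (piiUnionInter (fun n => {s | MeasurableSet[m' n] s}) Set.univ) := by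
    intro m'
    refine (Eq.trans ?_ (generateFrom_piiUnionInter_measurableSet m' Set.univ).symm)
    simp
  have hpi : ∀ m' : ι → MeasurableSpace Ω,
      IsPiSystem (piiUnionInter (fun n => {s | MeasurableSet[m' n] s}) Set.univ) := fun m' =>
    isPiSystem_piiUnionInter _ (fun x => @MeasurableSpace.isPiSystem_measurableSet _ (m' x)) _
  refine IndepSets.indep (iSup_le fun i => (hA i).trans (hmle i))
    (iSup_le fun i => (hB i).trans (hmle i)) (hpi A) (hpi B) (hgen A) (hgen B) ?_
  rw [IndepSets_iff]
  rintro _ _ ⟨I, -, f, hf, rfl⟩ ⟨J, -, g, hg, rfl⟩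
  -- Padding with `Set.univ` puts both intersections over the same index set `I ∪ J`. Independence
  -- of the `m i` then factors all three probabilities, and that of `A i` and `B i` factors each
  -- term.
  set f' : ι → Set Ω := fun i => if i ∈ I then f i else Set.univ
  set g' : ι → Set Ω := fun i => if i ∈ J then g i else Set.univ
  have hfs : ∀ i, MeasurableSet[A i] (f' i) := fun i => by
    by_cases h : i ∈ I <;> simp only [f', h, if_true, if_false]
    exacts [hf i h, MeasurableSet.univ]
  have hgs : ∀ i, MeasurableSet[B i] (g' i) := fun i => by
    by_cases h : i ∈ J <;> simp only [g', h, if_true, if_false]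
    exacts [hg i h, MeasurableSet.univ]
  have e1 : ⋂ i ∈ I, f i = ⋂ i ∈ I ∪ J, f' i := by
    ext ω
    simp only [Set.mem_iInter, Finset.mem_union, f']
    constructor
    · intro h i _
      by_cases hi : i ∈ I
      · simpa [hi] using h i hi
      · simp [hi]
    · intro h i hi
      simpa [hi] using h i (Or.inl hi)
  have e2 : ⋂ i ∈ J, g i = ⋂ i ∈ I ∪ J, g' i := by
    ext ω
    simp only [Set.mem_iInter, Finset.mem_union, g']
    constructor
    · intro h i _
      by_cases hi : i ∈ J
      · simpa [hi] using h i hi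
      · simp [hi]
    · intro h i hi
      simpa [hi] using h i (Or.inr hi)
  rw [e1, e2]
  have e3 : (⋂ i ∈ I ∪ J, f' i) ∩ ⋂ i ∈ I ∪ J, g' i = ⋂ i ∈ I ∪ J, f' i ∩ g' i := by
    ext ω
    simp only [Set.mem_inter_iff, Set.mem_iInter]
    exact ⟨fun h i hi => ⟨h.1 i hi, h.2 i hi⟩,
      fun h => ⟨fun i hi => (h i hi).1, fun i hi => (h i hi).2⟩⟩
  rw [e3]
  rw [iIndep_iff] at hm
  rw [hm _ (f := fun i => f' i ∩ g' i) fun i _ => (hA i _ (hfs i)).inter (hB i _ (hgs i)),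
    hm _ (f := f') fun i _ => hA i _ (hfs i), hm _ (f := g') fun i _ => hB i _ (hgs i),
    ← Finset.prod_mul_distrib]
  refine Finset.prod_congr rfl fun i _ => ?_
  exact (Indep_iff _ _ _).1 (hAB i) _ _ (hfs i) (hgs i)

/-- Independence of the future increments passes to the right limit of the past. -/
lemma indep_iInf_comap {E : Type*} [TopologicalSpace E] [MeasurableSpace E] [BorelSpace E]
    [HasOuterApproxClosed E] {𝓖 : ℕ → MeasurableSpace Ω}
    (h𝓖 : ∀ n, 𝓖 n ≤ mΩ) {Z : ℕ → Ω → E} {Z' : Ω → E} (hZ : ∀ n, Measurable (Z n))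
    (hZ' : Measurable Z')
    (hind : ∀ n, Indep (𝓖 n) (MeasurableSpace.comap (Z n) inferInstance) P)
    (hlim : ∀ᵐ ω ∂P, Tendsto (fun n => Z n ω) atTop (𝓝 (Z' ω))) :
    Indep (⨅ n, 𝓖 n) (MeasurableSpace.comap Z' inferInstance) P := by
  -- Bounded continuous test functions suffice, and they pass to the almost sure limit `Z n → Z'`.
  -- An event of the intersection is independent of every `Z n`.
  refine indep_comap_of_bcf ((iInf_le _ 0).trans (h𝓖 0)) hZ'.aemeasurable fun A hA f => ?_
  have hA0 : MeasurableSet A := h𝓖 0 _ (iInf_le 𝓖 0 _ hA)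
  have hn : ∀ n, ∫ ω in A, f (Z n ω) ∂P = P.real A * ∫ ω, f (Z n ω) ∂P := by
    intro n
    have hAn : MeasurableSet[𝓖 n] A := iInf_le 𝓖 n _ hA
    have hi : IndepFun (A.indicator fun _ => (1 : ℝ)) (fun ω => f (Z n ω)) P :=
      indep_of_indep_of_le_right (indep_of_indep_of_le_left (hind n)
        ((@measurable_const ℝ Ω _ (𝓖 n) 1).indicator hAn).comap_le)
        (((f.continuous.measurable.comp (comap_measurable (Z n)))).comap_le)
    have := hi.integral_mul_eq_mul_integral
      ((measurable_const.indicator hA0).aestronglyMeasurable)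
      ((f.continuous.measurable.comp (hZ n)).aestronglyMeasurable)
    rw [integral_indicator_const _ hA0, smul_eq_mul, mul_one] at this
    rw [← this, ← integral_indicator hA0]
    congr 1
    ext ω
    by_cases h : ω ∈ A <;> simp [h]
  have hlimset : ∀ S : Set Ω, Tendsto (fun n => ∫ ω in S, f (Z n ω) ∂P) atTop
      (𝓝 (∫ ω in S, f (Z' ω) ∂P)) := by
    intro S
    refine tendsto_integral_of_dominated_convergence (fun _ => ‖f‖)
      (fun n => (f.continuous.measurable.comp (hZ n)).aestronglyMeasurable)
      (integrable_const _) (fun n => Eventually.of_forall fun ω => f.norm_coe_le_norm _) ?_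
    filter_upwards [ae_restrict_of_ae hlim] with ω hω
    exact (f.continuous.tendsto _).comp hω
  refine tendsto_nhds_unique (hlimset A) ?_
  have := (hlimset Set.univ).const_mul (P.real A)
  simp only [Measure.restrict_univ] at this
  exact this.congr fun n => (hn n).symm

/-- Freezing: integration of a function of independent variables. -/
lemma lintegral_comp_of_indep {Ω γ β : Type*} {m mΩ : MeasurableSpace Ω} {P : Measure Ω}
    [IsProbabilityMeasure P] [MeasurableSpace γ] [MeasurableSpace β] (hm : m ≤ mΩ)
    {C : Ω → γ} {Z : Ω → β} (hC : Measurable[m] C)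
    (hZ : Measurable Z) (hind : Indep m (MeasurableSpace.comap Z inferInstance) P)
    {F : γ × β → ℝ≥0∞} (hF : Measurable F) :
    ∫⁻ ω, F (C ω, Z ω) ∂P = ∫⁻ ω, ∫⁻ z, F (C ω, z) ∂(P.map Z) ∂P := by
  have hC' : Measurable C := hC.mono hm le_rfl
  have hCZ : IndepFun C Z P := indep_of_indep_of_le_left hind hC.comap_le
  have hprod := (indepFun_iff_map_prod_eq_prod_map_map hC'.aemeasurable hZ.aemeasurable).1 hCZ
  have : IsProbabilityMeasure (P.map Z) := Measure.isProbabilityMeasure_map hZ.aemeasurable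
  rw [← lintegral_map hF (hC'.prodMk hZ), hprod, lintegral_prod _ hF.aemeasurable,
    lintegral_map hF.lintegral_prod_right' hC']

/-- On an event of `m` the integral factors by Fubini, and the inner integral over the law of `Z` is
zero for every frozen value of `C`. -/
lemma condExp_comp_eq_zero_of_indep {Ω γ β : Type*} {m mΩ : MeasurableSpace Ω} {P : Measure Ω}
    [IsProbabilityMeasure P] [MeasurableSpace γ] [MeasurableSpace β] (hm : m ≤ mΩ)
    {C : Ω → γ} {Z : Ω → β} (hC : Measurable[m] C)
    (hZ : Measurable Z) (hind : Indep m (MeasurableSpace.comap Z inferInstance) P)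
    {f : γ × β → ℝ} (hf : Measurable f) (hint : Integrable (fun ω => f (C ω, Z ω)) P)
    (hzero : ∀ c, ∫ z, f (c, z) ∂(P.map Z) = 0) :
    P[fun ω => f (C ω, Z ω) | m] =ᵐ[P] 0 := by
  refine (ae_eq_condExp_of_forall_setIntegral_eq hm hint (fun _ _ _ => integrableOn_zero)
    (fun A hA _ => ?_) aestronglyMeasurable_zero).symm
  have hA' : MeasurableSet A := hm _ hA
  -- The indicator of `A` joins the frozen variable, so that independence of `m` and `Z` also covers
  -- `A`.
  set D : Ω → ℝ × γ := fun ω => (A.indicator (fun _ => (1 : ℝ)) ω, C ω) with hD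
  have hDm : Measurable[m] D := ((@measurable_const ℝ Ω _ m 1).indicator hA).prodMk hC
  have hD' : Measurable D := hDm.mono hm le_rfl
  have hDZ : IndepFun D Z P := indep_of_indep_of_le_left hind hDm.comap_le
  have hprod := (indepFun_iff_map_prod_eq_prod_map_map hD'.aemeasurable hZ.aemeasurable).1 hDZ
  have : IsProbabilityMeasure (P.map Z) := Measure.isProbabilityMeasure_map hZ.aemeasurable
  have : IsProbabilityMeasure (P.map D) := Measure.isProbabilityMeasure_map hD'.aemeasurable
  set g : (ℝ × γ) × β → ℝ := fun q => q.1.1 * f (q.1.2, q.2) with hg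
  have hgm : Measurable g := by fun_prop
  have heq : (fun ω => g (D ω, Z ω)) = A.indicator fun ω => f (C ω, Z ω) := by
    ext ω
    by_cases h : ω ∈ A <;> simp [hg, hD, h]
  have hgint : Integrable (fun ω => g (D ω, Z ω)) P := by
    rw [heq]; exact hint.indicator hA'
  have hgint' : Integrable g ((P.map D).prod (P.map Z)) := by
    rw [← hprod]
    exact (integrable_map_measure hgm.aestronglyMeasurable
      (hD'.prodMk hZ).aemeasurable).2 hgint
  have hR : ∫ ω in A, f (C ω, Z ω) ∂P = ∫ ω, g (D ω, Z ω) ∂P := by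
    rw [← integral_indicator hA', ← heq]
  have h1 : ∫ ω, g (D ω, Z ω) ∂P = ∫ q, g q ∂((P.map D).prod (P.map Z)) := by
    rw [← hprod, integral_map (hD'.prodMk hZ).aemeasurable hgm.aestronglyMeasurable]
  rw [hR, h1, integral_prod _ hgint']
  simp [hg, integral_const_mul, hzero]

/-- Orthogonality of martingale differences. -/
lemma integral_sq_sum_of_condExp_eq_zero {𝓗 : ℕ → MeasurableSpace Ω} (h𝓗 : ∀ k, 𝓗 k ≤ mΩ)
    (hmono : Monotone 𝓗) {ξ : ℕ → Ω → ℝ} (n : ℕ) (hm : ∀ k < n, Measurable[𝓗 (k + 1)] (ξ k))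
    (hL : ∀ k < n, MemLp (ξ k) 2 P) (hz : ∀ k < n, P[ξ k | 𝓗 k] =ᵐ[P] 0) :
    ∫ ω, (∑ k ∈ Finset.range n, ξ k ω) ^ 2 ∂P = ∑ k ∈ Finset.range n, ∫ ω, ξ k ω ^ 2 ∂P := by
  induction n with
  | zero => simp
  | succ n ih =>
    have hSm : Measurable[𝓗 n] (fun ω => ∑ k ∈ Finset.range n, ξ k ω) :=
      Finset.measurable_fun_sum _ fun k hk => (hm k (by grind)).mono
        (hmono (by grind)) le_rfl
    have hSL : MemLp (fun ω => ∑ k ∈ Finset.range n, ξ k ω) 2 P :=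
      memLp_finsetSum _ fun k hk => hL k (by grind)
    have hξ := hL n (by omega)
    -- Conditioning on `𝓗 n` takes out the earlier sum and leaves the vanishing conditional mean of
    -- `ξ n`.
    have hcross : ∫ ω, (∑ k ∈ Finset.range n, ξ k ω) * ξ n ω ∂P = 0 := by
      have hint : Integrable ((fun ω => ∑ k ∈ Finset.range n, ξ k ω) * ξ n) P :=
        hSL.integrable_mul hξ
      have h1 := condExp_mul_of_stronglyMeasurable_left (m := 𝓗 n) hSm.stronglyMeasurable hint
        (hξ.integrable one_le_two)
      have h2 : ∫ ω, ((fun ω => ∑ k ∈ Finset.range n, ξ k ω) * ξ n) ω ∂P = 0 := by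
        rw [← integral_condExp (h𝓗 n), integral_congr_ae h1]
        rw [integral_congr_ae (g := fun _ => 0)]
        · simp
        · filter_upwards [hz n (by omega)] with ω hω
          simp [hω]
      exact h2
    have hI1 := hSL.integrable_sq
    have hI2 := hξ.integrable_sq
    have hI3 : Integrable (fun ω => (∑ k ∈ Finset.range n, ξ k ω) * ξ n ω) P :=
      hSL.integrable_mul hξ
    simp_rw [Finset.sum_range_succ]
    rw [← ih (fun k hk => hm k (by omega)) (fun k hk => hL k (by omega))
      (fun k hk => hz k (by omega))]
    have : ∀ ω, (∑ k ∈ Finset.range n, ξ k ω + ξ n ω) ^ 2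
        = ((∑ k ∈ Finset.range n, ξ k ω) ^ 2 + 2 * ((∑ k ∈ Finset.range n, ξ k ω) * ξ n ω))
          + ξ n ω ^ 2 := fun ω => by ring
    simp_rw [this]
    have hI4 : Integrable (fun ω => (∑ k ∈ Finset.range n, ξ k ω) ^ 2
        + 2 * ((∑ k ∈ Finset.range n, ξ k ω) * ξ n ω)) P := hI1.add (hI3.const_mul 2)
    rw [integral_add hI4 hI2, integral_add hI1 (hI3.const_mul 2),
      integral_const_mul, hcross]
    ring

end Independence

/-! ### Gaussian moments -/

section Gaussian

/-- The law of the increments over time `d` of two independent Brownian motions. -/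
def pairLaw (d : ℝ≥0) : Measure (ℝ × ℝ) := (gaussianReal 0 d).prod (gaussianReal 0 d)

/-- The integrands of interest depend on `z` only through `b * z.1 + c * z.2`, so this reduces their
moments to one-dimensional Gaussian ones. -/
lemma map_pairLaw (b c : ℝ) (d : ℝ≥0) :
    (pairLaw d).map (fun z => b * z.1 + c * z.2)
      = gaussianReal 0 ((b ^ 2 + c ^ 2).toNNReal * d) := by
  have h1 : (gaussianReal 0 d).map (b * ·) = gaussianReal 0 ((b ^ 2).toNNReal * d) := by
    rw [gaussianReal_map_const_mul]
    simp only [mul_zero]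
    congr 2
    ext; simp [sq_nonneg]
  have h2 : (gaussianReal 0 d).map (c * ·) = gaussianReal 0 ((c ^ 2).toNNReal * d) := by
    rw [gaussianReal_map_const_mul]
    simp only [mul_zero]
    congr 2
    ext; simp [sq_nonneg]
  have h3 : (pairLaw d).map (fun z => b * z.1 + c * z.2)
      = ((gaussianReal 0 d).map (b * ·)) ∗ ((gaussianReal 0 d).map (c * ·)) := by
    rw [Measure.conv, Measure.map_prod_map _ _ (by fun_prop) (by fun_prop),
      Measure.map_map (by fun_prop) (by fun_prop)]
    rfl
  rw [h3, h1, h2, gaussianReal_conv_gaussianReal]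
  simp [Real.toNNReal_add (sq_nonneg b) (sq_nonneg c), add_mul]

lemma integral_exp_gaussianReal (v : ℝ≥0) (t : ℝ) :
    ∫ x, Real.exp (t * x) ∂(gaussianReal 0 v) = Real.exp (v * t ^ 2 / 2) := by
  have := congrFun (mgf_id_gaussianReal (μ := 0) (v := v)) t
  simpa [mgf] using this

lemma integrable_exp_gaussianReal (v : ℝ≥0) (t : ℝ) :
    Integrable (fun x => Real.exp (t * x)) (gaussianReal 0 v) :=
  integrable_exp_mul_gaussianReal t

lemma integral_mul_exp_gaussianReal (v : ℝ≥0) :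
    ∫ x, x * Real.exp x ∂(gaussianReal 0 v) = v * Real.exp (v / 2) := by
  have h0 : (1 : ℝ) ∈ interior (integrableExpSet id (gaussianReal 0 v)) := by
    have : integrableExpSet id (gaussianReal 0 v) = Set.univ :=
      Set.eq_univ_of_forall fun t => integrable_exp_gaussianReal v t
    simp [this]
  have h1 := hasDerivAt_mgf h0
  rw [mgf_id_gaussianReal] at h1
  have h2 : HasDerivAt (fun t : ℝ => Real.exp (0 * t + v * t ^ 2 / 2))
      (v * Real.exp (v / 2)) 1 := by
    have : HasDerivAt (fun t : ℝ => 0 * t + v * t ^ 2 / 2) (v : ℝ) 1 := by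
      have h := ((hasDerivAt_pow 2 (1 : ℝ)).const_mul (v : ℝ)).div_const 2
      simpa using h
    convert this.exp using 1
    simp [mul_comm]
  have := h1.unique h2
  simpa using this

lemma integrable_mul_exp_gaussianReal (v : ℝ≥0) :
    Integrable (fun x => x * Real.exp x) (gaussianReal 0 v) := by
  have hx : MemLp (fun x : ℝ => x) 2 (gaussianReal 0 v) := memLp_id_gaussianReal 2
  have he : MemLp (fun x : ℝ => Real.exp x) 2 (gaussianReal 0 v) := by
    rw [memLp_two_iff_integrable_sq (by fun_prop)]
    refine (integrable_exp_gaussianReal v 2).congr (Eventually.of_forall fun x => ?_)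
    simp only [← Real.exp_nat_mul]; norm_num
  exact hx.integrable_mul he

lemma integral_sq_gaussianReal (v : ℝ≥0) : ∫ x, x ^ 2 ∂(gaussianReal 0 v) = v := by
  have h := variance_id_gaussianReal (μ := 0) (v := v)
  rw [variance_eq_integral measurable_id.aemeasurable] at h
  simpa using h

lemma integrable_sq_gaussianReal (v : ℝ≥0) : Integrable (fun x => x ^ 2) (gaussianReal 0 v) :=
  (memLp_id_gaussianReal 2).integrable_sq

/-- The martingale part of one step of `exp ((a - (b² + c²) / 2) t + b B + c B⁰)`, up to the
linear term. -/
def stepError (d : ℝ) (a b c : ℝ) (z : ℝ × ℝ) : ℝ :=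
  Real.exp ((a - (b ^ 2 + c ^ 2) / 2) * d + (b * z.1 + c * z.2)) - Real.exp (a * d)
    - (b * z.1 + c * z.2)

/-- The correction `-(b² + c²) / 2` compensates the mean of the Gaussian exponential, and the linear
term is centered. -/
lemma integral_stepError (d : ℝ≥0) (a b c : ℝ) :
    ∫ z, stepError d a b c z ∂(pairLaw d) = 0 := by
  set v : ℝ≥0 := (b ^ 2 + c ^ 2).toNNReal * d with hv
  have hv' : (v : ℝ) = (b ^ 2 + c ^ 2) * d := by
    rw [hv, NNReal.coe_mul, Real.coe_toNNReal _ (by positivity)]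
  have h1 : ∫ z, stepError d a b c z ∂(pairLaw d) = ∫ x,
      (Real.exp ((a - (b ^ 2 + c ^ 2) / 2) * d) * Real.exp (1 * x) - Real.exp (a * d) - x)
        ∂(gaussianReal 0 v) := by
    rw [hv, ← map_pairLaw b c d, integral_map (by fun_prop) (by fun_prop)]
    refine integral_congr_ae (Eventually.of_forall fun z => ?_)
    simp only [stepError, Real.exp_add, one_mul]
  have hi := (integrable_exp_gaussianReal v 1).const_mul
    (Real.exp ((a - (b ^ 2 + c ^ 2) / 2) * d))
  have hid : Integrable (fun x : ℝ => x) (gaussianReal 0 v) :=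
    (memLp_id_gaussianReal 1).integrable le_rfl
  have hi' : Integrable (fun x => Real.exp ((a - (b ^ 2 + c ^ 2) / 2) * d) * Real.exp (1 * x)
      - Real.exp (a * d)) (gaussianReal 0 v) := hi.sub (integrable_const _)
  rw [h1, integral_sub hi' hid, integral_sub hi (integrable_const _),
    integral_const_mul, integral_exp_gaussianReal, integral_id_gaussianReal, ← Real.exp_add, hv']
  simp only [integral_const, probReal_univ, one_smul, sub_zero]
  rw [sub_eq_zero]
  congr 1
  ring

/-- Subtracting the linear term removes the first-order part of the variance: with `v = (b² + c²)
d`, both `exp v - 1 - v` and `v (exp (a d) - 1)²` are at least of second order in `d`. -/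
lemma integral_sq_stepError (d : ℝ≥0) (a b c : ℝ) :
    Integrable (fun z => stepError d a b c z ^ 2) (pairLaw d) ∧
    ∫ z, stepError d a b c z ^ 2 ∂(pairLaw d)
      = Real.exp (a * d) ^ 2 * (Real.exp ((b ^ 2 + c ^ 2) * d) - 1 - (b ^ 2 + c ^ 2) * d)
        + (b ^ 2 + c ^ 2) * d * (Real.exp (a * d) - 1) ^ 2 := by
  set v : ℝ≥0 := (b ^ 2 + c ^ 2).toNNReal * d with hv
  have hv' : (b ^ 2 + c ^ 2) * d = (v : ℝ) := by
    rw [hv, NNReal.coe_mul, Real.coe_toNNReal _ (by positivity)]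
  set q : ℝ := Real.exp (a * d) with hq
  set p : ℝ := Real.exp (-(v / 2)) with hp
  -- The expanded square of `q p exp x - q - x`, where `x` is Gaussian of variance `v` and `p`
  -- carries the Itô correction.
  set g : ℝ → ℝ := fun x => (q * p) ^ 2 * Real.exp (2 * x) + q ^ 2 + x ^ 2
      - 2 * q * (q * p) * Real.exp (1 * x) - 2 * (q * p) * (x * Real.exp x) + 2 * q * x with hg
  have hstep : ∀ z, stepError d a b c z ^ 2 = g (b * z.1 + c * z.2) := by
    intro z
    have h1 : stepError d a b c z
        = q * p * Real.exp (b * z.1 + c * z.2) - q - (b * z.1 + c * z.2) := by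
      rw [stepError, Real.exp_add, hq, hp, ← Real.exp_add (a * d), ← hv']
      congr 4
      ring
    have h2 : Real.exp (2 * (b * z.1 + c * z.2)) = Real.exp (b * z.1 + c * z.2) ^ 2 := by
      rw [← Real.exp_nat_mul]; norm_num
    simp only [hg]
    rw [h1, h2, one_mul]
    ring
  have hmap := map_pairLaw b c d
  rw [← hv] at hmap
  have hid : Integrable (fun x : ℝ => x) (gaussianReal 0 v) :=
    (memLp_id_gaussianReal 1).integrable le_rfl
  have i1 := (integrable_exp_gaussianReal v 2).const_mul ((q * p) ^ 2)
  have i2 : Integrable (fun _ : ℝ => q ^ 2) (gaussianReal 0 v) := integrable_const _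
  have i3 := integrable_sq_gaussianReal v
  have i4 := (integrable_exp_gaussianReal v 1).const_mul (2 * q * (q * p))
  have i5 := (integrable_mul_exp_gaussianReal v).const_mul (2 * (q * p))
  have i6 := hid.const_mul (2 * q)
  have j2 : Integrable (fun x => (q * p) ^ 2 * Real.exp (2 * x) + q ^ 2) (gaussianReal 0 v) :=
    i1.add i2
  have j3 : Integrable (fun x => (q * p) ^ 2 * Real.exp (2 * x) + q ^ 2 + x ^ 2)
    (gaussianReal 0 v) := j2.add i3
  have j4 : Integrable (fun x => (q * p) ^ 2 * Real.exp (2 * x) + q ^ 2 + x ^ 2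
    - 2 * q * (q * p) * Real.exp (1 * x)) (gaussianReal 0 v) := j3.sub i4
  have j5 : Integrable (fun x => (q * p) ^ 2 * Real.exp (2 * x) + q ^ 2 + x ^ 2
    - 2 * q * (q * p) * Real.exp (1 * x) - 2 * (q * p) * (x * Real.exp x)) (gaussianReal 0 v) :=
    j4.sub i5
  have hgi : Integrable g (gaussianReal 0 v) := j5.add i6
  constructor
  · simp_rw [hstep]
    rw [← hmap] at hgi
    exact (integrable_map_measure hgi.aestronglyMeasurable (by fun_prop)).1 hgi
  · simp_rw [hstep]
    rw [← integral_map (μ := pairLaw d) (φ := fun z : ℝ × ℝ => b * z.1 + c * z.2) (f := g)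
      (by fun_prop) (by rw [hmap]; exact hgi.aestronglyMeasurable), hmap]
    simp only [hg]
    rw [integral_add j5 i6, integral_sub j4 i5, integral_sub j3 i4, integral_add j2 i3,
      integral_add i1 i2]
    rw [integral_const_mul (2 * q) fun x : ℝ => x]
    simp only [integral_const_mul]
    rw [integral_exp_gaussianReal, integral_exp_gaussianReal, integral_mul_exp_gaussianReal,
      integral_sq_gaussianReal, integral_id_gaussianReal, hv']
    simp only [integral_const, probReal_univ, one_smul]
    -- The factor `p` cancels the exponentials in the moments of `exp x` and `x exp x`, and `p ^ 2`
    -- turns the mean of `exp (2 x)` into `exp v`.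
    have e1 : p * Real.exp ((v : ℝ) * 1 ^ 2 / 2) = 1 := by
      rw [hp, ← Real.exp_add]; simp
    have e2 : p * Real.exp ((v : ℝ) / 2) = 1 := by
      rw [hp, ← Real.exp_add]; simp
    have e3 : p ^ 2 * Real.exp ((v : ℝ) * 2 ^ 2 / 2) = Real.exp v := by
      rw [hp, ← Real.exp_nat_mul, ← Real.exp_add]; congr 1; push_cast; ring
    linear_combination q ^ 2 * e3 - 2 * q ^ 2 * e1 - 2 * q * v * e2

lemma integral_sq_linear_pairLaw (d : ℝ≥0) (b c : ℝ) :
    Integrable (fun z => (b * z.1 + c * z.2) ^ 2) (pairLaw d) ∧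
    ∫ z, (b * z.1 + c * z.2) ^ 2 ∂(pairLaw d) = (b ^ 2 + c ^ 2) * d := by
  have hmap := map_pairLaw b c d
  have hi := integrable_sq_gaussianReal ((b ^ 2 + c ^ 2).toNNReal * d)
  have hv := integral_sq_gaussianReal ((b ^ 2 + c ^ 2).toNNReal * d)
  rw [← hmap] at hi hv
  refine ⟨(integrable_map_measure hi.aestronglyMeasurable (by fun_prop)).1 hi, ?_⟩
  rw [integral_map (by fun_prop) hi.aestronglyMeasurable] at hv
  rw [hv, NNReal.coe_mul, Real.coe_toNNReal _ (by positivity)]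

lemma integral_linear_pairLaw (d : ℝ≥0) (b c : ℝ) :
    ∫ z, (b * z.1 + c * z.2) ∂(pairLaw d) = 0 := by
  have hmap := map_pairLaw b c d
  have h := integral_id_gaussianReal (μ := 0) (v := (b ^ 2 + c ^ 2).toNNReal * d)
  rw [← hmap, integral_map (by fun_prop) (by fun_prop)] at h
  exact h

lemma abs_exp_sub_one_le {x K : ℝ} (hx : |x| ≤ K) : |Real.exp x - 1| ≤ |x| * Real.exp K := by
  have h1 : |Real.exp x - 1| ≤ |x| * Real.exp |x| := by
    rcases le_total 0 x with h | h
    · rw [abs_of_nonneg (by linarith [Real.add_one_le_exp x]), abs_of_nonneg h]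
      have := Real.add_one_le_exp (-x)
      have h3 : Real.exp x * Real.exp (-x) = 1 := by rw [← Real.exp_add]; simp
      nlinarith [Real.exp_pos x]
    · rw [abs_of_nonpos (by linarith [Real.exp_le_one_iff.2 h]), abs_of_nonpos h]
      have := Real.add_one_le_exp x
      have h2 : 1 ≤ Real.exp (-x) := Real.one_le_exp (by linarith)
      nlinarith
  exact h1.trans (by gcongr)

lemma exp_sub_one_sub_le {x K : ℝ} (hx : |x| ≤ K) :
    |Real.exp x - 1 - x| ≤ x ^ 2 * Real.exp K := by
  have h0 : 0 ≤ Real.exp x - 1 - x := by linarith [Real.add_one_le_exp x]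
  have h1 : Real.exp x - 1 - x ≤ x * (Real.exp x - 1) := by
    have := Real.add_one_le_exp (-x)
    have h3 : Real.exp x * Real.exp (-x) = 1 := by rw [← Real.exp_add]; simp
    nlinarith [Real.exp_pos x]
  rw [abs_of_nonneg h0]
  calc _ ≤ x * (Real.exp x - 1) := h1
    _ ≤ |x| * |Real.exp x - 1| := by rw [← abs_mul]; exact le_abs_self _
    _ ≤ |x| * (|x| * Real.exp K) := by gcongr; exact abs_exp_sub_one_le hx
    _ = _ := by rw [← mul_assoc, ← abs_mul, ← sq, abs_of_nonneg (sq_nonneg x)]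

/-- The square of the step error is of second order in the step. -/
lemma exists_integral_sq_stepError_le (K T : ℝ≥0) : ∃ C : ℝ, 0 ≤ C ∧ ∀ (d : ℝ≥0) (a b c : ℝ),
    d ≤ T → |a| ≤ K → |b| ≤ K → |c| ≤ K →
      ∫ z, stepError d a b c z ^ 2 ∂(pairLaw d) ≤ C * d ^ 2 := by
  -- `V` bounds `b² + c²`. The two summands of the constant bound the two terms of
  -- `integral_sq_stepError`, one factor `d` of the second being estimated by `T`.
  set V : ℝ := 2 * K ^ 2
  refine ⟨Real.exp (K * T) ^ 2 * (V ^ 2 * Real.exp (V * T)) +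
    V * T * (K * Real.exp (K * T)) ^ 2, by positivity, fun d a b c hd ha hb hc => ?_⟩
  rw [(integral_sq_stepError d a b c).2]
  have hd' : (d : ℝ) ≤ T := by exact_mod_cast hd
  have hb2 : b ^ 2 ≤ K ^ 2 := sq_le_sq' (abs_le.1 hb).1 (abs_le.1 hb).2
  have hc2 : c ^ 2 ≤ K ^ 2 := sq_le_sq' (abs_le.1 hc).1 (abs_le.1 hc).2
  have hv0 : 0 ≤ b ^ 2 + c ^ 2 := by positivity
  have hvV : b ^ 2 + c ^ 2 ≤ V := by simp only [V]; linarith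
  set v := b ^ 2 + c ^ 2
  have had : |a * d| ≤ K * T := by
    rw [abs_mul, abs_of_nonneg d.coe_nonneg]; gcongr
  have hvd : |v * d| ≤ V * T := by
    rw [abs_mul, abs_of_nonneg d.coe_nonneg, abs_of_nonneg hv0]; gcongr
  have h1 : Real.exp (v * d) - 1 - v * d ≤ (V * d) ^ 2 * Real.exp (V * T) :=
    ((le_abs_self _).trans (exp_sub_one_sub_le hvd)).trans (by gcongr)
  have h2 : (Real.exp (a * d) - 1) ^ 2 ≤ (K * d * Real.exp (K * T)) ^ 2 := by
    rw [← sq_abs]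
    have := abs_exp_sub_one_le had
    have h3 : |a * d| ≤ K * d := by rw [abs_mul, abs_of_nonneg d.coe_nonneg]; gcongr
    gcongr
    exact this.trans (by gcongr)
  have h3 : Real.exp (a * d) ≤ Real.exp (K * T) := Real.exp_le_exp.2 ((le_abs_self _).trans had)
  have h4 : 0 ≤ Real.exp (v * d) - 1 - v * d := by linarith [Real.add_one_le_exp (v * d)]
  calc _ ≤ Real.exp (K * T) ^ 2 * ((V * d) ^ 2 * Real.exp (V * T))
        + V * T * (K * d * Real.exp (K * T)) ^ 2 := by gcongr
    _ = _ := by ring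

end Gaussian

/-! ### Linear equations driven by two independent Brownian motions -/

/-- `B` and `B0` are independent Brownian motions relative to the filtration `𝓕`. -/
structure IsNoiseFiltration {Ω : Type*} [mΩ : MeasurableSpace Ω] (P : Measure Ω)
    (𝓕 : ℝ≥0 → MeasurableSpace Ω) (B B0 : ℝ≥0 → Ω → ℝ) : Prop where
  le : ∀ t, 𝓕 t ≤ mΩ
  mono : Monotone 𝓕
  adapted : ∀ t, Measurable[𝓕 t] (B t)
  adapted0 : ∀ t, Measurable[𝓕 t] (B0 t)
  indep : ∀ u v, u ≤ v → Indep (𝓕 u)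
    (MeasurableSpace.comap (fun ω => (B v ω - B u ω, B0 v ω - B0 u ω)) inferInstance) P
  law : ∀ u v, u ≤ v → P.map (fun ω => (B v ω - B u ω, B0 v ω - B0 u ω)) = pairLaw (v - u)

section Driven

variable {Ω : Type*} {mΩ : MeasurableSpace Ω} {P : Measure Ω} [IsProbabilityMeasure P]
  {𝓕 : ℝ≥0 → MeasurableSpace Ω} {B B0 : ℝ≥0 → Ω → ℝ}

omit [IsProbabilityMeasure P] in
lemma IsNoiseFiltration.measurable_incr (hN : IsNoiseFiltration P 𝓕 B B0) {u v : ℝ≥0}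
    (huv : u ≤ v) : Measurable[𝓕 v] (fun ω => (B v ω - B u ω, B0 v ω - B0 u ω)) :=
  ((hN.adapted v).sub ((hN.adapted u).mono (hN.mono huv) le_rfl)).prodMk
    ((hN.adapted0 v).sub ((hN.adapted0 u).mono (hN.mono huv) le_rfl))

omit [IsProbabilityMeasure P] in
lemma memLp_two_of_lintegral_le {X Q : Ω → ℝ} (hX : AEStronglyMeasurable X P)
    (hQ : Integrable Q P)
    (h : ∫⁻ ω, ENNReal.ofReal (X ω ^ 2) ∂P ≤ ∫⁻ ω, ENNReal.ofReal (Q ω) ∂P) :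
    MemLp X 2 P := by
  rw [memLp_two_iff_integrable_sq hX]
  refine ⟨hX.pow 2, ?_⟩
  rw [hasFiniteIntegral_iff_ofReal (Eventually.of_forall fun ω => sq_nonneg _)]
  exact h.trans_lt (hQ.lintegral_lt_top)

/-- The second moment of a sum of centered functions of the increments. -/
lemma IsNoiseFiltration.transform_bound (hN : IsNoiseFiltration P 𝓕 B B0) {γ : Type*}
    [MeasurableSpace γ] {p : ℕ → ℝ≥0} (hp : Monotone p) (n : ℕ) {C : ℕ → Ω → γ}
    {f : ℕ → γ × (ℝ × ℝ) → ℝ} {Q : ℕ → Ω → ℝ}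
    (hC : ∀ k < n, Measurable[𝓕 (p k)] (C k)) (hf : ∀ k, Measurable (f k))
    (hzero : ∀ k c, ∫ z, f k (c, z) ∂(pairLaw (p (k + 1) - p k)) = 0)
    (hint : ∀ k c, Integrable (fun z => f k (c, z) ^ 2) (pairLaw (p (k + 1) - p k)))
    (hQ : ∀ k < n, ∀ ω, ∫ z, f k (C k ω, z) ^ 2 ∂(pairLaw (p (k + 1) - p k)) ≤ Q k ω)
    (hQint : ∀ k < n, Integrable (Q k) P) :
    let ξ : ℕ → Ω → ℝ := fun k ω =>
      f k (C k ω, (B (p (k + 1)) ω - B (p k) ω, B0 (p (k + 1)) ω - B0 (p k) ω))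
    (∀ k < n, MemLp (ξ k) 2 P) ∧
      ∫ ω, (∑ k ∈ Finset.range n, ξ k ω) ^ 2 ∂P ≤ ∑ k ∈ Finset.range n, ∫ ω, Q k ω ∂P := by
  intro ξ
  have hstep : ∀ k, p k ≤ p (k + 1) := fun k => hp (Nat.le_succ k)
  have hZ : ∀ k, Measurable fun ω =>
      (B (p (k + 1)) ω - B (p k) ω, B0 (p (k + 1)) ω - B0 (p k) ω) := fun k =>
    (hN.measurable_incr (hstep k)).mono (hN.le _) le_rfl
  have hξm : ∀ k < n, Measurable[𝓕 (p (k + 1))] (ξ k) := fun k hk =>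
    (hf k).comp (((hC k hk).mono (hN.mono (hstep k)) le_rfl).prodMk
      (hN.measurable_incr (hstep k)))
  -- `C k` is known at time `p k` and is frozen while the independent increment is integrated out.
  -- The estimate is made with `∫⁻` because square integrability of `ξ k` is deduced from it.
  have hle : ∀ k < n, ∫⁻ ω, ENNReal.ofReal (ξ k ω ^ 2) ∂P ≤ ∫⁻ ω, ENNReal.ofReal (Q k ω) ∂P := by
    intro k hk
    have h := lintegral_comp_of_indep (hN.le (p k)) (hC k hk) (hZ k) (hN.indep _ _ (hstep k))
      (F := fun q => ENNReal.ofReal (f k q ^ 2)) ((hf k).pow_const 2).ennreal_ofReal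
    rw [h, hN.law _ _ (hstep k)]
    refine lintegral_mono fun ω => ?_
    rw [← ofReal_integral_eq_lintegral_ofReal (hint k _)
      (Eventually.of_forall fun z => sq_nonneg _)]
    exact ENNReal.ofReal_le_ofReal (hQ k hk ω)
  have hL : ∀ k < n, MemLp (ξ k) 2 P := fun k hk =>
    memLp_two_of_lintegral_le (((hξm k hk).mono (hN.le _) le_rfl).aestronglyMeasurable)
      (hQint k hk) (hle k hk)
  refine ⟨hL, ?_⟩
  rw [integral_sq_sum_of_condExp_eq_zero (𝓗 := fun k => 𝓕 (p k)) (fun k => hN.le _)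
    (fun k l h => hN.mono (hp h)) n hξm hL fun k hk => ?_]
  · refine Finset.sum_le_sum fun k hk => ?_
    have hk' := Finset.mem_range.1 hk
    rw [integral_eq_lintegral_of_nonneg_ae (Eventually.of_forall fun ω => sq_nonneg _)
      ((hL k hk').aestronglyMeasurable.pow 2)]
    have hQ0 : 0 ≤ Q k := fun ω => (integral_nonneg fun z => sq_nonneg _).trans (hQ k hk' ω)
    rw [integral_eq_lintegral_of_nonneg_ae (Eventually.of_forall hQ0)
      (hQint k hk').aestronglyMeasurable]
    exact ENNReal.toReal_mono (hQint k hk').lintegral_lt_top.ne (hle k hk')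
  · refine condExp_comp_eq_zero_of_indep (hN.le _) (hC k hk) (hZ k) (hN.indep _ _ (hstep k))
      (hf k) ((hL k hk).integrable one_le_two) fun c => ?_
    rw [hN.law _ _ (hstep k)]
    exact hzero k c

set_option maxHeartbeats 1000000 in
/-- Second moment of one-sided sums of a bounded adapted process against
`a dt + b dB + c dB⁰`. -/
lemma IsNoiseFiltration.integral_sq_linear_sum_le (hN : IsNoiseFiltration P 𝓕 B B0)
    {a b c : Ω → ℝ} (ha : Measurable[𝓕 0] a) (hb : Measurable[𝓕 0] b) (hc : Measurable[𝓕 0] c)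
    {K : ℝ} (haK : ∀ ω, |a ω| ≤ K) (hbK : ∀ ω, |b ω| ≤ K) (hcK : ∀ ω, |c ω| ≤ K)
    (t : ℝ≥0) (n : ℕ) {U : ℕ → Ω → ℝ} {M : ℝ}
    (hU : ∀ k < 2 ^ n, Measurable[𝓕 (dyadicPoint t n k)] (U k))
    (hUM : ∀ k < 2 ^ n, ∀ ω, |U k ω| ≤ M) :
    MemLp (fun ω => ∑ k ∈ Finset.range (2 ^ n), U k ω * (a ω * (t / 2 ^ n)
        + b ω * (B (dyadicPoint t n (k + 1)) ω - B (dyadicPoint t n k) ω)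
        + c ω * (B0 (dyadicPoint t n (k + 1)) ω - B0 (dyadicPoint t n k) ω))) 2 P ∧
    ∫ ω, (∑ k ∈ Finset.range (2 ^ n), U k ω * (a ω * (t / 2 ^ n)
        + b ω * (B (dyadicPoint t n (k + 1)) ω - B (dyadicPoint t n k) ω)
        + c ω * (B0 (dyadicPoint t n (k + 1)) ω - B0 (dyadicPoint t n k) ω))) ^ 2 ∂P
      ≤ (2 * K ^ 2 * t + 4 * K ^ 2)
        * ∑ k ∈ Finset.range (2 ^ n), (∫ ω, U k ω ^ 2 ∂P) * (t / 2 ^ n) := by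
  set d : ℝ := t / 2 ^ n with hd
  have hd0 : 0 ≤ d := by positivity
  set p := dyadicPoint t n with hp
  have hpd : ∀ k, ((p (k + 1) - p k : ℝ≥0) : ℝ) = d := fun k => by
    rw [NNReal.coe_sub (dyadicPoint_mono t n (Nat.le_succ k)), dyadicPoint_succ_sub]
  have h0 : ∀ {k : ℕ} {g : Ω → ℝ}, Measurable[𝓕 0] g → Measurable[𝓕 (p k)] g :=
    fun hg => hg.mono (hN.mono zero_le) le_rfl
  have hUm : ∀ k < 2 ^ n, Measurable (U k) := fun k hk => (hU k hk).mono (hN.le _) le_rfl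
  have ham : Measurable a := ha.mono (hN.le _) le_rfl
  have hU2 : ∀ k < 2 ^ n, Integrable (fun ω => U k ω ^ 2) P := fun k hk =>
    Integrable.of_bound ((hUm k hk).pow_const 2).aestronglyMeasurable (M ^ 2)
      (Eventually.of_forall fun ω => by
        rw [Real.norm_eq_abs, abs_of_nonneg (sq_nonneg _)]
        exact sq_le_sq' (abs_le.1 (hUM k hk ω)).1 (abs_le.1 (hUM k hk ω)).2)
  have hsq : ∀ {x : ℝ}, |x| ≤ K → x ^ 2 ≤ K ^ 2 := fun h => sq_le_sq' (abs_le.1 h).1 (abs_le.1 h).2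
  -- The Brownian part is a sum of centered functions of the increments with frozen coefficients `U
  -- k * b` and `U k * c`; the factor `2 * K ^ 2` in `Q` bounds `b² + c²`.
  obtain ⟨hL, hbd⟩ := hN.transform_bound (dyadicPoint_mono t n) (2 ^ n)
    (C := fun k ω => (U k ω * b ω, U k ω * c ω)) (f := fun _ q => q.1.1 * q.2.1 + q.1.2 * q.2.2)
    (Q := fun k ω => 2 * K ^ 2 * d * U k ω ^ 2)
    (fun k hk => ((hU k hk).mul (h0 hb)).prodMk ((hU k hk).mul (h0 hc)))
    (fun k => by fun_prop) (fun k q => integral_linear_pairLaw _ q.1 q.2)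
    (fun k q => (integral_sq_linear_pairLaw _ q.1 q.2).1)
    (fun k hk ω => by
      rw [(integral_sq_linear_pairLaw _ _ _).2, hpd]
      have := hsq (hbK ω)
      have := hsq (hcK ω)
      have : U k ω ^ 2 * (b ω ^ 2 + c ω ^ 2) ≤ U k ω ^ 2 * (2 * K ^ 2) := by
        gcongr; linarith
      nlinarith)
    (fun k hk => (hU2 k hk).const_mul _)
  set ξ : ℕ → Ω → ℝ := fun k ω => U k ω * b ω * (B (p (k + 1)) ω - B (p k) ω)
    + U k ω * c ω * (B0 (p (k + 1)) ω - B0 (p k) ω) with hξ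
  have hL' : MemLp (fun ω => ∑ k ∈ Finset.range (2 ^ n), ξ k ω) 2 P :=
    memLp_finsetSum _ fun k hk => hL k (Finset.mem_range.1 hk)
  have hA : MemLp (fun ω => ∑ k ∈ Finset.range (2 ^ n), U k ω * a ω * d) 2 P := by
    refine memLp_finsetSum _ fun k hk => ?_
    have hk' := Finset.mem_range.1 hk
    refine MemLp.of_bound (((hUm k hk').mul ham).mul_const d).aestronglyMeasurable (M * K * d)
      (Eventually.of_forall fun ω => ?_)
    rw [Real.norm_eq_abs, abs_mul, abs_mul, abs_of_nonneg hd0]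
    have := hUM k hk' ω
    have := haK ω
    have : 0 ≤ M := (abs_nonneg _).trans (hUM k hk' ω)
    gcongr
  have hsplit : ∀ ω, ∑ k ∈ Finset.range (2 ^ n), U k ω * (a ω * d
        + b ω * (B (p (k + 1)) ω - B (p k) ω) + c ω * (B0 (p (k + 1)) ω - B0 (p k) ω))
      = (∑ k ∈ Finset.range (2 ^ n), U k ω * a ω * d) + ∑ k ∈ Finset.range (2 ^ n), ξ k ω := by
    intro ω
    rw [← Finset.sum_add_distrib]
    exact Finset.sum_congr rfl fun k _ => by simp only [hξ]; ring
  simp_rw [hsplit]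
  refine ⟨hA.add hL', ?_⟩
  -- Cauchy-Schwarz over the `2 ^ n` terms, one factor `d` combining with `2 ^ n` to give `t`.
  have hAb : ∀ ω, (∑ k ∈ Finset.range (2 ^ n), U k ω * a ω * d) ^ 2
      ≤ ∑ k ∈ Finset.range (2 ^ n), K ^ 2 * t * d * U k ω ^ 2 := by
    intro ω
    refine (sq_sum_le_card_mul_sum_sq).trans ?_
    rw [Finset.card_range, Finset.mul_sum]
    refine Finset.sum_le_sum fun k _ => ?_
    have htd : ((2 ^ n : ℕ) : ℝ) * d = t := by
      rw [hd]; push_cast; field_simp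
    calc _ = (((2 ^ n : ℕ) : ℝ) * d) * d * U k ω ^ 2 * a ω ^ 2 := by ring
      _ ≤ t * d * U k ω ^ 2 * K ^ 2 := by
        rw [htd]
        have := hsq (haK ω)
        gcongr
      _ = _ := by ring
  have hI : Integrable (fun ω => ∑ k ∈ Finset.range (2 ^ n), K ^ 2 * t * d * U k ω ^ 2) P :=
    integrable_finsetSum _ fun k hk => (hU2 k (Finset.mem_range.1 hk)).const_mul _
  -- By `(x + y)² ≤ 2 x² + 2 y²` the drift contributes `2 K² t` to the constant and the Brownian
  -- part `4 K²`.
  calc ∫ ω, ((∑ k ∈ Finset.range (2 ^ n), U k ω * a ω * d)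
        + ∑ k ∈ Finset.range (2 ^ n), ξ k ω) ^ 2 ∂P
      ≤ ∫ ω, (2 * (∑ k ∈ Finset.range (2 ^ n), K ^ 2 * t * d * U k ω ^ 2)
        + 2 * (∑ k ∈ Finset.range (2 ^ n), ξ k ω) ^ 2) ∂P := by
        refine integral_mono (hA.add hL').integrable_sq
          ((hI.const_mul 2).add (hL'.integrable_sq.const_mul 2)) fun ω => ?_
        have := hAb ω
        refine add_sq_le.trans ?_
        rw [mul_add]
        gcongr
    _ = 2 * (∑ k ∈ Finset.range (2 ^ n), K ^ 2 * t * d * ∫ ω, U k ω ^ 2 ∂P)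
        + 2 * ∫ ω, (∑ k ∈ Finset.range (2 ^ n), ξ k ω) ^ 2 ∂P := by
        rw [integral_add (hI.const_mul 2) (hL'.integrable_sq.const_mul 2), integral_const_mul,
          integral_const_mul, integral_finsetSum _ fun k hk =>
            (hU2 k (Finset.mem_range.1 hk)).const_mul _]
        simp_rw [integral_const_mul]
    _ ≤ 2 * (∑ k ∈ Finset.range (2 ^ n), K ^ 2 * t * d * ∫ ω, U k ω ^ 2 ∂P)
        + 2 * ∑ k ∈ Finset.range (2 ^ n), ∫ ω, 2 * K ^ 2 * d * U k ω ^ 2 ∂P := by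
        gcongr
    _ = _ := by
        simp_rw [integral_const_mul, Finset.mul_sum]
        rw [← Finset.sum_add_distrib]
        exact Finset.sum_congr rfl fun k _ => by ring

/-- The left sum of an increasing function lies below its integral. The gain `1 / L` is what makes
the iteration in the uniqueness proof contract. -/
lemma sum_exp_dyadicPoint_le {L : ℝ} (hL : 0 < L) (t : ℝ≥0) (n : ℕ) :
    ∑ k ∈ Finset.range (2 ^ n), Real.exp (L * dyadicPoint t n k) * ((t : ℝ) / 2 ^ n)
      ≤ Real.exp (L * t) / L := by
  have h : ∀ k, Real.exp (L * dyadicPoint t n k) * ((t : ℝ) / 2 ^ n)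
      ≤ Real.exp (L * dyadicPoint t n (k + 1)) / L - Real.exp (L * dyadicPoint t n k) / L := by
    intro k
    have hs := dyadicPoint_succ_sub t n k
    rw [← hs]
    set u : ℝ := (dyadicPoint t n k : ℝ)
    set v : ℝ := (dyadicPoint t n (k + 1) : ℝ)
    have h1 := Real.add_one_le_exp (L * (v - u))
    have h2 : Real.exp (L * v) = Real.exp (L * u) * Real.exp (L * (v - u)) := by
      rw [← Real.exp_add]; congr 1; ring
    rw [h2, ← sub_div, le_div_iff₀ hL]
    nlinarith [Real.exp_pos (L * u)]
  refine (Finset.sum_le_sum fun k _ => h k).trans ?_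
  rw [Finset.sum_range_sub (fun k => Real.exp (L * dyadicPoint t n k) / L), dyadicPoint_last]
  have := Real.exp_pos (L * dyadicPoint t n 0)
  have : 0 < Real.exp (L * dyadicPoint t n 0) / L := by positivity
  linarith

/-- Uniqueness: an adapted process that is locally the limit of its own left-point sums against
`a dt + b dB + c dB⁰` vanishes. -/
theorem IsNoiseFiltration.eq_zero_of_tendsto_sum (hN : IsNoiseFiltration P 𝓕 B B0)
    {a b c : Ω → ℝ} (ha : Measurable[𝓕 0] a) (hb : Measurable[𝓕 0] b) (hc : Measurable[𝓕 0] c)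
    {K : ℝ} (haK : ∀ ω, |a ω| ≤ K) (hbK : ∀ ω, |b ω| ≤ K) (hcK : ∀ ω, |c ω| ≤ K)
    {T : ℝ≥0} {S : Set ℝ≥0} (hST : ∀ t ∈ S, t ≤ T)
    (hS : ∀ t ∈ S, ∀ n k, k ≤ 2 ^ n → dyadicPoint t n k ∈ S)
    {D : ℝ≥0 → Ω → ℝ} (hD : ∀ t ∈ S, Measurable[𝓕 t] (D t))
    {Γ : ℝ≥0 → Set Ω} (hΓ : ∀ t ∈ S, MeasurableSet[𝓕 t] (Γ t))
    (hΓanti : ∀ s ∈ S, ∀ t ∈ S, s ≤ t → Γ t ⊆ Γ s)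
    {M : ℝ} (hM : ∀ t ∈ S, ∀ ω ∈ Γ t, |D t ω| ≤ M)
    (hlim : ∀ t ∈ S, ∃ ns : ℕ → ℕ, ∀ᵐ ω ∂P, ω ∈ Γ t →
      Tendsto (fun n => ∑ k ∈ Finset.range (2 ^ ns n), D (dyadicPoint t (ns n) k) ω *
        (a ω * (t / 2 ^ ns n)
        + b ω * (B (dyadicPoint t (ns n) (k + 1)) ω - B (dyadicPoint t (ns n) k) ω)
        + c ω * (B0 (dyadicPoint t (ns n) (k + 1)) ω - B0 (dyadicPoint t (ns n) k) ω)))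
        atTop (𝓝 (D t ω))) :
    ∀ t ∈ S, ∀ᵐ ω ∂P, ω ∈ Γ t → D t ω = 0 := by
  -- The cutoff makes the process bounded. Since `Γ` decreases in time, on `Γ t` it alters none of
  -- the earlier values that enter the sums for `D t`.
  set E : ℝ≥0 → Ω → ℝ := fun t => (Γ t).indicator (D t) with hE
  have hEm : ∀ t ∈ S, Measurable[𝓕 t] (E t) := fun t ht => (hD t ht).indicator (hΓ t ht)
  have hEm' : ∀ t ∈ S, Measurable (E t) := fun t ht => (hEm t ht).mono (hN.le _) le_rfl
  have hEM : ∀ t ∈ S, ∀ ω, |E t ω| ≤ |M| := by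
    intro t ht ω
    by_cases h : ω ∈ Γ t
    · simpa [hE, h] using (hM t ht ω h).trans (le_abs_self M)
    · simp [hE, h]
  have hE2 : ∀ t ∈ S, ∀ ω, E t ω ^ 2 ≤ M ^ 2 := fun t ht ω => sq_le_sq.2 (hEM t ht ω)
  have hEi : ∀ t ∈ S, Integrable (fun ω => E t ω ^ 2) P := fun t ht =>
    Integrable.of_bound ((hEm' t ht).pow_const 2).aestronglyMeasurable (M ^ 2)
      (Eventually.of_forall fun ω => by
        rw [Real.norm_eq_abs, abs_of_nonneg (sq_nonneg _)]
        exact hE2 t ht ω)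
  set C : ℝ := 2 * K ^ 2 * T + 4 * K ^ 2 with hC
  have hC0 : 0 ≤ C := by positivity
  -- Large enough for `C / L ≤ 1 / 2`, and positive even when `C = 0`.
  set L : ℝ := 2 * C + 1 with hLdef
  have hL : 0 < L := by positivity
  -- One Picard step in the norm weighted by `exp (L t)`: the second moments of the sums are at most
  -- half the old bound, and Fatou's lemma passes this to their limit.
  have hstep : ∀ A : ℝ, 0 ≤ A → (∀ t ∈ S, ∫ ω, E t ω ^ 2 ∂P ≤ A * Real.exp (L * t)) →
      ∀ t ∈ S, ∫ ω, E t ω ^ 2 ∂P ≤ A / 2 * Real.exp (L * t) := by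
    intro A hA hyp t ht
    obtain ⟨ns, hns⟩ := hlim t ht
    set R : ℕ → Ω → ℝ := fun n ω => ∑ k ∈ Finset.range (2 ^ ns n),
      E (dyadicPoint t (ns n) k) ω * (a ω * (t / 2 ^ ns n)
        + b ω * (B (dyadicPoint t (ns n) (k + 1)) ω - B (dyadicPoint t (ns n) k) ω)
        + c ω * (B0 (dyadicPoint t (ns n) (k + 1)) ω - B0 (dyadicPoint t (ns n) k) ω)) with hR
    have hmem : ∀ n k, k < 2 ^ ns n → dyadicPoint t (ns n) k ∈ S := fun n k hk =>
      hS t ht _ _ hk.le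
    have hbound : ∀ n, MemLp (R n) 2 P ∧ ∫ ω, R n ω ^ 2 ∂P ≤ A / 2 * Real.exp (L * t) := by
      intro n
      obtain ⟨h1, h2⟩ := hN.integral_sq_linear_sum_le ha hb hc haK hbK hcK t (ns n)
        (U := fun k => E (dyadicPoint t (ns n) k)) (M := |M|)
        (fun k hk => hEm _ (hmem n k hk)) (fun k hk => hEM _ (hmem n k hk))
      refine ⟨h1, h2.trans ?_⟩
      have htT : (t : ℝ) ≤ T := by exact_mod_cast hST t ht
      have h3 : ∑ k ∈ Finset.range (2 ^ ns n),
          (∫ ω, E (dyadicPoint t (ns n) k) ω ^ 2 ∂P) * ((t : ℝ) / 2 ^ ns n)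
          ≤ A * (Real.exp (L * t) / L) := by
        calc _ ≤ ∑ k ∈ Finset.range (2 ^ ns n),
              A * (Real.exp (L * dyadicPoint t (ns n) k) * ((t : ℝ) / 2 ^ ns n)) := by
              refine Finset.sum_le_sum fun k hk => ?_
              rw [← mul_assoc]
              gcongr
              exact hyp _ (hmem n k (Finset.mem_range.1 hk))
          _ ≤ _ := by
              rw [← Finset.mul_sum]
              gcongr
              exact sum_exp_dyadicPoint_le hL t _
      calc _ ≤ C * (A * (Real.exp (L * t) / L)) := by
            rw [hC]
            gcongr
        _ = (C / L) * A * Real.exp (L * t) := by ring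
        _ ≤ (1 / 2) * A * Real.exp (L * t) := by
            have : C / L ≤ 1 / 2 := by
              rw [div_le_div_iff₀ hL two_pos]
              linarith
            gcongr ?_ * _ * _
        _ = _ := by ring
    have hfatou : ∫⁻ ω, ENNReal.ofReal (E t ω ^ 2) ∂P
        ≤ ENNReal.ofReal (A / 2 * Real.exp (L * t)) := by
      have hmeas : ∀ n, AEMeasurable (fun ω => ENNReal.ofReal (R n ω ^ 2)) P := fun n =>
        ((hbound n).1.aestronglyMeasurable.aemeasurable.pow_const 2).ennreal_ofReal
      calc _ ≤ ∫⁻ ω, liminf (fun n => ENNReal.ofReal (R n ω ^ 2)) atTop ∂P := by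
            refine lintegral_mono_ae ?_
            filter_upwards [hns] with ω hω
            by_cases h : ω ∈ Γ t
            · have h1 : Tendsto (fun n => ENNReal.ofReal (R n ω ^ 2)) atTop
                  (𝓝 (ENNReal.ofReal (E t ω ^ 2))) := by
                refine (ENNReal.continuous_ofReal.tendsto _).comp (Tendsto.pow ?_ 2)
                have h2 : E t ω = D t ω := by simp [hE, h]
                rw [h2]
                refine (hω h).congr fun n => Finset.sum_congr rfl fun k hk => ?_
                have hk' := Finset.mem_range.1 hk
                have : ω ∈ Γ (dyadicPoint t (ns n) k) :=
                  hΓanti _ (hmem n k hk') t ht (dyadicPoint_le hk'.le) h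
                simp [hE, this]
              rw [h1.liminf_eq]
            · simp [hE, h]
        _ ≤ liminf (fun n => ∫⁻ ω, ENNReal.ofReal (R n ω ^ 2) ∂P) atTop :=
            lintegral_liminf_le' hmeas
        _ ≤ _ := by
            refine liminf_le_of_frequently_le' (Frequently.of_forall fun n => ?_)
            rw [← ofReal_integral_eq_lintegral_ofReal (hbound n).1.integrable_sq
              (Eventually.of_forall fun ω => sq_nonneg _)]
            exact ENNReal.ofReal_le_ofReal (hbound n).2
    rw [← ofReal_integral_eq_lintegral_ofReal (hEi t ht)
      (Eventually.of_forall fun ω => sq_nonneg _)] at hfatou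
    exact (ENNReal.ofReal_le_ofReal_iff (by positivity)).1 hfatou
  have hiter : ∀ j : ℕ, ∀ t ∈ S, ∫ ω, E t ω ^ 2 ∂P ≤ M ^ 2 / 2 ^ j * Real.exp (L * t) := by
    intro j
    induction j with
    | zero =>
      intro t ht
      have h1 : ∫ ω, E t ω ^ 2 ∂P ≤ M ^ 2 := by
        have := integral_mono (hEi t ht) (integrable_const (M ^ 2)) (hE2 t ht)
        simpa using this
      have h2 : 1 ≤ Real.exp (L * t) := Real.one_le_exp (by positivity)
      simp only [pow_zero, div_one]
      nlinarith [sq_nonneg M]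
    | succ j ih =>
      intro t ht
      refine (hstep _ (by positivity) ih t ht).trans_eq ?_
      rw [pow_succ (2 : ℝ), div_div]
  intro t ht
  have h0 : ∫ ω, E t ω ^ 2 ∂P ≤ 0 := by
    have hl := (tendsto_div_two_pow (M ^ 2)).mul_const (Real.exp (L * t))
    rw [zero_mul] at hl
    exact ge_of_tendsto' hl fun j => hiter j t ht
  have h1 : ∫ ω, E t ω ^ 2 ∂P = 0 := le_antisymm h0 (integral_nonneg fun ω => sq_nonneg _)
  have h2 := (integral_eq_zero_iff_of_nonneg (fun ω => sq_nonneg _) (hEi t ht)).1 h1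
  filter_upwards [h2] with ω hω h
  simpa [hE, h] using hω

end Driven

section Exponential

variable {Ω : Type*} {mΩ : MeasurableSpace Ω} {P : Measure Ω}
  {𝓕 : ℝ≥0 → MeasurableSpace Ω} {B B0 : ℝ≥0 → Ω → ℝ}

/-- The stochastic exponential of `a t + b B + c B⁰`. -/
def expPath (B B0 : ℝ≥0 → Ω → ℝ) (a b c : Ω → ℝ) (t : ℝ≥0) (ω : Ω) : ℝ :=
  Real.exp ((a ω - (b ω ^ 2 + c ω ^ 2) / 2) * t
    + (b ω * (B t ω - B 0 ω) + c ω * (B0 t ω - B0 0 ω)))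

/-- The one-step Itô error splits into a centered function of the increment, whose sum is controlled
by orthogonality, and a second-order drift remainder, for which Cauchy-Schwarz is enough. -/
lemma expPath_step (B B0 : ℝ≥0 → Ω → ℝ) (a b c : Ω → ℝ) {u v : ℝ≥0} (ω : Ω) :
    expPath B B0 a b c v ω - expPath B B0 a b c u ω
      - expPath B B0 a b c u ω * (a ω * ((v : ℝ) - u) + b ω * (B v ω - B u ω)
        + c ω * (B0 v ω - B0 u ω))
    = expPath B B0 a b c u ω * stepError ((v : ℝ) - u) (a ω) (b ω) (c ω)
        (B v ω - B u ω, B0 v ω - B0 u ω)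
      + expPath B B0 a b c u ω * (Real.exp (a ω * ((v : ℝ) - u)) - 1 - a ω * ((v : ℝ) - u)) := by
  have h : expPath B B0 a b c v ω = expPath B B0 a b c u ω *
      Real.exp ((a ω - (b ω ^ 2 + c ω ^ 2) / 2) * ((v : ℝ) - u)
        + (b ω * (B v ω - B u ω) + c ω * (B0 v ω - B0 u ω))) := by
    rw [expPath, expPath, ← Real.exp_add]
    congr 1
    ring
  rw [h, stepError]
  ring

lemma IsNoiseFiltration.measurable_expPath (hN : IsNoiseFiltration P 𝓕 B B0) {a b c : Ω → ℝ}
    (ha : Measurable[𝓕 0] a) (hb : Measurable[𝓕 0] b) (hc : Measurable[𝓕 0] c) (t : ℝ≥0) :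
    Measurable[𝓕 t] (expPath B B0 a b c t) := by
  have h0 : ∀ {g : Ω → ℝ}, Measurable[𝓕 0] g → Measurable[𝓕 t] g :=
    fun hg => hg.mono (hN.mono zero_le) le_rfl
  have hi : Measurable[𝓕 t] (fun ω => B t ω - B 0 ω) := (hN.adapted t).sub (h0 (hN.adapted 0))
  have hi0 : Measurable[𝓕 t] (fun ω => B0 t ω - B0 0 ω) :=
    (hN.adapted0 t).sub (h0 (hN.adapted0 0))
  exact Real.measurable_exp.comp ((((h0 ha).sub ((((h0 hb).pow_const 2).add
    ((h0 hc).pow_const 2)).div_const 2)).mul_const (t : ℝ)).add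
    (((h0 hb).mul hi).add ((h0 hc).mul hi0)))

variable [IsProbabilityMeasure P]

lemma lintegral_exp_pairLaw (d : ℝ≥0) (b c : ℝ) :
    ∫⁻ z, ENNReal.ofReal (Real.exp (2 * (b * z.1 + c * z.2))) ∂(pairLaw d)
      = ENNReal.ofReal (Real.exp (2 * ((b ^ 2 + c ^ 2) * d))) := by
  set v : ℝ≥0 := (b ^ 2 + c ^ 2).toNNReal * d with hv
  have hv' : (v : ℝ) = (b ^ 2 + c ^ 2) * d := by
    rw [hv, NNReal.coe_mul, Real.coe_toNNReal _ (by positivity)]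
  have h1 := lintegral_map (μ := pairLaw d) (f := fun x : ℝ => ENNReal.ofReal (Real.exp (2 * x)))
    (g := fun z : ℝ × ℝ => b * z.1 + c * z.2) (by fun_prop) (by fun_prop)
  rw [← h1, map_pairLaw, ← hv, ← ofReal_integral_eq_lintegral_ofReal
    (integrable_exp_gaussianReal v 2) (Eventually.of_forall fun x => (Real.exp_pos _).le),
    integral_exp_gaussianReal, hv']
  congr 2
  ring

/-- Freezing the initial data and integrating the Gaussian increment leaves the exponent `(2 a + b²
+ c²) t`, which is at most `(2 K + 2 K²) T`. -/
lemma IsNoiseFiltration.integral_sq_expPath_le (hN : IsNoiseFiltration P 𝓕 B B0) {a b c : Ω → ℝ}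
    (ha : Measurable[𝓕 0] a) (hb : Measurable[𝓕 0] b) (hc : Measurable[𝓕 0] c)
    {K : ℝ} (haK : ∀ ω, |a ω| ≤ K) (hbK : ∀ ω, |b ω| ≤ K) (hcK : ∀ ω, |c ω| ≤ K)
    {t T : ℝ≥0} (htT : t ≤ T) :
    Integrable (fun ω => expPath B B0 a b c t ω ^ 2) P ∧
    ∫ ω, expPath B B0 a b c t ω ^ 2 ∂P ≤ Real.exp ((2 * K + 2 * K ^ 2) * T) := by
  have hm : Measurable (fun ω => expPath B B0 a b c t ω ^ 2) :=
    ((hN.measurable_expPath ha hb hc t).mono (hN.le _) le_rfl).pow_const 2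
  have hsq : ∀ {x : ℝ}, |x| ≤ K → x ^ 2 ≤ K ^ 2 := fun h => sq_le_sq' (abs_le.1 h).1 (abs_le.1 h).2
  have hle : ∫⁻ ω, ENNReal.ofReal (expPath B B0 a b c t ω ^ 2) ∂P
      ≤ ENNReal.ofReal (Real.exp ((2 * K + 2 * K ^ 2) * T)) := by
    have h := lintegral_comp_of_indep (hN.le 0) (C := fun ω => (a ω, b ω, c ω))
      (ha.prodMk (hb.prodMk hc)) ((hN.measurable_incr (zero_le (a := t))).mono (hN.le _) le_rfl)
      (hN.indep 0 t zero_le)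
      (F := fun q => ENNReal.ofReal (Real.exp (2 * ((q.1.1 - (q.1.2.1 ^ 2 + q.1.2.2 ^ 2) / 2) * t)))
        * ENNReal.ofReal (Real.exp (2 * (q.1.2.1 * q.2.1 + q.1.2.2 * q.2.2))))
      (by fun_prop)
    have h2 : ∀ ω, ENNReal.ofReal (expPath B B0 a b c t ω ^ 2)
        = ENNReal.ofReal (Real.exp (2 * ((a ω - (b ω ^ 2 + c ω ^ 2) / 2) * t)))
        * ENNReal.ofReal (Real.exp (2 * (b ω * (B t ω - B 0 ω) + c ω * (B0 t ω - B0 0 ω)))) := by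
      intro ω
      rw [← ENNReal.ofReal_mul (Real.exp_pos _).le, ← Real.exp_add, expPath, ← Real.exp_nat_mul]
      congr 2
      push_cast
      ring
    simp_rw [h2]
    rw [h, hN.law 0 t zero_le]
    simp only
    have hb1 : ∀ ω, ∫⁻ z, ENNReal.ofReal (Real.exp (2 * ((a ω - (b ω ^ 2 + c ω ^ 2) / 2) * t)))
        * ENNReal.ofReal (Real.exp (2 * (b ω * z.1 + c ω * z.2))) ∂(pairLaw (t - 0))
        ≤ ENNReal.ofReal (Real.exp ((2 * K + 2 * K ^ 2) * T)) := by
      intro ω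
      rw [lintegral_const_mul _ (by fun_prop), lintegral_exp_pairLaw,
        ← ENNReal.ofReal_mul (Real.exp_pos _).le, ← Real.exp_add, tsub_zero]
      refine ENNReal.ofReal_le_ofReal (Real.exp_le_exp.2 ?_)
      have h3 := hsq (hbK ω)
      have h4 := hsq (hcK ω)
      have h5 := (le_abs_self _).trans (haK ω)
      have h6 : (t : ℝ) ≤ T := by exact_mod_cast htT
      have h7 : 0 ≤ K := (abs_nonneg _).trans (haK ω)
      calc _ = (2 * a ω + (b ω ^ 2 + c ω ^ 2)) * t := by ring
        _ ≤ (2 * K + 2 * K ^ 2) * t := by gcongr; linarith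
        _ ≤ _ := by gcongr
    calc _ ≤ ∫⁻ _, ENNReal.ofReal (Real.exp ((2 * K + 2 * K ^ 2) * T)) ∂P := lintegral_mono hb1
      _ = _ := by simp
  have hint : Integrable (fun ω => expPath B B0 a b c t ω ^ 2) P := by
    refine ⟨hm.aestronglyMeasurable, ?_⟩
    rw [hasFiniteIntegral_iff_ofReal (Eventually.of_forall fun ω => sq_nonneg _)]
    exact hle.trans_lt ENNReal.ofReal_lt_top
  refine ⟨hint, ?_⟩
  rw [← ofReal_integral_eq_lintegral_ofReal hint (Eventually.of_forall fun ω => sq_nonneg _)]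
    at hle
  exact (ENNReal.ofReal_le_ofReal_iff (Real.exp_pos _).le).1 hle

omit [IsProbabilityMeasure P] in
/-- Random variables with summable second moments tend to zero. -/
lemma ae_tendsto_zero_of_integral_sq_le {S : ℕ → Ω → ℝ} (hS : ∀ n, MemLp (S n) 2 P) {C : ℝ}
    (hC : ∀ n, ∫ ω, S n ω ^ 2 ∂P ≤ C / 2 ^ n) :
    ∀ᵐ ω ∂P, Tendsto (fun n => S n ω) atTop (𝓝 0) := by
  have hmeas : ∀ n, AEMeasurable (fun ω => ENNReal.ofReal (S n ω ^ 2)) P := fun n =>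
    ((hS n).aestronglyMeasurable.aemeasurable.pow_const 2).ennreal_ofReal
  have hC0 : 0 ≤ C := by
    have := (integral_nonneg (μ := P) fun ω => sq_nonneg (S 0 ω)).trans (hC 0)
    simpa using this
  have hsum : ∫⁻ ω, ∑' n, ENNReal.ofReal (S n ω ^ 2) ∂P ≠ ∞ := by
    rw [lintegral_tsum hmeas]
    have hle : ∀ n, ∫⁻ ω, ENNReal.ofReal (S n ω ^ 2) ∂P ≤ ENNReal.ofReal (C / 2 ^ n) := fun n => by
      rw [← ofReal_integral_eq_lintegral_ofReal (hS n).integrable_sq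
        (Eventually.of_forall fun ω => sq_nonneg _)]
      exact ENNReal.ofReal_le_ofReal (hC n)
    refine ne_top_of_le_ne_top ?_ (ENNReal.tsum_le_tsum hle)
    have hs : Summable fun n : ℕ => C / 2 ^ n := by
      simpa [div_eq_mul_inv, inv_pow] using
        (summable_geometric_of_lt_one (by norm_num : (0 : ℝ) ≤ 2⁻¹) (by norm_num)).mul_left C
    rw [← ENNReal.ofReal_tsum_of_nonneg (fun n => by positivity) hs]
    exact ENNReal.ofReal_ne_top
  filter_upwards [ae_lt_top' (AEMeasurable.tsum hmeas) hsum] with ω hω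
  have h1 := ENNReal.tendsto_atTop_zero_of_tsum_ne_top hω.ne
  have h2 := (ENNReal.tendsto_toReal ENNReal.zero_ne_top).comp h1
  have h3 : Tendsto (fun n => S n ω ^ 2) atTop (𝓝 0) := by
    simpa [Function.comp_def, ENNReal.toReal_ofReal, sq_nonneg] using h2
  have h4 := (Real.continuous_sqrt.tendsto 0).comp h3
  rw [Real.sqrt_zero] at h4
  refine (tendsto_zero_iff_abs_tendsto_zero _).2 (h4.congr fun n => ?_)
  simp [Real.sqrt_sq_eq_abs]

set_option maxHeartbeats 1000000 in
/-- Itô's formula for the stochastic exponential, weighted by a bounded adapted process. -/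
theorem IsNoiseFiltration.ae_tendsto_sum_expPath (hN : IsNoiseFiltration P 𝓕 B B0)
    {a b c : Ω → ℝ} (ha : Measurable[𝓕 0] a) (hb : Measurable[𝓕 0] b) (hc : Measurable[𝓕 0] c)
    {K : ℝ≥0} (haK : ∀ ω, |a ω| ≤ K) (hbK : ∀ ω, |b ω| ≤ K) (hcK : ∀ ω, |c ω| ≤ K)
    (t : ℝ≥0) {H : ℝ≥0 → Ω → ℝ} {M : ℝ} (hH : ∀ s, Measurable[𝓕 s] (H s))
    (hM : ∀ s ω, |H s ω| ≤ M) :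
    ∀ᵐ ω ∂P, Tendsto (fun n => ∑ k ∈ Finset.range (2 ^ n), H (dyadicPoint t n k) ω *
      (expPath B B0 a b c (dyadicPoint t n (k + 1)) ω - expPath B B0 a b c (dyadicPoint t n k) ω
      - expPath B B0 a b c (dyadicPoint t n k) ω * (a ω * (t / 2 ^ n)
        + b ω * (B (dyadicPoint t n (k + 1)) ω - B (dyadicPoint t n k) ω)
        + c ω * (B0 (dyadicPoint t n (k + 1)) ω - B0 (dyadicPoint t n k) ω))))
      atTop (𝓝 0) := by
  obtain ⟨C1, hC1, hstep⟩ := exists_integral_sq_stepError_le K t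
  set e := expPath B B0 a b c with he
  set Ce : ℝ := Real.exp ((2 * K + 2 * K ^ 2) * t) with hCe
  set C2 : ℝ := K ^ 2 * Real.exp (K * t) with hC2
  have hem : ∀ s, Measurable[𝓕 s] (e s) := hN.measurable_expPath ha hb hc
  have hem' : ∀ s, Measurable (e s) := fun s => (hem s).mono (hN.le _) le_rfl
  have hHm' : ∀ s, Measurable (H s) := fun s => (hH s).mono (hN.le _) le_rfl
  have ham : Measurable a := ha.mono (hN.le _) le_rfl
  have hH2 : ∀ s ω, H s ω ^ 2 ≤ M ^ 2 := fun s ω => sq_le_sq' (abs_le.1 (hM s ω)).1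
    (abs_le.1 (hM s ω)).2
  have h0 : ∀ {s : ℝ≥0} {g : Ω → ℝ}, Measurable[𝓕 0] g → Measurable[𝓕 s] g :=
    fun hg => hg.mono (hN.mono zero_le) le_rfl
  -- The second moments decay like `1 / 2 ^ n`. Being summable, they give almost sure convergence
  -- along the whole dyadic sequence, without passing to a subsequence.
  have key : ∀ n, MemLp (fun ω => ∑ k ∈ Finset.range (2 ^ n), H (dyadicPoint t n k) ω *
      (e (dyadicPoint t n (k + 1)) ω - e (dyadicPoint t n k) ω
      - e (dyadicPoint t n k) ω * (a ω * (t / 2 ^ n)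
        + b ω * (B (dyadicPoint t n (k + 1)) ω - B (dyadicPoint t n k) ω)
        + c ω * (B0 (dyadicPoint t n (k + 1)) ω - B0 (dyadicPoint t n k) ω)))) 2 P ∧
      ∫ ω, (∑ k ∈ Finset.range (2 ^ n), H (dyadicPoint t n k) ω *
      (e (dyadicPoint t n (k + 1)) ω - e (dyadicPoint t n k) ω
      - e (dyadicPoint t n k) ω * (a ω * (t / 2 ^ n)
        + b ω * (B (dyadicPoint t n (k + 1)) ω - B (dyadicPoint t n k) ω)
        + c ω * (B0 (dyadicPoint t n (k + 1)) ω - B0 (dyadicPoint t n k) ω)))) ^ 2 ∂P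
      ≤ (2 * (t ^ 2 * M ^ 2 * Ce * C1) + 2 * (t ^ 4 * M ^ 2 * Ce * C2 ^ 2)) / 2 ^ n := by
    intro n
    set d : ℝ := t / 2 ^ n with hd
    have hd0 : 0 ≤ d := by positivity
    have htd : ((2 ^ n : ℕ) : ℝ) * d = t := by
      rw [hd]; push_cast; field_simp
    have hdt : d ≤ t := div_le_self t.coe_nonneg (one_le_pow₀ one_le_two)
    set p := dyadicPoint t n with hp
    have hpd : ∀ k, ((p (k + 1) - p k : ℝ≥0) : ℝ) = d := fun k => by
      rw [NNReal.coe_sub (dyadicPoint_mono t n (Nat.le_succ k)), dyadicPoint_succ_sub]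
    have hpd' : ∀ k, (p (k + 1) : ℝ) - p k = d := fun k => dyadicPoint_succ_sub t n k
    have hpdle : ∀ k, (p (k + 1) - p k : ℝ≥0) ≤ t := fun k => by
      rw [← NNReal.coe_le_coe, hpd]; exact hdt
    have hpt : ∀ k < 2 ^ n, p k ≤ t := fun k hk => dyadicPoint_le hk.le
    have hei : ∀ k < 2 ^ n, Integrable (fun ω => e (p k) ω ^ 2) P ∧
        ∫ ω, e (p k) ω ^ 2 ∂P ≤ Ce := fun k hk =>
      hN.integral_sq_expPath_le ha hb hc haK hbK hcK (hpt k hk)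
    -- Orthogonality adds up `2 ^ n` variances of order `d²`, in total of order `d`.
    obtain ⟨hL, hbd⟩ := hN.transform_bound (dyadicPoint_mono t n) (2 ^ n)
      (C := fun k ω => (H (p k) ω * e (p k) ω, a ω, b ω, c ω))
      (f := fun k q => q.1.1 * stepError ((p (k + 1) - p k : ℝ≥0) : ℝ) q.1.2.1 q.1.2.2.1 q.1.2.2.2
        q.2)
      (Q := fun k ω => M ^ 2 * C1 * d ^ 2 * e (p k) ω ^ 2)
      (fun k hk => ((hH _).mul (hem _)).prodMk ((h0 ha).prodMk ((h0 hb).prodMk (h0 hc))))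
      (fun k => by unfold stepError; fun_prop)
      (fun k q => by
        simp only
        rw [integral_const_mul, integral_stepError, mul_zero])
      (fun k q => by
        simp only [mul_pow]
        exact (integral_sq_stepError _ _ _ _).1.const_mul _)
      (fun k hk ω => by
        simp only [mul_pow]
        rw [integral_const_mul]
        have h1 := hstep _ (a ω) (b ω) (c ω) (hpdle k) (haK ω) (hbK ω) (hcK ω)
        rw [hpd] at h1 ⊢
        calc _ ≤ M ^ 2 * e (p k) ω ^ 2 * (C1 * d ^ 2) :=
              mul_le_mul (mul_le_mul_of_nonneg_right (hH2 _ _) (sq_nonneg _)) h1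
                (integral_nonneg fun z => sq_nonneg _) (by positivity)
          _ = _ := by ring)
      (fun k hk => (hei k hk).1.const_mul _)
    set ξ : ℕ → Ω → ℝ := fun k ω => H (p k) ω * e (p k) ω *
      stepError ((p (k + 1) - p k : ℝ≥0) : ℝ) (a ω) (b ω) (c ω)
        (B (p (k + 1)) ω - B (p k) ω, B0 (p (k + 1)) ω - B0 (p k) ω) with hξ
    set A : ℕ → Ω → ℝ := fun k ω => H (p k) ω * e (p k) ω *
      (Real.exp (a ω * d) - 1 - a ω * d) with hA
    have hsplit : ∀ ω, ∑ k ∈ Finset.range (2 ^ n), H (p k) ω *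
        (e (p (k + 1)) ω - e (p k) ω - e (p k) ω * (a ω * d + b ω * (B (p (k + 1)) ω - B (p k) ω)
          + c ω * (B0 (p (k + 1)) ω - B0 (p k) ω)))
        = (∑ k ∈ Finset.range (2 ^ n), ξ k ω) + ∑ k ∈ Finset.range (2 ^ n), A k ω := by
      intro ω
      rw [← Finset.sum_add_distrib]
      refine Finset.sum_congr rfl fun k _ => ?_
      have := expPath_step B B0 a b c (u := p k) (v := p (k + 1)) ω
      rw [hpd' k] at this
      rw [he, this]
      simp only [hξ, hA, he, hpd]
      ring
    have hAm : ∀ k, Measurable (A k) := fun k =>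
      ((hHm' _).mul (hem' _)).mul (by fun_prop)
    -- The remainders are of size `d²`. Even with the factor `2 ^ n` lost in Cauchy-Schwarz, the
    -- second moment of their sum is of order `2 ^ n * 2 ^ n * d ^ 4 = t² d²`.
    have hAsq : ∀ k ω, A k ω ^ 2 ≤ M ^ 2 * C2 ^ 2 * d ^ 4 * e (p k) ω ^ 2 := by
      intro k ω
      have h1 : |a ω * d| ≤ K * t := by
        rw [abs_mul, abs_of_nonneg hd0]
        have := haK ω
        gcongr
      have h2 : |Real.exp (a ω * d) - 1 - a ω * d| ≤ C2 * d ^ 2 := by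
        refine (exp_sub_one_sub_le h1).trans ?_
        rw [mul_pow, ← sq_abs (a ω)]
        have := haK ω
        calc _ ≤ (K : ℝ) ^ 2 * d ^ 2 * Real.exp (K * t) := by gcongr
          _ = _ := by rw [hC2]; ring
      have h3 : (Real.exp (a ω * d) - 1 - a ω * d) ^ 2 ≤ (C2 * d ^ 2) ^ 2 :=
        sq_le_sq' (abs_le.1 h2).1 (abs_le.1 h2).2
      simp only [hA, mul_pow]
      calc _ ≤ M ^ 2 * e (p k) ω ^ 2 * (C2 * d ^ 2) ^ 2 :=
            mul_le_mul (mul_le_mul_of_nonneg_right (hH2 _ _) (sq_nonneg _)) h3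
              (sq_nonneg _) (by positivity)
        _ = _ := by ring
    have hALk : ∀ k < 2 ^ n, MemLp (A k) 2 P := fun k hk => by
      rw [memLp_two_iff_integrable_sq (hAm k).aestronglyMeasurable]
      refine ((hei k hk).1.const_mul (M ^ 2 * C2 ^ 2 * d ^ 4)).mono'
        ((hAm k).pow_const 2).aestronglyMeasurable (Eventually.of_forall fun ω => ?_)
      rw [Real.norm_eq_abs, abs_of_nonneg (sq_nonneg _)]
      exact hAsq k ω
    have hAL : MemLp (fun ω => ∑ k ∈ Finset.range (2 ^ n), A k ω) 2 P :=
      memLp_finsetSum _ fun k hk => hALk k (Finset.mem_range.1 hk)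
    have hξL : MemLp (fun ω => ∑ k ∈ Finset.range (2 ^ n), ξ k ω) 2 P :=
      memLp_finsetSum _ fun k hk => hL k (Finset.mem_range.1 hk)
    have hξbd : ∫ ω, (∑ k ∈ Finset.range (2 ^ n), ξ k ω) ^ 2 ∂P
        ≤ t * M ^ 2 * Ce * C1 * d := by
      refine hbd.trans ?_
      calc _ ≤ ∑ k ∈ Finset.range (2 ^ n), M ^ 2 * C1 * d ^ 2 * Ce := by
            refine Finset.sum_le_sum fun k hk => ?_
            rw [integral_const_mul]
            gcongr
            exact (hei k (Finset.mem_range.1 hk)).2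
        _ = (((2 ^ n : ℕ) : ℝ) * d) * M ^ 2 * Ce * C1 * d := by
            rw [Finset.sum_const, Finset.card_range, nsmul_eq_mul]; ring
        _ = _ := by rw [htd]
    have hAbd : ∫ ω, (∑ k ∈ Finset.range (2 ^ n), A k ω) ^ 2 ∂P
        ≤ t ^ 3 * M ^ 2 * Ce * C2 ^ 2 * d := by
      have hI : Integrable (fun ω => ((2 ^ n : ℕ) : ℝ) * ∑ k ∈ Finset.range (2 ^ n),
          M ^ 2 * C2 ^ 2 * d ^ 4 * e (p k) ω ^ 2) P :=
        (integrable_finsetSum _ fun k hk =>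
          (hei k (Finset.mem_range.1 hk)).1.const_mul _).const_mul _
      calc _ ≤ ∫ ω, ((2 ^ n : ℕ) : ℝ) * ∑ k ∈ Finset.range (2 ^ n),
              M ^ 2 * C2 ^ 2 * d ^ 4 * e (p k) ω ^ 2 ∂P := by
            refine integral_mono hAL.integrable_sq hI fun ω => ?_
            refine (sq_sum_le_card_mul_sum_sq).trans ?_
            rw [Finset.card_range]
            gcongr with k hk
            exact hAsq k ω
        _ ≤ ((2 ^ n : ℕ) : ℝ) * ∑ k ∈ Finset.range (2 ^ n), M ^ 2 * C2 ^ 2 * d ^ 4 * Ce := by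
            rw [integral_const_mul, integral_finsetSum _ fun k hk =>
              (hei k (Finset.mem_range.1 hk)).1.const_mul _]
            gcongr with k hk
            rw [integral_const_mul]
            gcongr
            exact (hei k (Finset.mem_range.1 hk)).2
        _ = (((2 ^ n : ℕ) : ℝ) * d) ^ 2 * M ^ 2 * Ce * C2 ^ 2 * d ^ 2 := by
            rw [Finset.sum_const, Finset.card_range, nsmul_eq_mul]; ring
        _ = t ^ 2 * M ^ 2 * Ce * C2 ^ 2 * d * d := by rw [htd]; ring
        _ ≤ t ^ 2 * M ^ 2 * Ce * C2 ^ 2 * d * t := by gcongr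
        _ = _ := by ring
    simp_rw [hsplit]
    refine ⟨hξL.add hAL, ?_⟩
    calc _ ≤ ∫ ω, (2 * (∑ k ∈ Finset.range (2 ^ n), ξ k ω) ^ 2
          + 2 * (∑ k ∈ Finset.range (2 ^ n), A k ω) ^ 2) ∂P := by
          refine integral_mono (hξL.add hAL).integrable_sq
            ((hξL.integrable_sq.const_mul 2).add (hAL.integrable_sq.const_mul 2)) fun ω => ?_
          refine add_sq_le.trans ?_
          rw [mul_add]
      _ = 2 * ∫ ω, (∑ k ∈ Finset.range (2 ^ n), ξ k ω) ^ 2 ∂P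
          + 2 * ∫ ω, (∑ k ∈ Finset.range (2 ^ n), A k ω) ^ 2 ∂P := by
          rw [integral_add (hξL.integrable_sq.const_mul 2) (hAL.integrable_sq.const_mul 2),
            integral_const_mul, integral_const_mul]
      _ ≤ 2 * (t * M ^ 2 * Ce * C1 * d) + 2 * (t ^ 3 * M ^ 2 * Ce * C2 ^ 2 * d) := by gcongr
      _ = _ := by rw [hd]; ring
  exact ae_tendsto_zero_of_integral_sq_le (fun n => (key n).1) fun n => (key n).2

end Exponential

/-! ### Integer-valued measures -/

section IntegerValued

variable {F : Type*} [MeasurableSpace F] [StandardBorelSpace F]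

/-- A nonzero finite integer-valued measure has an atom. -/
lemma exists_atom_of_integer_valued {μ : Measure F} [IsFiniteMeasure μ]
    (h : ∀ B, MeasurableSet B → ∃ k : ℕ, μ B = k) (h0 : μ ≠ 0) : ∃ x, μ {x} ≠ 0 := by
  classical
  -- A measurable set `C` of least positive mass exists because masses are integers. Every
  -- measurable subset of it then has mass `0` or the mass of `C`.
  have hex : ∃ k : ℕ, k ≠ 0 ∧ ∃ C, MeasurableSet C ∧ μ C = k := by
    obtain ⟨k, hk⟩ := h Set.univ MeasurableSet.univ
    refine ⟨k, ?_, Set.univ, MeasurableSet.univ, hk⟩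
    rintro rfl
    exact h0 (Measure.measure_univ_eq_zero.1 (by simpa using hk))
  obtain ⟨hk0, C, hC, hCk⟩ := Nat.find_spec hex
  have hmin : ∀ B, MeasurableSet B → μ B < μ C → μ B = 0 := by
    intro B hB hlt
    obtain ⟨k, hk⟩ := h B hB
    by_contra hne
    rw [hk, hCk] at hlt
    exact Nat.find_min hex (by exact_mod_cast hlt) ⟨fun hk0' => hne (by simp [hk, hk0']), B, hB, hk⟩
  have hCne : C.Nonempty := by
    rw [Set.nonempty_iff_ne_empty]
    rintro rfl
    exact hk0 (by exact_mod_cast (measure_empty (μ := μ)).symm.trans hCk |>.symm)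
  -- Restricted to `C` the measure takes only two values. A countable separating family of
  -- measurable sets then forces it onto a single point.
  obtain ⟨x, -, hx⟩ := Filter.exists_mem_singleton_mem_of_mem_of_nonempty_of_forall_separating
    (l := ae (μ.restrict C)) (s := Set.univ) MeasurableSet univ_mem
    (hCne.mono (Set.subset_univ _)) fun U hU => by
      have hsplit := measure_inter_add_sdiff (μ := μ) C hU
      by_cases hz : μ (C \ U) = 0
      · left
        rw [mem_ae_iff, Measure.restrict_apply hU.compl, Set.inter_comm, ← Set.sdiff_eq]
        exact hz
      · right
        rw [mem_ae_iff, compl_compl, Measure.restrict_apply hU, Set.inter_comm]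
        refine hmin _ (hC.inter hU) ?_
        rw [← hsplit]
        exact ENNReal.lt_add_right (measure_ne_top _ _) hz
  refine ⟨x, fun hx0 => ?_⟩
  rw [mem_ae_iff, Measure.restrict_apply (measurableSet_singleton x).compl] at hx
  have : μ C ≤ μ ({x}ᶜ ∩ C) + μ {x} := by
    refine (measure_mono fun y hy => ?_).trans (measure_union_le _ _)
    by_cases hyx : y = x
    · exact Or.inr hyx
    · exact Or.inl ⟨hyx, hy⟩
  rw [hx, hx0, add_zero, hCk] at this
  exact hk0 (by exact_mod_cast le_antisymm this zero_le)

/-- A finite integer-valued measure is a finite sum of point masses. -/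
theorem exists_sum_dirac_of_integer_valued (n : ℕ) : ∀ {μ : Measure F} (_ : μ Set.univ = n)
    (_ : ∀ B, MeasurableSet B → ∃ k : ℕ, μ B = k),
    ∃ (A : Finset F) (c : F → ℕ), (∀ x ∈ A, c x ≠ 0) ∧
      μ = ∑ x ∈ A, (c x : ℝ≥0∞) • Measure.dirac x := by
  classical
  induction n using Nat.strong_induction_on with
  | _ n ih =>
    intro μ hn h
    have : IsFiniteMeasure μ := ⟨by rw [hn]; exact ENNReal.natCast_lt_top n⟩
    by_cases h0 : μ = 0
    · exact ⟨∅, 0, by simp, by simp [h0]⟩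
    obtain ⟨x, hx⟩ := exists_atom_of_integer_valued h h0
    obtain ⟨k, hk⟩ := h {x} (measurableSet_singleton x)
    obtain ⟨m, hm⟩ := h {x}ᶜ (measurableSet_singleton x).compl
    have hk0 : k ≠ 0 := fun hk0 => hx (by simp [hk, hk0])
    have hmn : m < n := by
      have := measure_add_measure_compl (μ := μ) (measurableSet_singleton x)
      rw [hk, hm, hn] at this
      have : k + m = n := by exact_mod_cast this
      omega
    obtain ⟨A, c, hc, hA⟩ := ih m hmn (μ := μ.restrict {x}ᶜ) (by simpa using hm) fun B hB => by
      rw [Measure.restrict_apply hB]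
      exact h _ (hB.inter (measurableSet_singleton x).compl)
    have hxA : x ∉ A := by
      intro hxA
      have h1 : μ.restrict {x}ᶜ {x} = 0 := by
        rw [Measure.restrict_apply (measurableSet_singleton x)]
        simp
      rw [hA, Measure.finsetSum_apply, Finset.sum_eq_zero_iff] at h1
      have := h1 x hxA
      simp [hc x hxA] at this
    refine ⟨insert x A, Function.update c x k, ?_, ?_⟩
    · intro y hy
      by_cases hyx : y = x
      · subst hyx; simpa using hk0
      · rw [Function.update_of_ne hyx]
        exact hc y (by simpa [hyx] using hy)
    · rw [Finset.sum_insert hxA, Function.update_self]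
      have h1 : ∑ y ∈ A, ((Function.update c x k y : ℕ) : ℝ≥0∞) • Measure.dirac y
          = ∑ y ∈ A, (c y : ℝ≥0∞) • Measure.dirac y :=
        Finset.sum_congr rfl fun y hy => by
          have hyx : y ≠ x := by
            rintro rfl
            exact hxA hy
          rw [Function.update_of_ne hyx]
      rw [h1, ← hA]
      conv_lhs => rw [← Measure.restrict_add_restrict_compl (μ := μ) (measurableSet_singleton x)]
      rw [Measure.restrict_singleton, hk]

end IntegerValued

/-! ### Poisson random measures on a time axis -/

section Poisson

lemma measurableEmbedding_coe_nnreal : MeasurableEmbedding (fun t : ℝ≥0 => (t : ℝ)) :=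
  NNReal.isClosedEmbedding_coe.measurableEmbedding

lemma timeMeasure_Ioc (u v : ℝ≥0) : timeMeasure (Set.Ioc u v) = ENNReal.ofReal (v - u) := by
  rw [timeMeasure, measurableEmbedding_coe_nnreal.comap_apply]
  have : (fun t : ℝ≥0 => (t : ℝ)) '' Set.Ioc u v = Set.Ioc (u : ℝ) v := by
    ext x
    constructor
    · rintro ⟨t, ht, rfl⟩
      exact ⟨by exact_mod_cast ht.1, by exact_mod_cast ht.2⟩
    · rintro ⟨h1, h2⟩
      have hx : 0 ≤ x := u.coe_nonneg.trans h1.le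
      exact ⟨⟨x, hx⟩, ⟨h1, h2⟩, rfl⟩
  rw [this, Real.volume_Ioc]

lemma timeMeasure_singleton (u : ℝ≥0) : timeMeasure {u} = 0 := by
  rw [timeMeasure, measurableEmbedding_coe_nnreal.comap_apply]
  simp

/-- `1 - (1 + r) exp (-r) ≤ 1 - (1 + r) (1 - r) = r²`. -/
lemma poissonMeasure_ge_two_le (r : ℝ≥0) :
    poissonMeasure r {k | 2 ≤ k} ≤ ENNReal.ofReal (r ^ 2) := by
  have h1 : ({k | 2 ≤ k} : Set ℕ) = ({0} ∪ {1})ᶜ := by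
    ext k
    simp only [Set.mem_ofPred_eq, Set.mem_compl_iff, Set.mem_union, Set.mem_singleton_iff]
    omega
  rw [← ofReal_measureReal]
  refine ENNReal.ofReal_le_ofReal ?_
  rw [h1, probReal_compl_eq_one_sub (by measurability),
    measureReal_union (by simp) (by measurability),
    poissonMeasure_real_singleton, poissonMeasure_real_singleton]
  have := Real.add_one_le_exp (-(r : ℝ))
  simp only [pow_zero, Nat.factorial, pow_one]
  have hr := r.coe_nonneg
  push_cast
  nlinarith

variable {Ω G : Type*} {mΩ : MeasurableSpace Ω} [MeasurableSpace G] [StandardBorelSpace G]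
  {P : Measure Ω} [IsProbabilityMeasure P] {N : Ω → Measure (ℝ≥0 × G)} {ρ : Measure G}
  [IsFiniteMeasure ρ]

/-- The time strip `[0, T]`. -/
def strip (G : Type*) (T : ℝ≥0) : Set (ℝ≥0 × G) := Set.Icc 0 T ×ˢ Set.univ

omit [StandardBorelSpace G] in
lemma measurableSet_strip (T : ℝ≥0) : MeasurableSet (strip G T) :=
  measurableSet_Icc.prod MeasurableSet.univ

omit [IsProbabilityMeasure P] in
lemma IsPoissonRandomMeasure.measurable_apply {F : Type*} [MeasurableSpace F]
    {N : Ω → Measure F} {μ : Measure F} (hN : IsPoissonRandomMeasure N μ P)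
    {B : Set F} (hB : MeasurableSet B) : Measurable fun ω => N ω B :=
  (Measure.measurable_coe hB).comp hN.measurable

omit [IsProbabilityMeasure P] in
lemma IsPoissonRandomMeasure.measure_mem {F : Type*} [MeasurableSpace F]
    {N : Ω → Measure F} {μ : Measure F} (hN : IsPoissonRandomMeasure N μ P)
    {B : Set F} (hB : MeasurableSet B) (hμ : μ B ≠ ⊤) {S : Set ℝ≥0∞} (hS : MeasurableSet S) :
    P {ω | N ω B ∈ S} = poissonMeasure (μ B).toNNReal {k | (k : ℝ≥0∞) ∈ S} := by
  have := congrArg (fun m => m S) (hN.law B hB hμ)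
  rw [Measure.map_apply (hN.measurable_apply hB) hS,
    Measure.map_apply (measurable_of_countable _) hS] at this
  exact this

omit [IsProbabilityMeasure P] in
lemma IsPoissonRandomMeasure.ae_ne_top {F : Type*} [MeasurableSpace F]
    {N : Ω → Measure F} {μ : Measure F} (hN : IsPoissonRandomMeasure N μ P)
    {B : Set F} (hB : MeasurableSet B) (hμ : μ B ≠ ⊤) : ∀ᵐ ω ∂P, N ω B ≠ ⊤ := by
  rw [ae_iff]
  simp only [not_not]
  have := hN.measure_mem hB hμ (measurableSet_singleton ⊤)
  simpa using this

omit [IsProbabilityMeasure P] in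
lemma IsPoissonRandomMeasure.ae_eq_zero {F : Type*} [MeasurableSpace F]
    {N : Ω → Measure F} {μ : Measure F} (hN : IsPoissonRandomMeasure N μ P)
    {B : Set F} (hB : MeasurableSet B) (hμ : μ B = 0) : ∀ᵐ ω ∂P, N ω B = 0 := by
  rw [ae_iff]
  have := hN.measure_mem hB (by simp [hμ]) (measurableSet_singleton 0).compl
  simp only [Set.mem_compl_iff, Set.mem_singleton_iff] at this
  rw [this, hμ]
  have h1 : ({k | ¬((k : ℝ≥0∞) = 0)} : Set ℕ) = {0}ᶜ := by
    ext k; simp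
  rw [h1, prob_compl_eq_zero_iff (measurableSet_singleton 0), ← ofReal_measureReal,
    poissonMeasure_real_singleton]
  simp

omit [IsProbabilityMeasure P] in
lemma IsPoissonRandomMeasure.measure_two_le {F : Type*} [MeasurableSpace F]
    {N : Ω → Measure F} {μ : Measure F} (hN : IsPoissonRandomMeasure N μ P)
    {B : Set F} (hB : MeasurableSet B) (hμ : μ B ≠ ⊤) :
    P {ω | 2 ≤ N ω B} ≤ ENNReal.ofReal ((μ B).toReal ^ 2) := by
  have := hN.measure_mem hB hμ (S := Set.Ici 2) measurableSet_Ici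
  simp only [Set.mem_Ici] at this
  rw [this]
  refine le_trans (le_of_eq ?_) ((poissonMeasure_ge_two_le (μ B).toNNReal).trans_eq ?_)
  · congr 1
    ext k
    simp only [Set.mem_ofPred_eq]
    exact_mod_cast Iff.rfl
  · rfl

omit [StandardBorelSpace G] [IsProbabilityMeasure P] in
/-- Almost surely, no two atoms occur at the same time. -/
lemma IsPoissonRandomMeasure.ae_exists_dyadic_le_one
    (hN : IsPoissonRandomMeasure N (timeMeasure.prod ρ) P) (T : ℝ≥0) :
    ∀ᵐ ω ∂P, ∃ n : ℕ, ∀ k < 2 ^ n,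
      N ω (Set.Ioc (dyadicPoint T n k) (dyadicPoint T n (k + 1)) ×ˢ Set.univ) < 2 := by
  rw [ae_iff]
  set c : ℝ := (ρ Set.univ).toReal with hc
  have hI : ∀ n k, (timeMeasure.prod ρ)
      (Set.Ioc (dyadicPoint T n k) (dyadicPoint T n (k + 1)) ×ˢ Set.univ)
      = ENNReal.ofReal (T / 2 ^ n * c) := by
    intro n k
    rw [Measure.prod_prod, timeMeasure_Ioc, dyadicPoint_succ_sub,
      ENNReal.ofReal_mul (by positivity), hc, ENNReal.ofReal_toReal (measure_ne_top _ _)]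
  -- If no level separates the atoms, level `n` fails in particular. The union bound over its `2 ^
  -- n` intervals gives `2 ^ n * (T c / 2 ^ n)²`.
  have hle : ∀ n : ℕ, P {ω | ¬∃ n : ℕ, ∀ k < 2 ^ n,
      N ω (Set.Ioc (dyadicPoint T n k) (dyadicPoint T n (k + 1)) ×ˢ Set.univ) < 2}
      ≤ ENNReal.ofReal ((T * c) ^ 2 / 2 ^ n) := by
    intro n
    calc _ ≤ P (⋃ k ∈ Finset.range (2 ^ n), {ω | 2 ≤
          N ω (Set.Ioc (dyadicPoint T n k) (dyadicPoint T n (k + 1)) ×ˢ Set.univ)}) := by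
          refine measure_mono fun ω hω => ?_
          simp only [Set.mem_ofPred_eq, not_exists, not_forall, not_lt] at hω
          obtain ⟨k, hk, h⟩ := hω n
          simp only [Set.mem_iUnion, Finset.mem_range]
          exact ⟨k, hk, h⟩
      _ ≤ ∑ k ∈ Finset.range (2 ^ n), P {ω | 2 ≤
          N ω (Set.Ioc (dyadicPoint T n k) (dyadicPoint T n (k + 1)) ×ˢ Set.univ)} :=
          measure_biUnion_finset_le _ _
      _ ≤ ∑ k ∈ Finset.range (2 ^ n), ENNReal.ofReal ((T / 2 ^ n * c) ^ 2) := by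
          refine Finset.sum_le_sum fun k _ => ?_
          refine (hN.measure_two_le (measurableSet_Ioc.prod MeasurableSet.univ)
            (by rw [hI]; exact ENNReal.ofReal_ne_top)).trans_eq ?_
          rw [hI, ENNReal.toReal_ofReal (by positivity)]
      _ = _ := by
          rw [Finset.sum_const, Finset.card_range, ← ENNReal.ofReal_nsmul, nsmul_eq_mul]
          congr 1
          push_cast
          field_simp
  have hlim : Tendsto (fun n : ℕ => ENNReal.ofReal ((T * c) ^ 2 / 2 ^ n)) atTop (𝓝 0) := by
    rw [← ENNReal.ofReal_zero]
    exact (ENNReal.continuous_ofReal.tendsto 0).comp (tendsto_div_two_pow _)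
  exact le_antisymm (ge_of_tendsto' hlim hle) zero_le

omit [IsProbabilityMeasure P] in
/-- Almost surely, the restriction of the random measure to `[0, T]` is a finite sum of point masses
at distinct positive times. -/
theorem IsPoissonRandomMeasure.ae_exists_sum_dirac [Nonempty G]
    (hN : IsPoissonRandomMeasure N (timeMeasure.prod ρ) P) (T : ℝ≥0) :
    ∀ᵐ ω ∂P, ∃ (A : Finset ℝ≥0) (e : ℝ≥0 → G), (∀ u ∈ A, 0 < u ∧ u ≤ T) ∧
      (N ω).restrict (strip G T) = ∑ u ∈ A, Measure.dirac (u, e u) := by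
  classical
  have hμT : (timeMeasure.prod ρ) (strip G T) ≠ ⊤ := by
    rw [strip, Measure.prod_prod]
    refine ENNReal.mul_ne_top ?_ (measure_ne_top _ _)
    have : Set.Icc 0 T ⊆ {0} ∪ Set.Ioc 0 T := fun x hx => by
      rcases eq_or_ne x 0 with h | h
      · exact Or.inl h
      · exact Or.inr ⟨pos_iff_ne_zero.2 h, hx.2⟩
    refine ne_top_of_le_ne_top ?_ ((measure_mono this).trans (measure_union_le _ _))
    simp [timeMeasure_singleton, timeMeasure_Ioc]
  have hμ0 : (timeMeasure.prod ρ) ({0} ×ˢ (Set.univ : Set G)) = 0 := by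
    rw [Measure.prod_prod, timeMeasure_singleton, zero_mul]
  filter_upwards [hN.integer_valued, hN.ae_ne_top (measurableSet_strip T) hμT,
    hN.ae_eq_zero ((measurableSet_singleton 0).prod MeasurableSet.univ) hμ0,
    hN.ae_exists_dyadic_le_one T] with ω hint htop hzero hdy
  set R := strip G T
  have hint' : ∀ B, MeasurableSet B → ∃ k : ℕ, (N ω).restrict R B = k := by
    intro B hB
    rw [Measure.restrict_apply hB]
    refine (hint _ (hB.inter (measurableSet_strip T))).resolve_left ?_
    exact ne_top_of_le_ne_top htop (measure_mono Set.inter_subset_right)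
  obtain ⟨n, hn⟩ := hint' Set.univ MeasurableSet.univ
  obtain ⟨A, c, hc, hA⟩ := exists_sum_dirac_of_integer_valued n hn hint'
  have hone : ∀ x ∈ A, ∀ B, MeasurableSet B → x ∈ B → (1 : ℝ≥0∞) ≤ (N ω).restrict R B := by
    intro x hx B hB hxB
    rw [hA, Measure.finsetSum_apply]
    refine le_trans ?_ (Finset.single_le_sum (fun _ _ => zero_le) hx)
    rw [Measure.smul_apply, Measure.dirac_apply' _ hB, Set.indicator_of_mem hxB]
    simp only [Pi.one_apply, smul_eq_mul, mul_one]
    exact_mod_cast Nat.one_le_iff_ne_zero.2 (hc x hx)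
  have hR : ∀ x ∈ A, x ∈ R := by
    intro x hx
    by_contra h
    have := hone x hx Rᶜ (measurableSet_strip T).compl h
    rw [Measure.restrict_apply (measurableSet_strip T).compl, Set.compl_inter_self,
      measure_empty] at this
    exact absurd this (by simp)
  have hpos : ∀ x ∈ A, 0 < x.1 := by
    intro x hx
    by_contra h
    have h0 : x.1 = 0 := by simpa using h
    have := hone x hx ({0} ×ˢ Set.univ) ((measurableSet_singleton 0).prod MeasurableSet.univ)
      ⟨h0, trivial⟩
    have h2 := (this.trans (Measure.restrict_apply_le _ _)).trans_eq hzero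
    simp at h2
  obtain ⟨m, hm⟩ := hdy
  have hI : ∀ x ∈ A, ∃ k < 2 ^ m, x ∈ Set.Ioc (dyadicPoint T m k) (dyadicPoint T m (k + 1)) ×ˢ
      (Set.univ : Set G) := by
    intro x hx
    have hxT : x.1 ≤ T := (hR x hx).1.2
    have hT : 0 < T := (hpos x hx).trans_le hxT
    have hx' : (0 : ℝ) < x.1 := by exact_mod_cast hpos x hx
    have hT' : (0 : ℝ) < T := by exact_mod_cast hT
    have hi : 0 < dyadicIndex T m x.1 := by
      rw [dyadicIndex, Nat.ceil_pos]; positivity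
    obtain ⟨k, hk⟩ := Nat.exists_eq_succ_of_ne_zero hi.ne'
    have h1 := dyadicIndex_le hT m (s := x.1) (by exact_mod_cast hxT)
    have h2 := le_dyadicPoint_dyadicIndex hT m x.1
    have h3 := dyadicPoint_dyadicIndex_lt hT m hx'
    have h4 := dyadicPoint_succ_sub T m k
    rw [hk] at h1 h2 h3
    refine ⟨k, by omega, ⟨?_, by exact_mod_cast h2⟩, trivial⟩
    rw [← NNReal.coe_lt_coe]
    simp only [Nat.succ_eq_add_one] at h3
    linarith
  have hbound : ∀ k < 2 ^ m, (N ω).restrict R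
      (Set.Ioc (dyadicPoint T m k) (dyadicPoint T m (k + 1)) ×ˢ Set.univ) < 2 := fun k hk =>
    (Measure.restrict_apply_le _ _).trans_lt (hm k hk)
  -- At level `m` every interval has mass below two, which excludes multiple atoms here and
  -- simultaneous atoms in `hinj`.
  have hc1 : ∀ x ∈ A, c x = 1 := by
    intro x hx
    obtain ⟨k, hk, hxk⟩ := hI x hx
    have h1 := hbound k hk
    rw [hA, Measure.finsetSum_apply] at h1
    have h2 := (Finset.single_le_sum (f := fun y => ((c y : ℝ≥0∞) • Measure.dirac y)
      (Set.Ioc (dyadicPoint T m k) (dyadicPoint T m (k + 1)) ×ˢ Set.univ))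
      (fun _ _ => zero_le) hx).trans_lt h1
    rw [Measure.smul_apply, Measure.dirac_apply' _ (measurableSet_Ioc.prod MeasurableSet.univ),
      Set.indicator_of_mem hxk] at h2
    simp only [Pi.one_apply, smul_eq_mul, mul_one] at h2
    have h3 : c x < 2 := by exact_mod_cast h2
    have := hc x hx
    omega
  have hinj : ∀ x ∈ A, ∀ y ∈ A, x.1 = y.1 → x = y := by
    intro x hx y hy hxy
    by_contra hne
    obtain ⟨k, hk, hxk⟩ := hI x hx
    have hyk : y ∈ Set.Ioc (dyadicPoint T m k) (dyadicPoint T m (k + 1)) ×ˢ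
        (Set.univ : Set G) := ⟨by rw [← hxy]; exact hxk.1, trivial⟩
    have h1 := hbound k hk
    rw [hA, Measure.finsetSum_apply] at h1
    have h2 := (Finset.sum_le_sum_of_subset (f := fun y => ((c y : ℝ≥0∞) • Measure.dirac y)
      (Set.Ioc (dyadicPoint T m k) (dyadicPoint T m (k + 1)) ×ˢ Set.univ))
      (s := {x, y}) (t := A) (by
        intro z hz
        rcases Finset.mem_insert.1 hz with h | h
        · rwa [h]
        · rwa [Finset.mem_singleton.1 h])).trans_lt h1
    rw [Finset.sum_pair hne, Measure.smul_apply, Measure.smul_apply,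
      Measure.dirac_apply' _ (measurableSet_Ioc.prod MeasurableSet.univ),
      Measure.dirac_apply' _ (measurableSet_Ioc.prod MeasurableSet.univ),
      Set.indicator_of_mem hxk, Set.indicator_of_mem hyk, hc1 x hx, hc1 y hy] at h2
    norm_num at h2
  -- Distinct atoms have distinct times, so the mark is a function of the time; off the jump times
  -- its value is immaterial.
  have hex : ∀ u : ℝ≥0, ∃ g : G, ∀ x ∈ A, x.1 = u → x.2 = g := by
    intro u
    by_cases hu : ∃ x ∈ A, x.1 = u
    · obtain ⟨x, hx, hxu⟩ := hu
      exact ⟨x.2, fun y hy hyu => by rw [hinj y hy x hx (hyu.trans hxu.symm)]⟩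
    · by_cases hne : A.Nonempty
      · obtain ⟨x, hx⟩ := hne
        exact ⟨x.2, fun y hy hyu => absurd ⟨y, hy, hyu⟩ hu⟩
      · exact ⟨Classical.arbitrary G, fun y hy => absurd ⟨y, hy⟩ hne⟩
  choose e he using hex
  refine ⟨A.image Prod.fst, e, ?_, ?_⟩
  · intro u hu
    obtain ⟨x, hx, rfl⟩ := Finset.mem_image.1 hu
    exact ⟨hpos x hx, (hR x hx).1.2⟩
  · rw [hA, Finset.sum_image fun x hx y hy h => hinj x hx y hy h]
    refine Finset.sum_congr rfl fun x hx => ?_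
    rw [hc1 x hx, ← he x.1 x hx rfl]
    simp

end Poisson

/-! ### Integration against a random measure -/

section Trunc

variable {F : Type*} [MeasurableSpace F]

open Classical in
/-- The restriction of a measure to `R` if it has mass `n` there, and `0` otherwise. -/
def massKernel {R : Set F} (hR : MeasurableSet R) (n : ℕ) : Kernel (Measure F) F :=
  Kernel.piecewise (s := {m : Measure F | m R = n})
    (measurableSet_eq_fun (Measure.measurable_coe hR) measurable_const)
    ⟨fun m => m.restrict R, Measure.measurable_of_measurable_coe _ fun s hs => by
      simp_rw [Measure.restrict_apply hs]
      exact Measure.measurable_coe (hs.inter hR)⟩ 0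

lemma massKernel_apply {R : Set F} (hR : MeasurableSet R) (n : ℕ) (m : Measure F) :
    massKernel hR n m = if m R = n then m.restrict R else 0 := by
  classical
  rw [massKernel, Kernel.piecewise_apply]
  rfl

instance {R : Set F} (hR : MeasurableSet R) (n : ℕ) : IsFiniteKernel (massKernel hR n) :=
  ⟨⟨n, ENNReal.natCast_lt_top n, fun m => by
    rw [massKernel_apply]
    split_ifs with h
    · simp [h]
    · simp⟩⟩

/-- The restriction of a measure to `R`, if it has finite integer mass there. -/
def truncKernel {R : Set F} (hR : MeasurableSet R) : Kernel (Measure F) F :=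
  Kernel.sum (massKernel hR)

/-- The splitting by mass serves this purpose: s-finiteness makes integrals jointly measurable in
the measure and in a parameter. -/
instance {R : Set F} (hR : MeasurableSet R) : IsSFiniteKernel (truncKernel hR) := by
  unfold truncKernel
  infer_instance

lemma truncKernel_apply {R : Set F} (hR : MeasurableSet R) {m : Measure F} {k : ℕ}
    (hk : m R = k) : truncKernel hR m = m.restrict R := by
  ext B hB
  rw [truncKernel, Kernel.sum_apply' _ _ hB, tsum_eq_single k]
  · rw [massKernel_apply, if_pos hk]
  · intro n hn
    rw [massKernel_apply, if_neg, Measure.coe_zero, Pi.zero_apply]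
    rw [hk]
    exact fun h => hn (by exact_mod_cast h.symm)

variable {Ω A : Type*} {mΩ : MeasurableSpace Ω} [MeasurableSpace A] {P : Measure Ω}
  [IsProbabilityMeasure P] {N : Ω → Measure F} {μ : Measure F}

/-- A random measure does not charge random null sets of its intensity that are independent
of it. -/
lemma IsPoissonRandomMeasure.ae_ae_notMem (hN : IsPoissonRandomMeasure N μ P) {R : Set F}
    (hR : MeasurableSet R) (hfin : ∀ᵐ ω ∂P, ∃ k : ℕ, N ω R = k) {τ : Ω → A} (hτ : Measurable τ)
    (hind : IndepFun τ N P) {B : Set (A × F)} (hB : MeasurableSet B)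
    (hnull : ∀ᵐ a ∂(P.map τ), μ (R ∩ Prod.mk a ⁻¹' B) = 0) :
    ∀ᵐ ω ∂P, ∀ᵐ q ∂((N ω).restrict R), (τ ω, q) ∉ B := by
  have : IsProbabilityMeasure (P.map τ) := Measure.isProbabilityMeasure_map hτ.aemeasurable
  have : IsProbabilityMeasure (P.map N) :=
    Measure.isProbabilityMeasure_map hN.measurable.aemeasurable
  set D : Set ((A × Measure F) × F) := {q | (q.1.1, q.2) ∈ B}
  have hD : MeasurableSet D := by
    have : Measurable fun q : (A × Measure F) × F => (q.1.1, q.2) := by fun_prop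
    exact this hB
  set κ : Kernel (A × Measure F) F := (truncKernel hR).comap Prod.snd measurable_snd
  have hκ : Measurable fun p : A × Measure F => κ p (Prod.mk p ⁻¹' D) :=
    Kernel.measurable_kernel_prodMk_left hD
  have hprod := (indepFun_iff_map_prod_eq_prod_map_map hτ.aemeasurable
    hN.measurable.aemeasurable).1 hind
  have hset : MeasurableSet {p : A × Measure F | κ p (Prod.mk p ⁻¹' D) ≠ 0} :=
    (hκ (measurableSet_singleton 0)).compl
  -- By independence `τ` may be frozen first. For almost every value `a` the section of `B` is null
  -- for the intensity, so `N` almost surely does not charge it.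
  have hzero : ((P.map τ).prod (P.map N)) {p | κ p (Prod.mk p ⁻¹' D) ≠ 0} = 0 := by
    rw [Measure.measure_prod_null hset]
    filter_upwards [hnull] with a ha
    have hBa : MeasurableSet (R ∩ Prod.mk a ⁻¹' B) := hR.inter (measurable_prodMk_left hB)
    have hm : MeasurableSet (Prod.mk a ⁻¹' {p : A × Measure F | κ p (Prod.mk p ⁻¹' D) ≠ 0}) :=
      measurable_prodMk_left hset
    rw [Pi.zero_apply, Measure.map_apply hN.measurable hm]
    refine measure_eq_zero_iff_ae_notMem.2 ?_
    filter_upwards [hN.ae_eq_zero hBa ha, hfin] with ω hω ⟨k, hk⟩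
    simp only [Set.mem_preimage, Set.mem_ofPred_eq, ne_eq, not_not]
    have : κ (a, N ω) = (N ω).restrict R := truncKernel_apply hR hk
    rw [this, Measure.restrict_apply (measurable_prodMk_left hD), Set.inter_comm]
    exact hω
  rw [← hprod, Measure.map_apply (hτ.prodMk hN.measurable) hset] at hzero
  filter_upwards [measure_eq_zero_iff_ae_notMem.1 hzero, hfin] with ω hω ⟨k, hk⟩
  simp only [Set.mem_preimage, Set.mem_ofPred_eq, ne_eq, not_not] at hω
  have : κ (τ ω, N ω) = (N ω).restrict R := truncKernel_apply hR hk
  rw [this] at hω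
  exact measure_eq_zero_iff_ae_notMem.1 hω

end Trunc

/-! ### Dyadic times -/

/-- The dyadic times of `[0, T]`. -/
def dyadicTimes (T : ℝ≥0) : Set ℝ≥0 := {s | ∃ n k : ℕ, k ≤ 2 ^ n ∧ s = dyadicPoint T n k}

lemma countable_dyadicTimes (T : ℝ≥0) : (dyadicTimes T).Countable := by
  refine (Set.countable_range fun p : ℕ × ℕ => dyadicPoint T p.1 p.2).mono ?_
  rintro s ⟨n, k, -, rfl⟩
  exact ⟨(n, k), rfl⟩

lemma le_of_mem_dyadicTimes {T s : ℝ≥0} (hs : s ∈ dyadicTimes T) : s ≤ T := by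
  obtain ⟨n, k, hk, rfl⟩ := hs
  exact dyadicPoint_le hk

lemma self_mem_dyadicTimes (T : ℝ≥0) : T ∈ dyadicTimes T := ⟨0, 1, by simp, by simp [dyadicPoint]⟩

lemma dyadicPoint_mem_dyadicTimes {T t : ℝ≥0} (ht : t ∈ dyadicTimes T) (n k : ℕ)
    (hk : k ≤ 2 ^ n) : dyadicPoint t n k ∈ dyadicTimes T := by
  obtain ⟨m, l, hl, rfl⟩ := ht
  refine ⟨m + n, l * k, ?_, ?_⟩
  · rw [pow_add]; exact Nat.mul_le_mul hl hk
  · simp only [dyadicPoint, pow_add, Nat.cast_mul]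
    rw [mul_assoc, div_mul_div_comm]

lemma exists_dyadicTimes_between {T u v : ℝ≥0} (huv : u < v) (hv : v ≤ T) :
    ∃ s ∈ dyadicTimes T, u < s ∧ s < v := by
  have hT : 0 < T := (zero_le.trans_lt huv).trans_le hv
  have hT' : (0 : ℝ) < T := by exact_mod_cast hT
  have huv' : (0 : ℝ) < v - u := sub_pos.2 (by exact_mod_cast huv)
  obtain ⟨n, hn⟩ := ((tendsto_div_two_pow (T : ℝ)).eventually (gt_mem_nhds huv')).exists
  have h1 := Nat.lt_floor_add_one ((u : ℝ) * 2 ^ n / T)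
  have h2 := Nat.floor_le (a := (u : ℝ) * 2 ^ n / T) (by positivity)
  set k := ⌊(u : ℝ) * 2 ^ n / T⌋₊
  have hlow : u < dyadicPoint T n (k + 1) := by
    rw [← NNReal.coe_lt_coe, coe_dyadicPoint]
    rw [div_lt_iff₀ hT'] at h1
    push_cast
    rw [mul_div_assoc', lt_div_iff₀ (by positivity)]
    linarith
  have hup : dyadicPoint T n (k + 1) < v := by
    rw [← NNReal.coe_lt_coe]
    have h3 := dyadicPoint_succ_sub T n k
    have h4 : (dyadicPoint T n k : ℝ) ≤ u := by
      rw [coe_dyadicPoint, mul_div_assoc', div_le_iff₀ (by positivity)]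
      rw [le_div_iff₀ hT'] at h2
      linarith
    linarith
  refine ⟨_, ⟨n, k + 1, ?_, rfl⟩, hlow, hup⟩
  by_contra h
  exact absurd (hup.trans_le hv) (not_lt.2
    ((dyadicPoint_last T n).symm.le.trans (dyadicPoint_mono T n (not_le.1 h).le)))

lemma frequently_nhdsLT_dyadicTimes {T u : ℝ≥0} (hu : 0 < u) (huT : u ≤ T) :
    ∃ᶠ s in 𝓝[<] u, s ∈ dyadicTimes T := by
  rw [frequently_iff]
  intro U hU
  obtain ⟨l, hl, hlU⟩ := (mem_nhdsLT_iff_exists_Ioo_subset' hu).1 hU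
  obtain ⟨s, hs, h1, h2⟩ := exists_dyadicTimes_between hl huT
  exact ⟨s, hlU ⟨h1, h2⟩, hs⟩

lemma frequently_nhdsGT_dyadicTimes {T u : ℝ≥0} (huT : u < T) :
    ∃ᶠ s in 𝓝[>] u, s ∈ dyadicTimes T := by
  rw [frequently_iff]
  intro U hU
  obtain ⟨l, hl, hlU⟩ := (mem_nhdsGT_iff_exists_Ioo_subset' huT).1 hU
  obtain ⟨s, hs, h1, h2⟩ := exists_dyadicTimes_between (lt_min hl huT) (min_le_right l T)
  exact ⟨s, hlU ⟨h1, h2.trans_le (min_le_left _ _)⟩, hs⟩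

lemma eventually_le_iff_of_nhdsGE (A : Finset ℝ≥0) (t : ℝ≥0) :
    ∀ᶠ s in 𝓝[≥] t, ∀ u ∈ A, (u ≤ s ↔ u ≤ t) := by
  rw [eventually_all_finset]
  intro u _
  rcases le_or_gt u t with h | h
  · filter_upwards [self_mem_nhdsWithin] with s hs
    exact ⟨fun _ => h, fun _ => h.trans hs⟩
  · filter_upwards [mem_nhdsWithin_of_mem_nhds (Iio_mem_nhds h)] with s hs
    exact ⟨fun h' => absurd hs (not_lt.2 h'), fun h' => absurd h (not_lt.2 h')⟩

lemma eventually_le_iff_of_nhdsLT (A : Finset ℝ≥0) (t : ℝ≥0) :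
    ∀ᶠ s in 𝓝[<] t, ∀ u ∈ A, (u ≤ s ↔ u < t) := by
  rw [eventually_all_finset]
  intro u _
  rcases lt_or_ge u t with h | h
  · filter_upwards [mem_nhdsWithin_of_mem_nhds (Ioi_mem_nhds h)] with s hs
    exact ⟨fun _ => h, fun _ => le_of_lt hs⟩
  · filter_upwards [self_mem_nhdsWithin] with s hs
    exact ⟨fun h' => absurd (h'.trans_lt hs) (not_lt.2 h), fun h' => absurd h' (not_lt.2 h)⟩

/-! ### Truncation -/

/-- The truncation of `x` to `[-K, K]`. -/
def clamp (K x : ℝ) : ℝ := max (-K) (min K x)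

lemma abs_clamp_le {K : ℝ} (hK : 0 ≤ K) (x : ℝ) : |clamp K x| ≤ K :=
  abs_le.2 ⟨le_max_left _ _, max_le (by linarith) (min_le_left _ _)⟩

lemma clamp_of_abs_le {K x : ℝ} (h : |x| ≤ K) : clamp K x = x := by
  rw [clamp, min_eq_right (abs_le.1 h).2, max_eq_right (abs_le.1 h).1]

lemma measurable_clamp (K : ℝ) : Measurable (clamp K) := by unfold clamp; fun_prop

/-! ### The explicit solution of the linear equation -/

section Solution

variable {Ω : Type*} {mΩ : MeasurableSpace Ω} {P : Measure Ω} [IsProbabilityMeasure P]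
  {𝓕 : ℝ≥0 → MeasurableSpace Ω} {B B0 : ℝ≥0 → Ω → ℝ}

/-- The process `x₀ · expPath · ∏ (1 + h u)`, product over the jump times up to `t`. -/
def jumpSolution (B B0 : ℝ≥0 → Ω → ℝ) (a b c x0 : Ω → ℝ) (A : Ω → Finset ℝ≥0) (h : Ω → ℝ≥0 → ℝ)
    (t : ℝ≥0) (ω : Ω) : ℝ :=
  x0 ω * expPath B B0 a b c t ω * ∏ u ∈ A ω with u ≤ t, (1 + h ω u)

omit mΩ in
lemma continuous_expPath {a b c : Ω → ℝ} {ω : Ω} (hB : Continuous fun t => B t ω)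
    (hB0 : Continuous fun t => B0 t ω) : Continuous fun t => expPath B B0 a b c t ω := by
  unfold expPath
  fun_prop

omit mΩ in
lemma tendsto_jumpSolution_nhdsGE {a b c x0 : Ω → ℝ} {A : Ω → Finset ℝ≥0} {h : Ω → ℝ≥0 → ℝ} {ω : Ω}
    (hB : Continuous fun t => B t ω) (hB0 : Continuous fun t => B0 t ω) (t : ℝ≥0) :
    Tendsto (fun s => jumpSolution B B0 a b c x0 A h s ω) (𝓝[≥] t)
      (𝓝 (jumpSolution B B0 a b c x0 A h t ω)) := by
  have h1 : Tendsto (fun s => x0 ω * expPath B B0 a b c s ω *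
      ∏ u ∈ A ω with u ≤ t, (1 + h ω u)) (𝓝[≥] t) (𝓝 (jumpSolution B B0 a b c x0 A h t ω)) :=
    (((continuous_expPath hB hB0).tendsto t).mono_left nhdsWithin_le_nhds).const_mul _
      |>.mul_const _
  refine h1.congr' ?_
  filter_upwards [eventually_le_iff_of_nhdsGE (A ω) t] with s hs
  simp only [jumpSolution]
  rw [Finset.filter_congr hs]

omit mΩ in
lemma tendsto_jumpSolution_nhdsLT {a b c x0 : Ω → ℝ} {A : Ω → Finset ℝ≥0} {h : Ω → ℝ≥0 → ℝ} {ω : Ω}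
    (hB : Continuous fun t => B t ω) (hB0 : Continuous fun t => B0 t ω) (t : ℝ≥0) :
    Tendsto (fun s => jumpSolution B B0 a b c x0 A h s ω) (𝓝[<] t)
      (𝓝 (x0 ω * expPath B B0 a b c t ω * ∏ u ∈ A ω with u < t, (1 + h ω u))) := by
  have h1 : Tendsto (fun s => x0 ω * expPath B B0 a b c s ω *
      ∏ u ∈ A ω with u < t, (1 + h ω u)) (𝓝[<] t)
      (𝓝 (x0 ω * expPath B B0 a b c t ω * ∏ u ∈ A ω with u < t, (1 + h ω u))) :=
    (((continuous_expPath hB hB0).tendsto t).mono_left nhdsWithin_le_nhds).const_mul _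
      |>.mul_const _
  refine h1.congr' ?_
  filter_upwards [eventually_le_iff_of_nhdsLT (A ω) t] with s hs
  simp only [jumpSolution]
  rw [Finset.filter_congr hs]

/-- The left-point sums of the explicit solution. -/
lemma IsNoiseFiltration.ae_tendsto_sum_jumpSolution (hN : IsNoiseFiltration P 𝓕 B B0)
    (hB : ∀ᵐ ω ∂P, Continuous fun t => B t ω) (hB0 : ∀ᵐ ω ∂P, Continuous fun t => B0 t ω)
    {a b c x0 : Ω → ℝ} (ha : Measurable[𝓕 0] a) (hb : Measurable[𝓕 0] b) (hc : Measurable[𝓕 0] c)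
    (hx0 : Measurable[𝓕 0] x0) {T : ℝ≥0} {A : Ω → Finset ℝ≥0} {h : Ω → ℝ≥0 → ℝ}
    {J : ℝ≥0 → Ω → ℝ} (hJ : ∀ t, Measurable[𝓕 0] (J t))
    (hA : ∀ᵐ ω ∂P, ∀ u ∈ A ω, 0 < u ∧ u ≤ T)
    (hAJ : ∀ᵐ ω ∂P, ∀ t ≤ T, J t ω = ∏ u ∈ A ω with u ≤ t, (1 + h ω u)) {t : ℝ≥0} (ht : t ≤ T) :
    ∀ᵐ ω ∂P, Tendsto (fun n => ∑ k ∈ Finset.range (2 ^ n),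
      jumpSolution B B0 a b c x0 A h (dyadicPoint t n k) ω * (a ω * (t / 2 ^ n)
        + b ω * (B (dyadicPoint t n (k + 1)) ω - B (dyadicPoint t n k) ω)
        + c ω * (B0 (dyadicPoint t n (k + 1)) ω - B0 (dyadicPoint t n k) ω))) atTop
      (𝓝 (jumpSolution B B0 a b c x0 A h t ω - x0 ω
        - ∑ u ∈ A ω with u ≤ t, (x0 ω * expPath B B0 a b c u ω
          * ∏ v ∈ A ω with v < u, (1 + h ω v)) * h ω u)) := by
  -- Itô's formula is available for bounded data only. It is applied to all integer truncations at
  -- once, and for each `ω` a large `K` makes them inactive. The jump product can be part of the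
  -- weight because it is known at time `0`.
  have hito : ∀ K : ℕ, ∀ᵐ ω ∂P, Tendsto (fun n => ∑ k ∈ Finset.range (2 ^ n),
      clamp K (x0 ω * J (dyadicPoint t n k) ω) *
      (expPath B B0 (fun ω => clamp K (a ω)) (fun ω => clamp K (b ω)) (fun ω => clamp K (c ω))
          (dyadicPoint t n (k + 1)) ω
        - expPath B B0 (fun ω => clamp K (a ω)) (fun ω => clamp K (b ω)) (fun ω => clamp K (c ω))
          (dyadicPoint t n k) ω
      - expPath B B0 (fun ω => clamp K (a ω)) (fun ω => clamp K (b ω)) (fun ω => clamp K (c ω))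
          (dyadicPoint t n k) ω * (clamp K (a ω) * (t / 2 ^ n)
        + clamp K (b ω) * (B (dyadicPoint t n (k + 1)) ω - B (dyadicPoint t n k) ω)
        + clamp K (c ω) * (B0 (dyadicPoint t n (k + 1)) ω - B0 (dyadicPoint t n k) ω))))
      atTop (𝓝 0) := fun K =>
    hN.ae_tendsto_sum_expPath (K := K) ((measurable_clamp K).comp ha) ((measurable_clamp K).comp hb)
      ((measurable_clamp K).comp hc) (fun ω => abs_clamp_le (Nat.cast_nonneg K) _)
      (fun ω => abs_clamp_le (Nat.cast_nonneg K) _) (fun ω => abs_clamp_le (Nat.cast_nonneg K) _) t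
      (H := fun s ω => clamp K (x0 ω * J s ω)) (M := K)
      (fun s => ((measurable_clamp K).comp (hx0.mul (hJ s))).mono (hN.mono zero_le) le_rfl)
      (fun s ω => abs_clamp_le (Nat.cast_nonneg K) _)
  filter_upwards [ae_all_iff.2 hito, hB, hB0, hA, hAJ] with ω h1 h2 h3 h4 h5
  set e : ℝ≥0 → ℝ := fun s => expPath B B0 a b c s ω with he
  set j : ℝ≥0 → ℝ := fun s => ∏ u ∈ A ω with u ≤ s, (1 + h ω u) with hj
  obtain ⟨K, hKa, hKb, hKc, hKJ⟩ : ∃ K : ℕ, |a ω| ≤ K ∧ |b ω| ≤ K ∧ |c ω| ≤ K ∧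
      ∀ s, |x0 ω * j s| ≤ K := by
    -- The product up to any time runs over one of the finitely many subsets of `A ω`, which bounds
    -- it uniformly in time.
    set M : ℝ := ∑ C ∈ (A ω).powerset, |x0 ω * ∏ u ∈ C, (1 + h ω u)|
    have hM : ∀ s, |x0 ω * j s| ≤ M := fun s =>
      Finset.single_le_sum (f := fun C => |x0 ω * ∏ u ∈ C, (1 + h ω u)|) (fun _ _ => abs_nonneg _)
        (Finset.mem_powerset.2 (Finset.filter_subset (· ≤ s) (A ω)))
    obtain ⟨K, hK⟩ := exists_nat_ge (max (max |a ω| |b ω|) (max |c ω| M))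
    refine ⟨K, ?_, ?_, ?_, fun s => (hM s).trans ?_⟩ <;> refine le_trans ?_ hK <;> simp
  have h6 : Tendsto (fun n => ∑ k ∈ Finset.range (2 ^ n), x0 ω * j (dyadicPoint t n k) *
      (e (dyadicPoint t n (k + 1)) - e (dyadicPoint t n k)
      - e (dyadicPoint t n k) * (a ω * (t / 2 ^ n)
        + b ω * (B (dyadicPoint t n (k + 1)) ω - B (dyadicPoint t n k) ω)
        + c ω * (B0 (dyadicPoint t n (k + 1)) ω - B0 (dyadicPoint t n k) ω)))) atTop (𝓝 0) := by
    refine (h1 K).congr fun n => Finset.sum_congr rfl fun k hk => ?_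
    have hkt : dyadicPoint t n k ≤ T :=
      (dyadicPoint_le (Finset.mem_range.1 hk).le).trans ht
    have hee : ∀ s, expPath B B0 (fun ω => clamp K (a ω)) (fun ω => clamp K (b ω))
        (fun ω => clamp K (c ω)) s ω = e s := fun s => by
      simp only [expPath, he, clamp_of_abs_le hKa, clamp_of_abs_le hKb, clamp_of_abs_le hKc]
    rw [hee, hee, clamp_of_abs_le hKa, clamp_of_abs_le hKb, clamp_of_abs_le hKc, h5 _ hkt,
      clamp_of_abs_le (hKJ _)]
  have h7 := (tendsto_sum_jump_mul (t := t) (A ω) (fun u hu => (h4 u hu).1) (h ω)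
    (continuous_expPath (a := a) (b := b) (c := c) h2 h3)).const_mul (x0 ω)
  have h8 : jumpSolution B B0 a b c x0 A h 0 ω = x0 ω := by
    have : (A ω).filter (· ≤ 0) = ∅ := by
      rw [Finset.filter_eq_empty_iff]
      intro u hu
      exact not_le.2 (h4 u hu).1
    simp only [jumpSolution, this]
    simp [expPath]
  -- Discrete product rule: an increment of the solution is the left jump product times the
  -- increment of the exponential, plus the right value of the exponential times the increment of
  -- the jump product, both multiplied by `x0`. The former is handled by `h6`, the latter by `h7`.
  have h9 := (h7.const_sub (jumpSolution B B0 a b c x0 A h t ω - x0 ω)).sub h6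
  rw [sub_zero] at h9
  have h10 : ∑ u ∈ A ω with u ≤ t, (x0 ω * expPath B B0 a b c u ω
          * ∏ v ∈ A ω with v < u, (1 + h ω v)) * h ω u
      = x0 ω * ∑ u ∈ A ω with u ≤ t, h ω u * (∏ v ∈ A ω with v < u, (1 + h ω v))
        * expPath B B0 a b c u ω := by
    rw [Finset.mul_sum]
    exact Finset.sum_congr rfl fun u _ => by ring
  rw [h10]
  refine h9.congr fun n => ?_
  have htel := Finset.sum_range_sub
    (fun k => jumpSolution B B0 a b c x0 A h (dyadicPoint t n k) ω) (2 ^ n)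
  rw [dyadicPoint_last, dyadicPoint_zero, h8] at htel
  rw [← htel, Finset.mul_sum, ← Finset.sum_sub_distrib, ← Finset.sum_sub_distrib]
  refine Finset.sum_congr rfl fun k _ => ?_
  simp only [jumpSolution, he, hj]
  ring

/-- The solution of the linear equation is the explicit one. -/
theorem IsNoiseFiltration.ae_eq_jumpSolution (hN : IsNoiseFiltration P 𝓕 B B0)
    (hB : ∀ᵐ ω ∂P, Continuous fun t => B t ω) (hB0 : ∀ᵐ ω ∂P, Continuous fun t => B0 t ω)
    {a b c x0 : Ω → ℝ} (ha : Measurable[𝓕 0] a) (hb : Measurable[𝓕 0] b) (hc : Measurable[𝓕 0] c)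
    (hx0 : Measurable[𝓕 0] x0) {T : ℝ≥0} {A : Ω → Finset ℝ≥0} {h : Ω → ℝ≥0 → ℝ}
    {J : ℝ≥0 → Ω → ℝ} (hJ : ∀ t, Measurable[𝓕 0] (J t))
    (hA : ∀ᵐ ω ∂P, ∀ u ∈ A ω, 0 < u ∧ u ≤ T)
    (hAJ : ∀ᵐ ω ∂P, ∀ t ≤ T, J t ω = ∏ u ∈ A ω with u ≤ t, (1 + h ω u))
    {C : ℝ≥0 → ℕ → Set Ω} (hC : ∀ t k, MeasurableSet[𝓕 0] (C t k))
    (hCA : ∀ᵐ ω ∂P, ∀ t ≤ T, ∀ k, ω ∈ C t k ↔ ((A ω).filter (· ≤ t)).card < k)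
    {X : ℝ≥0 → Ω → ℝ} (hXm : ∀ t ≤ T, ∃ Y : Ω → ℝ, Measurable[𝓕 t] Y ∧ X t =ᵐ[P] Y)
    (hX : ∀ᵐ ω ∂P, IsCadlagOn T fun t => X t ω)
    (heq : ∀ t ≤ T, ∃ I I0 : Ω → ℝ, IsItoIntegral P X B t I ∧ IsItoIntegral P X B0 t I0 ∧
      ∀ᵐ ω ∂P, X t ω = x0 ω + a ω * (∫ s in (0 : ℝ)..t, X s.toNNReal ω) + b ω * I ω + c ω * I0 ω
        + ∑ u ∈ A ω with u ≤ t, Function.leftLim (fun s => X s ω) u * h ω u) :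
    ∀ᵐ ω ∂P, ∀ t ≤ T, X t ω = jumpSolution B B0 a b c x0 A h t ω := by
  set S := dyadicTimes T with hS
  have hST : ∀ t ∈ S, t ≤ T := fun t => le_of_mem_dyadicTimes
  have hScount : S.Countable := countable_dyadicTimes T
  -- The values of `X` are adapted only up to null sets. On the countable set of dyadic times they
  -- can all be replaced by exactly adapted versions.
  choose! Y hYm hXY using hXm
  set V := jumpSolution B B0 a b c x0 A h with hV
  set D : ℝ≥0 → Ω → ℝ := fun t ω => Y t ω - x0 ω * expPath B B0 a b c t ω * J t ω with hD
  have hDm : ∀ t ∈ S, Measurable[𝓕 t] (D t) := fun t ht =>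
    (hYm t (hST t ht)).sub (((hx0.mono (hN.mono zero_le) le_rfl).mul
      (hN.measurable_expPath ha hb hc t)).mul ((hJ t).mono (hN.mono zero_le) le_rfl))
  have hDX : ∀ᵐ ω ∂P, ∀ t ∈ S, D t ω = X t ω - V t ω := by
    have h1 : ∀ᵐ ω ∂P, ∀ t ∈ S, X t ω = Y t ω :=
      (ae_ball_iff hScount).2 fun t ht => hXY t (hST t ht)
    filter_upwards [h1, hAJ] with ω h1 h2 t ht
    simp only [hD, hV, jumpSolution]
    rw [h1 t ht, h2 t (hST t ht)]
  -- the difference of the two processes at the dyadic times satisfies the linear equation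
  have hsum : ∀ t ∈ S, ∃ ns : ℕ → ℕ, ∀ᵐ ω ∂P,
      Tendsto (fun n => ∑ k ∈ Finset.range (2 ^ ns n), D (dyadicPoint t (ns n) k) ω *
        (a ω * (t / 2 ^ ns n)
        + b ω * (B (dyadicPoint t (ns n) (k + 1)) ω - B (dyadicPoint t (ns n) k) ω)
        + c ω * (B0 (dyadicPoint t (ns n) (k + 1)) ω - B0 (dyadicPoint t (ns n) k) ω)))
        atTop (𝓝 (D t ω - ∑ u ∈ A ω with u ≤ t, (Function.leftLim (fun s => X s ω) u
          - x0 ω * expPath B B0 a b c u ω * ∏ v ∈ A ω with v < u, (1 + h ω v)) * h ω u)) := by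
    intro t ht
    have htT := hST t ht
    obtain ⟨I, I0, hI, hI0, hXt⟩ := heq t htT
    -- Both integrals are limits in probability. The second subsequence is extracted along the
    -- first, so that both kinds of sums converge almost surely.
    obtain ⟨ns, hns, h1⟩ := (hI _ _ (isPartitionSequence_dyadicPoint t tendsto_id)
      ).exists_seq_tendsto_ae
    obtain ⟨ms, hms, h2⟩ := (hI0 _ _ (isPartitionSequence_dyadicPoint t hns.tendsto_atTop)
      ).exists_seq_tendsto_ae
    refine ⟨ns ∘ ms, ?_⟩
    filter_upwards [h1, h2, hX, hXt, hDX, hN.ae_tendsto_sum_jumpSolution hB hB0 ha hb hc hx0 hJ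
      hA hAJ htT] with ω h1 h2 h3 h4 h5 h6
    have hlim := (hns.comp hms).tendsto_atTop
    have g1 := (h1.comp hms.tendsto_atTop).const_mul (b ω)
    have g2 := h2.const_mul (c ω)
    have g3 := ((h3.tendsto_riemannSum htT).comp hlim).const_mul (a ω)
    have g4 := ((g3.add g1).add g2).sub (h6.comp hlim)
    have hval : a ω * (∫ s in (0 : ℝ)..t, X s.toNNReal ω) + b ω * I ω + c ω * I0 ω
        - (V t ω - x0 ω - ∑ u ∈ A ω with u ≤ t, (x0 ω * expPath B B0 a b c u ω
          * ∏ v ∈ A ω with v < u, (1 + h ω v)) * h ω u)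
        = D t ω - ∑ u ∈ A ω with u ≤ t, (Function.leftLim (fun s => X s ω) u
          - x0 ω * expPath B B0 a b c u ω * ∏ v ∈ A ω with v < u, (1 + h ω v)) * h ω u := by
      rw [h5 t ht, h4]
      simp_rw [sub_mul]
      rw [Finset.sum_sub_distrib]
      ring
    rw [← hval]
    refine g4.congr fun n => ?_
    simp only [Function.comp_apply, id_eq]
    rw [Finset.mul_sum, Finset.mul_sum, Finset.mul_sum, ← Finset.sum_add_distrib,
      ← Finset.sum_add_distrib, ← Finset.sum_sub_distrib]
    refine Finset.sum_congr rfl fun k hk => ?_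
    rw [h5 _ (dyadicPoint_mem_dyadicTimes ht _ _ (Finset.mem_range.1 hk).le)]
    ring
  have hBX : ∀ᵐ ω ∂P, ∃ M : ℕ, ∀ s ∈ S, |D s ω| ≤ M := by
    filter_upwards [hX, hDX, hB, hB0] with ω h1 h2 h3 h4
    obtain ⟨M1, hM1⟩ := h1.exists_bound
    have hVc : IsCadlagOn T fun t => V t ω :=
      ⟨fun t _ => tendsto_jumpSolution_nhdsGE h3 h4 t,
        fun t _ => ⟨_, tendsto_jumpSolution_nhdsLT h3 h4 t⟩⟩
    obtain ⟨M2, hM2⟩ := hVc.exists_bound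
    obtain ⟨M, hM⟩ := exists_nat_ge (M1 + M2)
    refine ⟨M, fun s hs => ?_⟩
    rw [h2 s hs]
    exact (abs_sub _ _).trans ((add_le_add (hM1 s (hST s hs)) (hM2 s (hST s hs))).trans hM)
  -- induction on the number of jumps
  have hind : ∀ k : ℕ, ∀ᵐ ω ∂P, ∀ t ∈ S, ω ∈ C t k → D t ω = 0 := by
    intro k
    induction k with
    | zero =>
      filter_upwards [hCA] with ω hω t ht hk
      exact absurd ((hω t (hST t ht) 0).1 hk) (Nat.not_lt_zero _)
    | succ k ih =>
      -- If at most `k` jumps occur up to `t` and `u` is one of them, fewer than `k` occur up to any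
      -- time before `u`. By induction the processes agree at the dyadic times before `u`, so they
      -- have the same left limit at `u` and the jump terms cancel.
      have hzero : ∀ᵐ ω ∂P, ∀ t ∈ S, ω ∈ C t (k + 1) →
          ∑ u ∈ A ω with u ≤ t, (Function.leftLim (fun s => X s ω) u
          - x0 ω * expPath B B0 a b c u ω * ∏ v ∈ A ω with v < u, (1 + h ω v)) * h ω u = 0 := by
        filter_upwards [ih, hCA, hX, hB, hB0, hDX, hA] with ω h1 h2 h3 h4 h5 h6 h7 t ht hk
        refine Finset.sum_eq_zero fun u hu => ?_
        obtain ⟨huA, hut⟩ := Finset.mem_filter.1 hu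
        obtain ⟨hu0, huT⟩ := h7 u huA
        obtain ⟨l, hl⟩ := h3.2 u huT
        rw [leftLim_eq_of_tendsto_pos hu0 hl]
        have hlV := hl.sub (tendsto_jumpSolution_nhdsLT (a := a) (b := b) (c := c) (x0 := x0)
          (A := A) (h := h) h4 h5 u)
        have hfreq : ∃ᶠ s in 𝓝[<] u, X s ω - jumpSolution B B0 a b c x0 A h s ω = 0 := by
          refine ((frequently_nhdsLT_dyadicTimes hu0 huT).and_eventually
            self_mem_nhdsWithin).mono fun s hs => ?_
          obtain ⟨hsS, hsu⟩ := hs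
          rw [← hV, ← h6 s hsS]
          refine h1 s hsS ((h2 s (hST s hsS) k).2 ?_)
          have hcard := (h2 t (hST t ht) (k + 1)).1 hk
          refine lt_of_lt_of_le (Finset.card_lt_card ?_) (Nat.lt_succ_iff.1 hcard)
          rw [Finset.ssubset_iff_of_subset
            (Finset.monotone_filter_right _ fun v _ hv => hv.trans ((le_of_lt hsu).trans hut))]
          exact ⟨u, hu, fun hmem => absurd (Finset.mem_filter.1 hmem).2 (not_le.2 hsu)⟩
        have : l - x0 ω * expPath B B0 a b c u ω * ∏ v ∈ A ω with v < u, (1 + h ω v) = 0 := by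
          have : (0 : ℝ) ∈ ({0} : Set ℝ) := rfl
          exact isClosed_singleton.mem_of_frequently_of_tendsto (s := {(0 : ℝ)}) hfreq hlV
        rw [this, zero_mul]
      -- The localizing set at time `t` bounds the coefficients, and it bounds the difference and
      -- the number of jumps at all dyadic times up to `t`. Including all earlier times makes it
      -- decreasing in `t`.
      have hfix : ∀ K : ℕ, ∀ t ∈ S, ∀ᵐ ω ∂P, ω ∈ ({ω | |a ω| ≤ K} ∩ {ω | |b ω| ≤ K}
          ∩ {ω | |c ω| ≤ K}) ∩ (⋂ s ∈ S ∩ Set.Iic t, {ω | |D s ω| ≤ K})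
          ∩ (⋂ s ∈ S ∩ Set.Iic t, C s (k + 1)) → D t ω = 0 := by
        intro K
        have habs : ∀ {m : MeasurableSpace Ω} {f : Ω → ℝ}, Measurable[m] f →
            MeasurableSet[m] {ω | |f ω| ≤ K} := fun {m f} hf =>
          (continuous_abs.measurable.comp hf) measurableSet_Iic
        refine hN.eq_zero_of_tendsto_sum (K := K) (M := K) ((measurable_clamp K).comp ha)
          ((measurable_clamp K).comp hb) ((measurable_clamp K).comp hc)
          (fun ω => abs_clamp_le (Nat.cast_nonneg K) _)
          (fun ω => abs_clamp_le (Nat.cast_nonneg K) _)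
          (fun ω => abs_clamp_le (Nat.cast_nonneg K) _) hST
          (fun t ht n k hk => dyadicPoint_mem_dyadicTimes ht n k hk) hDm
          (fun t ht => ?_) (fun s hs t ht hst => ?_) (fun t ht ω hω => ?_) (fun t ht => ?_)
        · have h0 : ∀ {E : Set Ω}, MeasurableSet[𝓕 0] E → MeasurableSet[𝓕 t] E :=
            fun hE => hN.mono zero_le _ hE
          have hcount : (S ∩ Set.Iic t).Countable := hScount.mono Set.inter_subset_left
          refine MeasurableSet.inter (MeasurableSet.inter (h0 (((habs ha).inter (habs hb)).inter
            (habs hc))) ?_) ?_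
          · exact MeasurableSet.biInter hcount fun s hs =>
              habs ((hDm s hs.1).mono (hN.mono hs.2) le_rfl)
          · exact MeasurableSet.biInter hcount fun s _ => h0 (hC s (k + 1))
        · refine Set.inter_subset_inter (Set.inter_subset_inter_right _ ?_) ?_ <;>
          · refine Set.biInter_mono (fun r hr => ⟨hr.1, le_trans hr.2 hst⟩) fun _ _ => le_rfl
        · exact Set.mem_iInter₂.1 hω.1.2 t ⟨ht, le_refl t⟩
        · obtain ⟨ns, hns⟩ := hsum t ht
          refine ⟨ns, ?_⟩
          filter_upwards [hns, hzero] with ω h1 h2 hω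
          obtain ⟨⟨⟨⟨hka, hkb⟩, hkc⟩, -⟩, hωC⟩ := hω
          have hωt : ω ∈ C t (k + 1) := Set.mem_iInter₂.1 hωC t ⟨ht, le_refl t⟩
          rw [h2 t ht hωt, sub_zero] at h1
          simp only [Function.comp_apply]
          rw [clamp_of_abs_le hka, clamp_of_abs_le hkb, clamp_of_abs_le hkc]
          exact h1
      have hfix' : ∀ᵐ ω ∂P, ∀ K : ℕ, ∀ t ∈ S, ω ∈ ({ω | |a ω| ≤ K} ∩ {ω | |b ω| ≤ K}
          ∩ {ω | |c ω| ≤ K}) ∩ (⋂ s ∈ S ∩ Set.Iic t, {ω | |D s ω| ≤ K})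
          ∩ (⋂ s ∈ S ∩ Set.Iic t, C s (k + 1)) → D t ω = 0 :=
        ae_all_iff.2 fun K => (ae_ball_iff hScount).2 (hfix K)
      filter_upwards [hfix', hBX, hCA] with ω h1 ⟨M, hM⟩ h2 t ht hk
      obtain ⟨K, hK⟩ := exists_nat_ge (max (max |a ω| |b ω|) (max |c ω| M))
      refine h1 K t ht ⟨⟨⟨⟨?_, ?_⟩, ?_⟩, ?_⟩, ?_⟩
      · exact le_trans (by simp) hK
      · exact le_trans (by simp) hK
      · exact le_trans (by simp) hK
      · exact Set.mem_iInter₂.2 fun s hs => (hM s hs.1).trans (le_trans (by simp) hK)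
      · refine Set.mem_iInter₂.2 fun s hs => (h2 s (hST s hs.1) _).2 ?_
        refine lt_of_le_of_lt (Finset.card_le_card ?_) ((h2 t (hST t ht) _).1 hk)
        exact Finset.monotone_filter_right _ fun v _ hv => le_trans hv hs.2
  filter_upwards [ae_all_iff.2 hind, hX, hB, hB0, hDX, hCA] with ω h1 h2 h3 h4 h5 h6
  have hSeq : ∀ t ∈ S, X t ω - V t ω = 0 := fun t ht => by
    rw [← h5 t ht]
    exact h1 (((A ω).filter (· ≤ t)).card + 1) t ht ((h6 t (hST t ht) _).2 (Nat.lt_succ_self _))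
  intro t ht
  -- Right-continuity extends the identity from the dyadic times; `T`, where it is not available, is
  -- itself dyadic.
  rcases ht.lt_or_eq with hlt | rfl
  · have hlim := ((h2.1 t hlt).tendsto.mono_left (nhdsWithin_mono t Set.Ioi_subset_Ici_self)).sub
      ((tendsto_jumpSolution_nhdsGE (a := a) (b := b) (c := c) (x0 := x0) (A := A) (h := h)
        h3 h4 t).mono_left (nhdsWithin_mono t Set.Ioi_subset_Ici_self))
    have hfreq : ∃ᶠ s in 𝓝[>] t, X s ω - jumpSolution B B0 a b c x0 A h s ω = 0 :=
      (frequently_nhdsGT_dyadicTimes hlt).mono hSeq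
    exact sub_eq_zero.1
      (isClosed_singleton.mem_of_frequently_of_tendsto (s := {(0 : ℝ)}) hfreq hlim)
  · exact sub_eq_zero.1 (hSeq t (self_mem_dyadicTimes t))

end Solution

/-! ### The enlarged filtration -/

section Filtration

variable {Ω : Type*} {mΩ : MeasurableSpace Ω} {P : Measure Ω}

lemma _root_.ProbabilityTheory.IsPreBrownianReal.indep_past_sub {B : ℝ≥0 → Ω → ℝ}
    (hB : IsPreBrownianReal B P) {s v : ℝ≥0} (hsv : s ≤ v) :
    Indep (⨆ r ∈ Set.Iic s, MeasurableSpace.comap (B r) inferInstance)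
      (MeasurableSpace.comap (fun ω => B v ω - B s ω) inferInstance) P := by
  have h := (hB.indepFun_shift s).symm
  refine indep_of_indep_of_le_right (indep_of_indep_of_le_left h ?_) ?_
  · refine iSup₂_le fun r hr => ?_
    have : B r = (fun x : Set.Iic s → ℝ => x ⟨r, hr⟩) ∘ fun ω (t : Set.Iic s) => B t ω := rfl
    rw [this, ← MeasurableSpace.comap_comp]
    exact MeasurableSpace.comap_mono (measurable_pi_apply _).comap_le
  · have : (fun ω => B v ω - B s ω) =
        (fun x : ℝ≥0 → ℝ => x (v - s)) ∘ fun ω t => B (s + t) ω - B s ω := by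
      ext ω
      simp [add_tsub_cancel_of_le hsv]
    rw [this, ← MeasurableSpace.comap_comp]
    exact MeasurableSpace.comap_mono (measurable_pi_apply _).comap_le

lemma _root_.ProbabilityTheory.IsPreBrownianReal.map_sub {B : ℝ≥0 → Ω → ℝ}
    (hB : IsPreBrownianReal B P) {s v : ℝ≥0} (hsv : s ≤ v) :
    P.map (fun ω => B v ω - B s ω) = gaussianReal 0 (v - s) := by
  have h := (hB.hasLaw_sub v s).map_eq
  have hd : nndist v.1 s.1 = v - s := by
    rw [← NNReal.coe_inj, coe_nndist, NNReal.coe_sub hsv, Real.dist_eq]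
    exact abs_of_nonneg (sub_nonneg.2 (by exact_mod_cast hsv))
  rw [hd] at h
  exact h

/-- A variable that has a version measurable with respect to every `𝓖 n` has a version measurable
with respect to their intersection. -/
lemma exists_measurable_iInf_ae_eq {𝓖 : ℕ → MeasurableSpace Ω} (h𝓖 : Antitone 𝓖) {X : Ω → ℝ}
    (hX : ∀ n, AEStronglyMeasurable[𝓖 n] X P) :
    ∃ Y : Ω → ℝ, Measurable[⨅ n, 𝓖 n] Y ∧ X =ᵐ[P] Y := by
  choose Y hY hXY using hX
  -- A limsup ignores finitely many terms, so it is measurable with respect to every `𝓖 n`.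
  refine ⟨fun ω => limsup (fun n => Y n ω) atTop, ?_, ?_⟩
  · rw [measurable_iff_comap_le]
    refine le_iInf fun n => ?_
    rw [← measurable_iff_comap_le]
    have : (fun ω => limsup (fun k => Y k ω) atTop)
        = fun ω => limsup (fun k => Y (k + n) ω) atTop := by
      ext ω
      exact (limsup_nat_add (fun k => Y k ω) n).symm
    rw [this]
    exact @Measurable.limsup ℝ Ω _ _ _ (𝓖 n) _ _ _ (fun k => Y (k + n)) fun k =>
      (hY (k + n)).measurable.mono (h𝓖 (Nat.le_add_left n k)) le_rfl
  · filter_upwards [ae_all_iff.2 hXY] with ω hω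
    simp [← hω]

end Filtration

section Market

variable {Ω S Ec Ei : Type*} {mΩ : MeasurableSpace Ω} [MeasurableSpace S] [MeasurableSpace Ec]
  [MeasurableSpace Ei] {P : Measure Ω} [IsProbabilityMeasure P] {𝕋 : Measure S} {lam : ℝ≥0}
  {νc : Measure Ec} {νi : Measure Ei} [IsProbabilityMeasure νi]
  {τ : ℕ → Ω → S} {W0 : ℝ≥0 → Ω → ℝ} {W : ℕ → ℝ≥0 → Ω → ℝ}
  {N : Ω → Measure (ℝ≥0 × Ec × (ℕ → Ei))}

/-- The part of a source known at time `s`, if the types and the Poisson measure are revealed at the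
beginning. -/
@[reducible]
def pastSigma (τ : ℕ → Ω → S) (W0 : ℝ≥0 → Ω → ℝ) (W : ℕ → ℝ≥0 → Ω → ℝ)
    (N : Ω → Measure (ℝ≥0 × Ec × (ℕ → Ei))) (s : ℝ≥0) : Source → MeasurableSpace Ω
  | .type j => MeasurableSpace.comap (τ j) inferInstance
  | .idiosyncratic j => ⨆ t ∈ Set.Iic s, MeasurableSpace.comap (W j t) inferInstance
  | .common => ⨆ t ∈ Set.Iic s, MeasurableSpace.comap (W0 t) inferInstance
  | .poisson => MeasurableSpace.comap N inferInstance

/-- The right-continuous filtration in which the types and the Poisson measure are revealed at the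
beginning. -/
@[reducible]
def enlargedFiltration (τ : ℕ → Ω → S) (W0 : ℝ≥0 → Ω → ℝ) (W : ℕ → ℝ≥0 → Ω → ℝ)
    (N : Ω → Measure (ℝ≥0 × Ec × (ℕ → Ei))) (u : ℝ≥0) : MeasurableSpace Ω :=
  ⨅ n : ℕ, ⨆ i, pastSigma τ W0 W N (u + 1 / ((n : ℝ≥0) + 1)) i

/-- The part of a source that generates the increments of `W j` and `W0` over `[s, v]`. -/
@[reducible]
def incrSigma (W0 : ℝ≥0 → Ω → ℝ) (W : ℕ → ℝ≥0 → Ω → ℝ) (j : ℕ) (s v : ℝ≥0) :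
    Source → MeasurableSpace Ω
  | .type _ => ⊥
  | .idiosyncratic k =>
      if k = j then MeasurableSpace.comap (fun ω => W j v ω - W j s ω) inferInstance else ⊥
  | .common => MeasurableSpace.comap (fun ω => W0 v ω - W0 s ω) inferInstance
  | .poisson => ⊥

omit mΩ in
lemma pastSigma_mono {s s' : ℝ≥0} (h : s ≤ s') (i : Source) :
    pastSigma τ W0 W N s i ≤ pastSigma τ W0 W N s' i := by
  cases i
  · exact le_rfl
  · exact biSup_mono fun r hr => le_trans hr h
  · exact biSup_mono fun r hr => le_trans hr h
  · exact le_rfl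

omit mΩ in
lemma pastSigma_le_sourceSigma (s : ℝ≥0) (i : Source) :
    pastSigma τ W0 W N s i ≤ sourceSigma τ W0 W N i := by
  cases i
  · exact le_rfl
  · exact iSup₂_le fun r _ => le_iSup (fun t => MeasurableSpace.comap (W _ t) inferInstance) r
  · exact iSup₂_le fun r _ => le_iSup (fun t => MeasurableSpace.comap (W0 t) inferInstance) r
  · exact le_rfl

omit mΩ in
lemma incrSigma_le_sourceSigma (j : ℕ) (s v : ℝ≥0) (i : Source) :
    incrSigma W0 W j s v i ≤ sourceSigma τ W0 W N i := by
  cases i with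
  | type k => exact bot_le
  | idiosyncratic k =>
    simp only [incrSigma]
    split_ifs with h
    · subst h
      refine Measurable.comap_le ?_
      exact ((comap_measurable (W k v)).mono
          (le_iSup (fun t => MeasurableSpace.comap (W k t) inferInstance) v) le_rfl).sub
        ((comap_measurable (W k s)).mono
          (le_iSup (fun t => MeasurableSpace.comap (W k t) inferInstance) s) le_rfl)
    · exact bot_le
  | common =>
    refine Measurable.comap_le ?_
    exact ((comap_measurable (W0 v)).mono
        (le_iSup (fun t => MeasurableSpace.comap (W0 t) inferInstance) v) le_rfl).sub
      ((comap_measurable (W0 s)).mono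
        (le_iSup (fun t => MeasurableSpace.comap (W0 t) inferInstance) s) le_rfl)
  | poisson => exact bot_le

omit [IsProbabilityMeasure P] in
lemma IsMarketNoise.sourceSigma_le (h : IsMarketNoise P 𝕋 lam νc νi τ W0 W N) (i : Source) :
    sourceSigma τ W0 W N i ≤ mΩ := by
  cases i
  · exact (h.measurable_type _).comap_le
  · exact iSup_le fun t => (h.measurable_idiosyncratic _ t).comap_le
  · exact iSup_le fun t => (h.measurable_common t).comap_le
  · exact h.poisson.measurable.comap_le

omit mΩ in
lemma measurable_pair_incrSigma (j : ℕ) (s v : ℝ≥0) :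
    Measurable[⨆ i, incrSigma W0 W j s v i] fun ω => (W j v ω - W j s ω, W0 v ω - W0 s ω) := by
  refine Measurable.prodMk ?_ ?_
  · have h : MeasurableSpace.comap (fun ω => W j v ω - W j s ω) inferInstance
        ≤ incrSigma W0 W j s v (Source.idiosyncratic j) := (if_pos rfl).ge
    exact (comap_measurable _).mono
      (h.trans (le_iSup (incrSigma W0 W j s v) (Source.idiosyncratic j))) le_rfl
  · exact (comap_measurable _).mono (le_iSup (incrSigma W0 W j s v) Source.common) le_rfl

/-- This is decided source by source: the types, the Poisson measure and the other idiosyncratic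
motions contribute nothing to the increment, and `W j` and `W0` each have increments independent of
their own past. -/
lemma IsMarketNoise.indep_past_incr (h : IsMarketNoise P 𝕋 lam νc νi τ W0 W N) (j : ℕ)
    {s v : ℝ≥0} (hsv : s ≤ v) :
    Indep (⨆ i, pastSigma τ W0 W N s i)
      (MeasurableSpace.comap (fun ω => (W j v ω - W j s ω, W0 v ω - W0 s ω)) inferInstance) P := by
  refine indep_of_indep_of_le_right (indep_iSup_iSup h.indep h.sourceSigma_le
    (pastSigma_le_sourceSigma s) (incrSigma_le_sourceSigma j s v) fun i => ?_)
    (measurable_pair_incrSigma j s v).comap_le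
  cases i with
  | type k => exact indep_bot_right _
  | idiosyncratic k =>
    simp only [incrSigma]
    split_ifs with hk
    · subst hk
      exact (h.brownian_idiosyncratic k).toIsPreBrownianReal.indep_past_sub hsv
    · exact indep_bot_right _
  | common => exact h.brownian_common.toIsPreBrownianReal.indep_past_sub hsv
  | poisson => exact indep_bot_right _

lemma tendsto_add_one_div (u : ℝ≥0) :
    Tendsto (fun n : ℕ => u + 1 / ((n : ℝ≥0) + 1)) atTop (𝓝 u) := by
  have : Tendsto (fun n : ℕ => 1 / ((n : ℝ≥0) + 1)) atTop (𝓝 0) := by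
    rw [← NNReal.tendsto_coe]
    simpa using tendsto_one_div_add_atTop_nhds_zero_nat (𝕜 := ℝ)
  simpa using this.const_add u

omit mΩ in
lemma antitone_past (u : ℝ≥0) :
    Antitone fun n : ℕ => ⨆ i, pastSigma τ W0 W N (u + 1 / ((n : ℝ≥0) + 1)) i := by
  intro n m hnm
  refine iSup_mono fun i => pastSigma_mono ?_ i
  have : (n : ℝ≥0) ≤ m := by exact_mod_cast hnm
  gcongr

omit mΩ in
lemma pastSigma_le_enlargedFiltration (u : ℝ≥0) (i : Source) :
    pastSigma τ W0 W N u i ≤ enlargedFiltration τ W0 W N u :=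
  le_iInf fun _ => (pastSigma_mono le_self_add i).trans (le_iSup _ i)

/-- Revealing the types and `N` in advance leaves `W j` and `W0` Brownian, since the sources are
independent. Random coefficients and jumps thereby become data known at time `0`. -/
theorem IsMarketNoise.isNoiseFiltration (h : IsMarketNoise P 𝕋 lam νc νi τ W0 W N) (j : ℕ) :
    IsNoiseFiltration P (enlargedFiltration τ W0 W N) (W j) W0 where
  le t := (iInf_le _ 0).trans
    (iSup_le fun i => (pastSigma_le_sourceSigma _ i).trans (h.sourceSigma_le i))
  mono u v huv := iInf_mono fun n => iSup_mono fun i =>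
    pastSigma_mono (add_le_add_left huv _) i
  adapted t := (comap_measurable (W j t)).mono
    ((le_iSup₂_of_le t (Set.mem_Iic.2 le_rfl) le_rfl).trans
      (pastSigma_le_enlargedFiltration t (Source.idiosyncratic j))) le_rfl
  adapted0 t := (comap_measurable (W0 t)).mono
    ((le_iSup₂_of_le t (Set.mem_Iic.2 le_rfl) le_rfl).trans
      (pastSigma_le_enlargedFiltration t Source.common)) le_rfl
  indep u v huv := by
    rcases huv.eq_or_lt with rfl | huv
    · simp only [sub_self]
      rw [MeasurableSpace.comap_const]
      exact indep_bot_right _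
    -- While `u + 1 / (n + 1)` precedes `v`, the past at that time is independent of the increment
    -- from it to `v`. As `n` grows, continuity of the paths turns this into the increment from `u`.
    obtain ⟨n0, hn0⟩ :=
      ((tendsto_add_one_div u).eventually (gt_mem_nhds huv)).exists_forall_of_atTop
    have hm : ∀ s, Measurable fun ω => (W j v ω - W j s ω, W0 v ω - W0 s ω) := fun s =>
      ((h.measurable_idiosyncratic j v).sub (h.measurable_idiosyncratic j s)).prodMk
        ((h.measurable_common v).sub (h.measurable_common s))
    refine indep_of_indep_of_le_left (indep_iInf_comap
      (𝓖 := fun n => ⨆ i, pastSigma τ W0 W N (u + 1 / (((n + n0 : ℕ) : ℝ≥0) + 1)) i)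
      (fun n => iSup_le fun i => (pastSigma_le_sourceSigma _ i).trans (h.sourceSigma_le i))
      (fun n => hm (u + 1 / (((n + n0 : ℕ) : ℝ≥0) + 1))) (hm u)
      (fun n => h.indep_past_incr j (hn0 _ (Nat.le_add_left _ _)).le) ?_)
      (le_iInf fun n => iInf_le _ (n + n0))
    filter_upwards [(h.brownian_idiosyncratic j).cont, h.brownian_common.cont] with ω h1 h2
    have hlim := (tendsto_add_atTop_iff_nat n0).2 (tendsto_add_one_div u)
    exact ((((h1.tendsto u).comp hlim).const_sub _).prodMk_nhds
      (((h2.tendsto u).comp hlim).const_sub _))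
  law u v huv := by
    have hind : IndepFun (fun ω => W j v ω - W j u ω) (fun ω => W0 v ω - W0 u ω) P := by
      have := h.indep.indep (i := Source.idiosyncratic j) (j := Source.common) (by simp)
      refine indep_of_indep_of_le_right (indep_of_indep_of_le_left this ?_)
        (incrSigma_le_sourceSigma j u v Source.common)
      have := incrSigma_le_sourceSigma (τ := τ) (W0 := W0) (W := W) (N := N) j u v
        (Source.idiosyncratic j)
      simpa only [incrSigma, if_true] using this
    refine Eq.trans ((indepFun_iff_map_prod_eq_prod_map_map
      ((h.measurable_idiosyncratic j v).sub (h.measurable_idiosyncratic j u)).aemeasurable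
      ((h.measurable_common v).sub (h.measurable_common u)).aemeasurable).1 hind) ?_
    exact congrArg₂ Measure.prod ((h.brownian_idiosyncratic j).toIsPreBrownianReal.map_sub huv)
      (h.brownian_common.toIsPreBrownianReal.map_sub huv)

omit mΩ in
lemma information_le_past (s : ℝ≥0) :
    information τ W0 W N s ≤ ⨆ i, pastSigma τ W0 W N s i := by
  refine sup_le (sup_le (sup_le ?_ ?_) ?_) ?_
  · exact iSup_le fun j => le_iSup (pastSigma τ W0 W N s) (Source.type j)
  · exact le_iSup (pastSigma τ W0 W N s) Source.common
  · exact iSup_le fun j => le_iSup (pastSigma τ W0 W N s) (Source.idiosyncratic j)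
  · refine iSup₂_le fun r _ => iSup₂_le fun A hA => ?_
    refine le_trans ?_ (le_iSup (pastSigma τ W0 W N s) Source.poisson)
    refine Measurable.comap_le ?_
    exact (Measure.measurable_coe (measurableSet_Icc.prod (show MeasurableSet A from hA))).comp
      (comap_measurable N)

omit [IsProbabilityMeasure P] in
-- Adaptedness provides versions measurable at every time after `t`, but not at `t` itself; hence
-- the right-continuous form of the enlarged filtration.
lemma IsAdaptedOn.exists_measurable_enlargedFiltration {T : ℝ≥0} {X : ℝ≥0 → Ω → ℝ}
    (h : IsAdaptedOn P (information τ W0 W N) T X) {t : ℝ≥0} (ht : t ≤ T) :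
    ∃ Y : Ω → ℝ, Measurable[enlargedFiltration τ W0 W N t] Y ∧ X t =ᵐ[P] Y := by
  refine exists_measurable_iInf_ae_eq (antitone_past t) fun n => ?_
  exact (h t ht (t + 1 / ((n : ℝ≥0) + 1)) (lt_add_of_pos_right _ (by positivity))).mono
    (information_le_past _)

end Market

/-! ### The explicit wealth process -/

section SumDirac

variable {G : Type*} [MeasurableSpace G] {μ : Measure (ℝ≥0 × G)} {A : Finset ℝ≥0} {e : ℝ≥0 → G}
  {T t : ℝ≥0}

lemma restrict_strip_strip (ht : t ≤ T) :
    (μ.restrict (strip G T)).restrict (strip G t) = μ.restrict (strip G t) :=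
  Measure.restrict_restrict_of_subset
    (Set.prod_mono (Set.Icc_subset_Icc_right ht) le_rfl)

omit [MeasurableSpace G] in
lemma mem_strip {u : ℝ≥0} {x : G} : (u, x) ∈ strip G t ↔ u ≤ t := by
  simp [strip]

lemma integral_strip_eq_sum [MeasurableSingletonClass G]
    (h : μ.restrict (strip G T) = ∑ u ∈ A, Measure.dirac (u, e u)) (ht : t ≤ T)
    (f : ℝ≥0 × G → ℝ) :
    ∫ q in strip G t, f q ∂μ = ∑ u ∈ A with u ≤ t, f (u, e u) := by
  classical
  rw [← restrict_strip_strip ht, h, ← integral_indicator (measurableSet_strip t),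
    integral_finsetSum_measure fun u _ => integrable_dirac (by simp), Finset.sum_filter]
  refine Finset.sum_congr rfl fun u _ => ?_
  rw [integral_dirac]
  by_cases hu : u ≤ t
  · rw [Set.indicator_of_mem (mem_strip.2 hu), if_pos hu]
  · rw [Set.indicator_of_notMem (fun hm => hu (mem_strip.1 hm)), if_neg hu]

lemma measure_strip_eq_card (h : μ.restrict (strip G T) = ∑ u ∈ A, Measure.dirac (u, e u))
    (ht : t ≤ T) : μ (strip G t) = ((A.filter (· ≤ t)).card : ℝ≥0∞) := by
  classical
  rw [← Measure.restrict_apply_self μ (strip G t), ← restrict_strip_strip ht,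
    Measure.restrict_apply_self, h, Measure.finsetSum_apply, Finset.card_filter]
  push_cast
  refine Finset.sum_congr rfl fun u _ => ?_
  rw [Measure.dirac_apply' _ (measurableSet_strip t)]
  by_cases hu : u ≤ t
  · rw [Set.indicator_of_mem (mem_strip.2 hu), if_pos hu, Pi.one_apply]
  · rw [Set.indicator_of_notMem (fun hm => hu (mem_strip.1 hm)), if_neg hu]

lemma ae_restrict_strip_iff [MeasurableSingletonClass G]
    (h : μ.restrict (strip G T) = ∑ u ∈ A, Measure.dirac (u, e u)) {p : ℝ≥0 × G → Prop} :
    (∀ᵐ q ∂(μ.restrict (strip G T)), p q) ↔ ∀ u ∈ A, p (u, e u) := by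
  classical
  rw [h, ae_iff, Measure.finsetSum_apply, Finset.sum_eq_zero_iff]
  refine forall₂_congr fun u _ => ?_
  rw [Measure.dirac_apply]
  simp [Set.indicator_apply]

end SumDirac

section Wealth

variable {Ω S Ec Ei : Type*} {mΩ : MeasurableSpace Ω} [MeasurableSpace S] [MeasurableSpace Ec]
  [MeasurableSpace Ei] [MeasurableSingletonClass (Ec × (ℕ → Ei))]
  {P : Measure Ω} [IsProbabilityMeasure P] {𝕋 : Measure S} {lam : ℝ≥0}
  {νc : Measure Ec} {νi : Measure Ei} [IsProbabilityMeasure νi]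
  {τ : ℕ → Ω → S} {W0 : ℝ≥0 → Ω → ℝ} {W : ℕ → ℝ≥0 → Ω → ℝ}
  {N : Ω → Measure (ℝ≥0 × Ec × (ℕ → Ei))}

/-- In the enlarged filtration the type and all jumps are known at time `0`, so the wealth equation
falls under `IsNoiseFiltration.ae_eq_jumpSolution`. -/
theorem IsMarketNoise.ae_wealth_eq (h : IsMarketNoise P 𝕋 lam νc νi τ W0 W N) {T : ℝ≥0}
    {A : Ω → Finset ℝ≥0} {e : Ω → ℝ≥0 → Ec × (ℕ → Ei)}
    (hA : ∀ᵐ ω ∂P, (∀ u ∈ A ω, 0 < u ∧ u ≤ T) ∧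
      (N ω).restrict (strip _ T) = ∑ u ∈ A ω, Measure.dirac (u, e ω u))
    {a b c x0 : S → ℝ} (ha : Measurable a) (hb : Measurable b) (hc : Measurable c)
    (hx0 : Measurable x0) {γ : S → Ec × Ei → ℝ} (hγ : Measurable fun p : S × Ec × Ei => γ p.1 p.2)
    {j : ℕ} (hpos : ∀ᵐ ω ∂P, ∀ u ∈ A ω, 0 < 1 + γ (τ j ω) ((e ω u).1, (e ω u).2 j))
    {X : ℝ≥0 → Ω → ℝ}
    (hX : SolvesLinearSDE P (information τ W0 W N) T (W j) W0 N (fun ω => x0 (τ j ω))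
      (fun ω => a (τ j ω)) (fun ω => b (τ j ω)) (fun ω => c (τ j ω))
      (fun ω q => γ (τ j ω) (q.1, q.2 j)) X) :
    ∀ᵐ ω ∂P, ∀ t ≤ T, X t ω = x0 (τ j ω) *
      Real.exp ((a (τ j ω) - (b (τ j ω) ^ 2 + c (τ j ω) ^ 2) / 2) * t
        + (b (τ j ω) * W j t ω + c (τ j ω) * W0 t ω)) *
      ∏ u ∈ A ω with u ≤ t, (1 + γ (τ j ω) ((e ω u).1, (e ω u).2 j)) := by
  classical
  set 𝓕 := enlargedFiltration τ W0 W N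
  have hN : IsNoiseFiltration P 𝓕 (W j) W0 := h.isNoiseFiltration j
  have hτ : Measurable[𝓕 0] (τ j) :=
    (comap_measurable (τ j)).mono (pastSigma_le_enlargedFiltration 0 (Source.type j)) le_rfl
  have hNm : Measurable[𝓕 0] N :=
    (comap_measurable N).mono (pastSigma_le_enlargedFiltration 0 Source.poisson) le_rfl
  -- The atoms `A`, `e` need not be measurable in `ω`. The jump product is therefore expressed
  -- through the type and `N`, as the exponential of the integral of `log (1 + γ)`, which is where
  -- positivity of `1 + γ` enters.
  set f : ℝ≥0 → (S × Measure (ℝ≥0 × Ec × (ℕ → Ei))) × (ℝ≥0 × Ec × (ℕ → Ei)) → ℝ := fun t p =>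
    (strip (Ec × (ℕ → Ei)) t).indicator
      (fun q => Real.log (1 + γ p.1.1 (q.2.1, q.2.2 j))) p.2 with hf
  have hfm : ∀ t, Measurable (f t) := by
    intro t
    have h1 : Measurable fun p : (S × Measure (ℝ≥0 × Ec × (ℕ → Ei))) × (ℝ≥0 × Ec × (ℕ → Ei)) =>
        Real.log (1 + γ p.1.1 (p.2.2.1, p.2.2.2 j)) := by
      refine Real.measurable_log.comp (measurable_const.add ?_)
      exact hγ.comp (measurable_fst.fst.prodMk ((measurable_snd.snd.fst).prodMk
        ((measurable_pi_apply j).comp measurable_snd.snd.snd)))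
    have h2 : f t = (Prod.snd ⁻¹' strip (Ec × (ℕ → Ei)) t).indicator
        (fun p => Real.log (1 + γ p.1.1 (p.2.2.1, p.2.2.2 j))) := by
      ext p
      simp only [hf, Set.indicator, Set.mem_preimage]
    rw [h2]
    exact h1.indicator (measurable_snd (measurableSet_strip t))
  set Ψ : ℝ≥0 → S × Measure (ℝ≥0 × Ec × (ℕ → Ei)) → ℝ := fun t p =>
    Real.exp (∫ q, f t (p, q) ∂(((truncKernel (measurableSet_strip T)).comap Prod.snd
      measurable_snd) p)) with hΨ
  have hΨm : ∀ t, Measurable (Ψ t) := fun t =>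
    Real.measurable_exp.comp
      ((hfm t).stronglyMeasurable.integral_kernel_prod_right').measurable
  have key := hN.ae_eq_jumpSolution (h.brownian_idiosyncratic j).cont h.brownian_common.cont
    (ha.comp hτ) (hb.comp hτ) (hc.comp hτ) (hx0.comp hτ) (T := T) (A := A)
    (h := fun ω u => γ (τ j ω) ((e ω u).1, (e ω u).2 j))
    (J := fun t ω => Ψ t (τ j ω, N ω)) (fun t => (hΨm t).comp (hτ.prodMk hNm))
    (hA.mono fun ω hω => hω.1) ?_
    -- For the same reason the number of jumps up to `t` is read off as the mass of the strip.
    (C := fun t k => {ω | N ω (strip _ t) < k})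
    (fun t k => ((Measure.measurable_coe (measurableSet_strip t)).comp hNm) measurableSet_Iio) ?_
    (X := X) (fun t ht => hX.adapted.exists_measurable_enlargedFiltration ht) hX.cadlag ?_
  · filter_upwards [key, (h.brownian_idiosyncratic j).toIsPreBrownianReal.eval_zero_ae_eq_zero,
      h.brownian_common.toIsPreBrownianReal.eval_zero_ae_eq_zero] with ω h1 h2 h3 t ht
    rw [h1 t ht, jumpSolution, expPath, h2, h3]
    simp only [Function.comp_apply, sub_zero]
  · filter_upwards [hA, hpos] with ω h1 h2 t ht
    simp only [hΨ, Kernel.comap_apply]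
    rw [truncKernel_apply (measurableSet_strip T) (measure_strip_eq_card h1.2 le_rfl)]
    simp only [hf]
    rw [integral_indicator (measurableSet_strip t), restrict_strip_strip ht,
      integral_strip_eq_sum h1.2 ht, Real.exp_sum]
    refine Finset.prod_congr rfl fun u hu => ?_
    exact Real.exp_log (h2 u (Finset.mem_filter.1 hu).1)
  · filter_upwards [hA] with ω h1 t ht k
    rw [measure_strip_eq_card h1.2 ht]
    exact Nat.cast_lt
  · intro t ht
    obtain ⟨I, I0, hI, hI0, heq⟩ := hX.equation t ht
    refine ⟨I, I0, hI, hI0, ?_⟩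
    filter_upwards [heq, hA] with ω h1 h2
    rw [h1]
    congr 1
    exact integral_strip_eq_sum h2.2 ht
      (fun q => Function.leftLim (fun s => X s ω) q.1 * γ (τ j ω) (q.2.1, q.2.2 j))

end Wealth

/-! ### Admissible strategies keep wealth positive -/

section Admissible

/-- For `η < 0` one has `1 + x η > 1 + y η ≥ 1 + y L ≥ 0`; strictness comes from the room between
`x` and `y`. -/
lemma one_add_mul_pos_of_lower {x y η : ℝ} {L : EReal} (hx : 0 < x) (hxy : x < y)
    (hy : (y : EReal) ≤ -L⁻¹) (hη : L ≤ η) : 0 < 1 + x * η := by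
  rcases le_or_gt 0 η with h | h
  · positivity
  induction L using EReal.rec with
  | bot =>
    -- With `L = -∞` the bound `-1 / L` is `0` and leaves no room for a positive position.
    rw [EReal.inv_bot, neg_zero] at hy
    exact absurd (EReal.coe_nonneg.not.2 (not_le.2 h)) (by
      have : y ≤ 0 := by exact_mod_cast hy
      linarith)
  | top => simp at hη
  | coe L =>
    have hL : L ≤ η := by exact_mod_cast hη
    have hy' : y ≤ -L⁻¹ := by
      rw [← EReal.coe_inv, ← EReal.coe_neg] at hy
      exact_mod_cast hy
    have hL0 : 0 < -L := by linarith
    have h1 : y * (-L) ≤ 1 := by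
      rw [← inv_neg] at hy'
      calc y * (-L) ≤ (-L)⁻¹ * (-L) := by gcongr
        _ = 1 := inv_mul_cancel₀ hL0.ne'
    nlinarith [mul_lt_mul_of_pos_right hxy (neg_pos.2 h), mul_le_mul_of_nonneg_left
      (neg_le_neg hL) (hx.trans hxy).le]

lemma one_add_mul_pos_of_upper {x y η : ℝ} {U : EReal} (hx : x < 0) (hxy : y < x)
    (hy : -U⁻¹ ≤ (y : EReal)) (hη : (η : EReal) ≤ U) : 0 < 1 + x * η := by
  have h := one_add_mul_pos_of_lower (x := -x) (y := -y) (η := -η) (L := -U) (by linarith)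
    (by linarith) ?_ ?_
  · linarith
  · rw [EReal.inv_neg, neg_neg, EReal.coe_neg]
    exact EReal.neg_le.1 hy
  · rw [EReal.coe_neg]
    exact EReal.neg_le_neg_iff.2 hη

lemma exists_gt_lt_mem_of_mem_interior {s : Set ℝ} {x : ℝ} (h : x ∈ interior s) :
    (∃ y ∈ s, x < y) ∧ ∃ y ∈ s, y < x := by
  have h' := mem_interior_iff_mem_nhds.1 h
  constructor
  · obtain ⟨y, h1, h2⟩ := ((show ∀ᶠ y in 𝓝[>] x, y ∈ s from nhdsWithin_le_nhds h').and
      self_mem_nhdsWithin).exists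
    exact ⟨y, h1, h2⟩
  · obtain ⟨y, h1, h2⟩ := ((show ∀ᶠ y in 𝓝[<] x, y ∈ s from nhdsWithin_le_nhds h').and
      self_mem_nhdsWithin).exists
    exact ⟨y, h1, h2⟩

variable {E : Type*} [MeasurableSpace E] {ν : Measure E} [IsFiniteMeasure ν] {θ : InvestorType E}
  {φ : ℝ → ℝ}

lemma ae_signalKernel {z : ℝ} (hz : z ≠ 0) {p : E → Prop}
    (h : ∀ᵐ e ∂(signalKernel ν θ z), p e) : ∀ᵐ e ∂ν, θ.zeta e = z → p e := by
  rw [signalKernel, if_neg hz, ProbabilityTheory.cond, Measure.ae_ennreal_smul_measure_iff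
    (ENNReal.inv_ne_zero.2 (measure_ne_top _ _)),
    ae_restrict_iff' (θ.measurable_zeta (measurableSet_singleton z))] at h
  exact h

lemma measurableSet_unsignaledShocks : MeasurableSet (unsignaledShocks θ) :=
  (θ.measurable_zeta (measurableSet_singleton 0)).inter
    (θ.measurable_eta (measurableSet_singleton 0).compl)

omit [IsFiniteMeasure ν] in
/-- If the position `x` taken at the signal `z` is an interior point of `positions`, wealth stays
positive. -/
lemma one_add_mul_pos_of_mem_interior {z x : ℝ} (hx : x ∈ interior (positions ν θ z)) {η : ℝ}
    (hη : lowerJump ν θ z ≤ η ∧ (η : EReal) ≤ upperJump ν θ z)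
    (hz : z = 0 → ν (unsignaledShocks θ) ≠ 0) : 0 < 1 + x * η := by
  obtain ⟨⟨y, hy, hxy⟩, ⟨y', hy', hxy'⟩⟩ := exists_gt_lt_mem_of_mem_interior hx
  rw [positions] at hy hy'
  rcases lt_trichotomy x 0 with hx0 | rfl | hx0
  · rcases le_or_gt η 0 with h | h
    · nlinarith
    refine one_add_mul_pos_of_upper hx0 hxy' ?_ hη.2
    have hU : 0 < upperJump ν θ z := lt_of_lt_of_le (by exact_mod_cast h) hη.2
    -- Every branch of `positions` either supplies the constraint involving `upperJump` or is
    -- excluded, by `hz` or by the sign of the jump bounds.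
    split_ifs at hy' with h1 h2 h3 h4
    · exact hy'.1
    · exact absurd h2 (hz (not_not.1 h1))
    · obtain rfl := not_not.1 h1
      exact hy'.1
    · obtain rfl := not_not.1 h1
      exact hy'
    · obtain rfl := not_not.1 h1
      exact absurd ⟨not_le.1 h4, hU⟩ h3
  · simp
  · rcases le_or_gt 0 η with h | h
    · positivity
    refine one_add_mul_pos_of_lower hx0 hxy ?_ hη.1
    have hL : lowerJump ν θ z < 0 := lt_of_le_of_lt hη.1 (by exact_mod_cast h)
    split_ifs at hy with h1 h2 h3 h4
    · exact hy.2
    · exact absurd h2 (hz (not_not.1 h1))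
    · obtain rfl := not_not.1 h1
      exact hy.2
    · obtain rfl := not_not.1 h1
      exact absurd hL (not_lt.2 h4)
    · obtain rfl := not_not.1 h1
      exact hy

/-- There are finitely many signals, so one null set per value may be removed. Nonzero values of
mass zero are discarded, the position `0` and marks with `η = 0` are harmless, and interior
positions are covered by `one_add_mul_pos_of_mem_interior`. -/
theorem IsAdmissibleSignalStrategy.ae_one_add_jumpReturn_pos
    (hφ : IsAdmissibleSignalStrategy ν θ φ) (hθ : IsAdmissibleType ν θ) :
    ∀ᵐ e ∂ν, 0 < 1 + jumpReturn θ φ e := by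
  obtain ⟨-, lo, hi, hlohi⟩ := hφ
  have hmain : ∀ z ∈ Set.range θ.zeta, ∀ᵐ e ∂ν, θ.zeta e = z → 0 < 1 + φ z * θ.eta e := by
    intro z _
    by_cases hz : IsPossibleSignal ν θ z
    · obtain ⟨hsub, hmem⟩ := hlohi z hz
      rcases hsub hmem with h0 | hint
      · rw [Set.mem_singleton_iff.1 h0]
        simp
      have hker : ∀ᵐ e ∂(signalKernel ν θ z),
          lowerJump ν θ z ≤ θ.eta e ∧ (θ.eta e : EReal) ≤ upperJump ν θ z :=
        (ae_essInf_le (f := fun e => (θ.eta e : EReal))).and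
          (ae_le_essSup (f := fun e => (θ.eta e : EReal)))
      by_cases h0 : z = 0
      · subst h0
        by_cases hnull : ν (unsignaledShocks θ) = 0
        · filter_upwards [measure_eq_zero_iff_ae_notMem.1 hnull] with e he hze
          have : θ.eta e = 0 := by
            by_contra hne
            exact he ⟨hze, hne⟩
          simp [this]
        · rw [signalKernel, if_pos rfl, ae_restrict_iff' measurableSet_unsignaledShocks] at hker
          filter_upwards [hker] with e he hze
          by_cases hη : θ.eta e = 0
          · simp [hη]
          · exact one_add_mul_pos_of_mem_interior hint (he ⟨hze, hη⟩) fun _ => hnull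
      · filter_upwards [ae_signalKernel h0 hker] with e he hze
        exact one_add_mul_pos_of_mem_interior hint (he hze) fun h => absurd h h0
    · rw [IsPossibleSignal, not_or, not_not] at hz
      filter_upwards [measure_eq_zero_iff_ae_notMem.1 hz.2] with e he hze
      exact absurd hze he
  have hall := (ae_ball_iff hθ.finite_signals.countable).2 hmain
  filter_upwards [hall] with e he
  exact he _ ⟨e, rfl⟩ rfl

end Admissible

section Market

variable {Ω S Ec Ei : Type*} {mΩ : MeasurableSpace Ω} [MeasurableSpace S] [MeasurableSpace Ec]
  [MeasurableSpace Ei]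
  {P : Measure Ω} [IsProbabilityMeasure P] {𝕋 : Measure S} {lam : ℝ≥0}
  {νc : Measure Ec} [IsProbabilityMeasure νc] {νi : Measure Ei} [IsProbabilityMeasure νi]
  {τ : ℕ → Ω → S} {W0 : ℝ≥0 → Ω → ℝ} {W : ℕ → ℝ≥0 → Ω → ℝ}
  {N : Ω → Measure (ℝ≥0 × Ec × (ℕ → Ei))}

lemma measurePreserving_investorMark (lam : ℝ≥0) (j : ℕ) :
    MeasurePreserving (fun e : Ec × (ℕ → Ei) => (e.1, e.2 j)) (markIntensity lam νc νi)
      (investorIntensity lam νc νi) := by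
  have := ((MeasurePreserving.id νc).prod
    (measurePreserving_eval_infinitePi (fun _ : ℕ => νi) j)).smul_measure (lam : ℝ≥0∞)
  exact this

instance : IsFiniteMeasure (markIntensity lam νc νi) := by
  unfold markIntensity; infer_instance

instance : IsFiniteMeasure (investorIntensity lam νc νi) := by
  unfold investorIntensity; infer_instance

/-- A null set of marks stays null for the intensity when all times are allowed, and the exceptional
set depends only on `κ`, which is independent of `N`. -/
lemma IsMarketNoise.ae_strip (h : IsMarketNoise P 𝕋 lam νc νi τ W0 W N) {T : ℝ≥0}
    {α : Type*} [MeasurableSpace α] {κ : Ω → α} (hκ : Measurable κ) (hind : IndepFun κ N P)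
    (hfin : ∀ᵐ ω ∂P, ∃ k : ℕ, N ω (strip _ T) = k) {p : α → Ec × (ℕ → Ei) → Prop}
    (hp : MeasurableSet {q : α × Ec × (ℕ → Ei) | p q.1 q.2})
    (hae : ∀ᵐ a ∂(P.map κ), ∀ᵐ e ∂(markIntensity lam νc νi), p a e) :
    ∀ᵐ ω ∂P, ∀ᵐ q ∂((N ω).restrict (strip _ T)), p (κ ω) q.2 := by
  have := h.poisson.ae_ae_notMem (measurableSet_strip T) hfin hκ hind
    (B := {q | ¬ p q.1 q.2.2})
    ((measurable_fst.prodMk measurable_snd.snd) hp).compl ?_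
  · filter_upwards [this] with ω hω
    filter_upwards [hω] with q hq
    exact not_not.1 hq
  · filter_upwards [hae] with a ha
    refine measure_mono_null (t := Set.univ ×ˢ {e | ¬ p a e}) (fun q hq => ⟨trivial, hq.2⟩) ?_
    rw [Measure.prod_prod, ae_iff.1 ha, mul_zero]

theorem IsMarketNoise.ae_strip_one_add_jumpReturn_pos
    (h : IsMarketNoise P 𝕋 lam νc νi τ W0 W N) {T : ℝ≥0}
    (hfin : ∀ᵐ ω ∂P, ∃ k : ℕ, N ω (strip _ T) = k) {γ : S → Ec × Ei → ℝ}
    (hγ : Measurable fun p : S × Ec × Ei => γ p.1 p.2)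
    (hpos : ∀ᵐ s ∂𝕋, ∀ᵐ e ∂(investorIntensity lam νc νi), 0 < 1 + γ s e) (j : ℕ) :
    ∀ᵐ ω ∂P, ∀ᵐ q ∂((N ω).restrict (strip _ T)), 0 < 1 + γ (τ j ω) (q.2.1, q.2.2 j) := by
  refine h.ae_strip (h.measurable_type j) ?_ hfin (p := fun s e => 0 < 1 + γ s (e.1, e.2 j)) ?_ ?_
  · exact h.indep.indep (i := Source.type j) (j := Source.poisson) (by simp)
  · refine measurableSet_lt measurable_const (measurable_const.add ?_)
    exact hγ.comp (measurable_fst.prodMk (measurable_snd.fst.prodMk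
      ((measurable_pi_apply j).comp measurable_snd.snd)))
  · rw [h.type_law j]
    filter_upwards [hpos] with s hs
    exact (measurePreserving_investorMark lam j).quasiMeasurePreserving.ae hs

end Market

/-! ### Dyadic chaining -/

section Chaining

/-- A bound for the largest increment of `w` over the dyadic intervals of level `n` of `[0, T]`, by
the fourth powers of the increments. -/
def chainBound (T : ℝ≥0) (n : ℕ) (w : ℝ≥0 → ℝ) : ℝ :=
  (9 / 10) ^ n + (((9 / 10 : ℝ) ^ n)⁻¹) ^ 3 *
    ∑ k ∈ Finset.range (2 ^ n), (w (dyadicPoint T n (k + 1)) - w (dyadicPoint T n k)) ^ 4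

lemma chainBound_nonneg (T : ℝ≥0) (n : ℕ) (w : ℝ≥0 → ℝ) : 0 ≤ chainBound T n w := by
  unfold chainBound
  have : 0 ≤ ∑ k ∈ Finset.range (2 ^ n),
      (w (dyadicPoint T n (k + 1)) - w (dyadicPoint T n k)) ^ 4 :=
    Finset.sum_nonneg fun k _ => by positivity
  positivity

/-- If `|x| > ε` then `|x| ≤ x⁴ / ε³`. This lets a maximum of increments be replaced by a sum whose
expectation is explicit. -/
lemma abs_le_add_pow_four {ε x : ℝ} (hε : 0 < ε) : |x| ≤ ε + (ε⁻¹) ^ 3 * x ^ 4 := by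
  rcases le_or_gt |x| ε with h | h
  · have : 0 ≤ (ε⁻¹) ^ 3 * x ^ 4 := by positivity
    linarith
  · have h1 : |x| * ε ^ 3 ≤ x ^ 4 := by
      calc |x| * ε ^ 3 ≤ |x| * |x| ^ 3 := by gcongr
        _ = |x| ^ 4 := by ring
        _ = x ^ 4 := by rw [pow_abs, abs_of_nonneg (by positivity)]
    have h2 : |x| = (ε⁻¹) ^ 3 * (|x| * ε ^ 3) := by
      field_simp
    rw [h2]
    have : (ε⁻¹) ^ 3 * (|x| * ε ^ 3) ≤ (ε⁻¹) ^ 3 * x ^ 4 := by gcongr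
    linarith

lemma abs_incr_le_chainBound (T : ℝ≥0) {n k : ℕ} (hk : k < 2 ^ n) (w : ℝ≥0 → ℝ) :
    |w (dyadicPoint T n (k + 1)) - w (dyadicPoint T n k)| ≤ chainBound T n w := by
  refine (abs_le_add_pow_four (ε := (9 / 10 : ℝ) ^ n) (by positivity)).trans ?_
  unfold chainBound
  gcongr
  exact Finset.single_le_sum
    (f := fun k => (w (dyadicPoint T n (k + 1)) - w (dyadicPoint T n k)) ^ 4)
    (fun k _ => by positivity) (Finset.mem_range.2 hk)

/-- The sum of the chaining bounds from level `n` on. -/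
def chainTail (T : ℝ≥0) (n : ℕ) (w : ℝ≥0 → ℝ) : ℝ :=
  (∑' l, ENNReal.ofReal (chainBound T (l + n) w)).toReal

/-- The point of index `i` at level `n` has index `2 i` at level `n + 1`, where the index of `s` is
`2 i` or `2 i - 1`. The two points are thus at most one fine interval apart. -/
lemma abs_dyadicIndex_step_le {T : ℝ≥0} (hT : 0 < T) (n : ℕ) {s : ℝ} (hs : s ≤ T) (w : ℝ≥0 → ℝ) :
    |w (dyadicPoint T n (dyadicIndex T n s)) - w (dyadicPoint T (n + 1) (dyadicIndex T (n + 1) s))|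
      ≤ chainBound T (n + 1) w := by
  set i := dyadicIndex T n s with hi
  set j := dyadicIndex T (n + 1) s with hj
  have hT' : (0 : ℝ) < T := by exact_mod_cast hT
  have h2 : s * 2 ^ (n + 1) / (T : ℝ) = 2 * (s * 2 ^ n / T) := by ring
  have hpt : dyadicPoint T n i = dyadicPoint T (n + 1) (2 * i) := by
    simp only [dyadicPoint, pow_succ]
    push_cast
    field_simp
  have hj1 : j ≤ 2 * i := by
    rw [hj, dyadicIndex, h2, Nat.ceil_le]
    have := Nat.le_ceil (s * 2 ^ n / (T : ℝ))
    push_cast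
    rw [hi, dyadicIndex]
    linarith
  have hj2 : 2 * i ≤ j + 1 := by
    rcases Nat.eq_zero_or_pos i with h0 | h0
    · omega
    have h3 : ((i - 1 : ℕ) : ℝ) < s * 2 ^ n / T := by
      rw [← Nat.lt_ceil]
      exact Nat.sub_lt h0 one_pos
    have h4 := Nat.le_ceil (s * 2 ^ (n + 1) / (T : ℝ))
    rw [h2] at h4
    have h5 : ((2 * (i - 1) : ℕ) : ℝ) < j := by
      push_cast
      calc (2 : ℝ) * ((i - 1 : ℕ) : ℝ) < 2 * (s * 2 ^ n / T) := by linarith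
        _ ≤ j := by rw [hj, dyadicIndex, h2]; exact h4
    have h6 : 2 * (i - 1) < j := by exact_mod_cast h5
    omega
  have hi2 : i ≤ 2 ^ n := dyadicIndex_le hT n hs
  rw [hpt]
  rcases (show 2 * i = j ∨ 2 * i = j + 1 by omega) with h | h
  · rw [h, sub_self, abs_zero]
    exact chainBound_nonneg _ _ _
  · rw [h]
    refine abs_incr_le_chainBound T ?_ w
    rw [pow_succ]
    omega

/-- Telescoping along the dyadic points at or after `t`, which converge to `t` as the level grows.
-/
lemma abs_sub_dyadicPoint_le_chainTail {T : ℝ≥0} (hT : 0 < T) {w : ℝ≥0 → ℝ} (hw : Continuous w)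
    (hfin : ∑' l, ENNReal.ofReal (chainBound T (l + 1) w) ≠ ⊤) {t : ℝ≥0} (ht : t ≤ T) (n : ℕ) :
    |w t - w (dyadicPoint T n (dyadicIndex T n t))| ≤ chainTail T (n + 1) w := by
  have hsum : Summable fun l => chainBound T (l + 1) w := by
    have := ENNReal.summable_toReal hfin
    simpa only [ENNReal.toReal_ofReal (chainBound_nonneg _ _ _)] using this
  have hlim : Tendsto (fun n => w (dyadicPoint T n (dyadicIndex T n t))) atTop (𝓝 (w t)) := by
    refine (hw.tendsto t).comp ?_
    rcases eq_or_ne t 0 with rfl | h0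
    · simp [dyadicIndex, dyadicPoint_zero]
    · exact (tendsto_dyadicPoint_dyadicIndex hT (pos_iff_ne_zero.2 h0)).mono_right
        nhdsWithin_le_nhds
  have h := dist_le_tsum_of_dist_le_of_tendsto (fun l => chainBound T (l + 1) w)
    (fun n => by
      rw [Real.dist_eq]
      exact abs_dyadicIndex_step_le hT n (by exact_mod_cast ht) w) hsum hlim n
  rw [dist_comm, Real.dist_eq] at h
  refine h.trans_eq ?_
  rw [chainTail, ENNReal.tsum_toReal_eq (fun l => ENNReal.ofReal_ne_top)]
  refine tsum_congr fun l => ?_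
  rw [ENNReal.toReal_ofReal (chainBound_nonneg _ _ _)]
  congr 1
  ring

lemma measurable_chainBound (T : ℝ≥0) (n : ℕ) : Measurable (chainBound T n) := by
  have h : ∀ k : ℕ, Measurable fun w : ℝ≥0 → ℝ =>
      (w (dyadicPoint T n (k + 1)) - w (dyadicPoint T n k)) ^ 4 := fun k => by
    have h1 : ∀ t : ℝ≥0, Measurable fun w : ℝ≥0 → ℝ => w t := measurable_pi_apply
    exact Measurable.pow_const ((h1 _).sub (h1 _)) 4
  have h' := Finset.measurable_fun_sum (Finset.range (2 ^ n)) fun k _ => h k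
  exact (h'.const_mul _).const_add _

lemma measurable_chainTail (T : ℝ≥0) (n : ℕ) : Measurable (chainTail T n) :=
  (Measurable.tsum fun l => (measurable_chainBound T (l + n)).ennreal_ofReal).ennreal_toReal

variable {Ω : Type*} {mΩ : MeasurableSpace Ω} {P : Measure Ω} [IsProbabilityMeasure P]

lemma integral_pow_four_gaussianReal (d : ℝ≥0) :
    ∫ x, x ^ 4 ∂(gaussianReal 0 d) = d ^ 2 * ∫ x, x ^ 4 ∂(gaussianReal 0 1) := by
  have h : gaussianReal 0 d = (gaussianReal 0 1).map (√(d : ℝ) * ·) := by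
    rw [gaussianReal_map_const_mul, mul_zero, mul_one]
    congr 1
    rw [← NNReal.coe_inj]
    exact (Real.sq_sqrt d.coe_nonneg).symm
  rw [h, integral_map (by fun_prop) (by fun_prop), ← integral_const_mul]
  refine integral_congr_ae (Eventually.of_forall fun x => ?_)
  have : √(d : ℝ) ^ 4 = (d : ℝ) ^ 2 := by
    rw [show √(d : ℝ) ^ 4 = (√(d : ℝ) ^ 2) ^ 2 by ring, Real.sq_sqrt d.coe_nonneg]
  simp only [mul_pow, this]

lemma integrable_pow_four_gaussianReal (d : ℝ≥0) :
    Integrable (fun x => x ^ 4) (gaussianReal 0 d) := by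
  have h := (memLp_id_gaussianReal (μ := 0) (v := d) 4).integrable_norm_pow (by norm_num)
  refine h.congr (Eventually.of_forall fun x => ?_)
  simp only [id, Real.norm_eq_abs, pow_abs]
  exact abs_of_nonneg (by positivity)

/-- The `2 ^ n` fourth moments, each proportional to `(T / 2 ^ n)²`, are weighted by `(10 / 9) ^ (3
n)`, which produces the ratio `1000 / (2 * 729) = 500 / 729`. The base `9 / 10` is such that both
geometric series converge. -/
lemma integral_chainBound {B : ℝ≥0 → Ω → ℝ} (hB : IsPreBrownianReal B P)
    (hBm : ∀ t, Measurable (B t)) (T : ℝ≥0) (n : ℕ) :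
    Integrable (fun ω => chainBound T n fun t => B t ω) P ∧
    ∫ ω, chainBound T n (fun t => B t ω) ∂P = (9 / 10) ^ n +
      T ^ 2 * (∫ x, x ^ 4 ∂(gaussianReal 0 1)) * (500 / 729) ^ n := by
  have hmap : ∀ k, P.map (fun ω => B (dyadicPoint T n (k + 1)) ω - B (dyadicPoint T n k) ω)
      = gaussianReal 0 (T / 2 ^ n) := fun k => by
    rw [hB.map_sub (dyadicPoint_mono T n (Nat.le_succ k)), dyadicPoint_succ, add_tsub_cancel_left]
  have hm : ∀ k, Measurable
      (fun ω => B (dyadicPoint T n (k + 1)) ω - B (dyadicPoint T n k) ω) := fun k =>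
    (hBm _).sub (hBm _)
  have h4 : Measurable fun x : ℝ => x ^ 4 := measurable_id.pow_const 4
  have hint : ∀ k, Integrable
      (fun ω => (B (dyadicPoint T n (k + 1)) ω - B (dyadicPoint T n k) ω) ^ 4) P := fun k => by
    have := integrable_pow_four_gaussianReal (T / 2 ^ n)
    rw [← hmap k] at this
    exact this.comp_measurable (hm k)
  have hval : ∀ k, ∫ ω, (B (dyadicPoint T n (k + 1)) ω - B (dyadicPoint T n k) ω) ^ 4 ∂P
      = (T / 2 ^ n) ^ 2 * ∫ x, x ^ 4 ∂(gaussianReal 0 1) := fun k => by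
    have := integral_map (μ := P) (hm k).aemeasurable h4.aestronglyMeasurable
    rw [← this, hmap k, integral_pow_four_gaussianReal]
    simp
  have hsum : Integrable (fun ω => ∑ k ∈ Finset.range (2 ^ n),
      (B (dyadicPoint T n (k + 1)) ω - B (dyadicPoint T n k) ω) ^ 4) P :=
    integrable_finsetSum _ fun k _ => hint k
  unfold chainBound
  refine ⟨(integrable_const _).add (hsum.const_mul _), ?_⟩
  rw [integral_add (integrable_const _) (hsum.const_mul _), integral_const_mul,
    integral_finsetSum _ fun k _ => hint k, Finset.sum_congr rfl fun k _ => hval k]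
  simp only [integral_const, probReal_univ, smul_eq_mul, one_mul, Finset.sum_const,
    Finset.card_range, nsmul_eq_mul]
  push_cast
  have e1 : ((500 / 729 : ℝ)) ^ n = ((((9 / 10 : ℝ) ^ n)⁻¹) ^ 3) * ((2 ^ n)⁻¹) := by
    rw [← inv_pow, ← inv_pow, ← pow_mul, mul_comm n 3, pow_mul, ← mul_pow]
    norm_num
  rw [e1]
  field_simp

/-- The mean of a tail is the tail of the convergent series of means, by exchange of sum and
integral for nonnegative terms. -/
lemma lintegral_chainTail {B : ℝ≥0 → Ω → ℝ} (hB : IsPreBrownianReal B P)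
    (hBm : ∀ t, Measurable (B t)) (T : ℝ≥0) :
    (∀ n, Integrable (fun ω => chainTail T n fun t => B t ω) P) ∧
    (∀ᵐ ω ∂P, ∑' l, ENNReal.ofReal (chainBound T (l + 1) fun t => B t ω) ≠ ⊤) ∧
    Tendsto (fun n => ∫ ω, chainTail T n (fun t => B t ω) ∂P) atTop (𝓝 0) := by
  set r : ℕ → ℝ := fun n => ∫ ω, chainBound T n (fun t => B t ω) ∂P with hr
  have hr0 : ∀ n, 0 ≤ r n := fun n => integral_nonneg fun ω => chainBound_nonneg _ _ _
  have hrs : Summable r := by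
    simp only [hr, (integral_chainBound hB hBm T _).2]
    exact (summable_geometric_of_lt_one (by norm_num) (by norm_num)).add
      ((summable_geometric_of_lt_one (by norm_num) (by norm_num)).mul_left _)
  have hpath : Measurable fun ω t => B t ω := measurable_pi_lambda _ hBm
  have hm : ∀ n, Measurable fun ω => ∑' l, ENNReal.ofReal (chainBound T (l + n) fun t => B t ω) :=
    fun n => Measurable.tsum fun l =>
      ((measurable_chainBound T (l + n)).comp hpath).ennreal_ofReal
  have hl : ∀ n, ∫⁻ ω, ∑' l, ENNReal.ofReal (chainBound T (l + n) fun t => B t ω) ∂P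
      = ENNReal.ofReal (∑' l, r (l + n)) := by
    intro n
    rw [lintegral_tsum
      (f := fun l ω => ENNReal.ofReal (chainBound T (l + n) fun t => B t ω)) fun l =>
        ((measurable_chainBound T (l + n)).comp hpath).ennreal_ofReal.aemeasurable,
      ENNReal.ofReal_tsum_of_nonneg (fun l => hr0 _) ((summable_nat_add_iff n).2 hrs)]
    refine tsum_congr fun l => ?_
    rw [hr, ofReal_integral_eq_lintegral_ofReal (integral_chainBound hB hBm T _).1
      (Eventually.of_forall fun ω => chainBound_nonneg _ _ _)]
  have hne : ∀ n, ∫⁻ ω, ∑' l, ENNReal.ofReal (chainBound T (l + n) fun t => B t ω) ∂P ≠ ⊤ :=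
    fun n => (hl n).trans_ne ENNReal.ofReal_ne_top
  have hae : ∀ n, ∀ᵐ ω ∂P,
      ∑' l, ENNReal.ofReal (chainBound T (l + n) fun t => B t ω) < ⊤ := fun n =>
    ae_lt_top (hm n) (hne n)
  refine ⟨fun n => integrable_toReal_of_lintegral_ne_top (hm n).aemeasurable (hne n),
    (hae 1).mono fun ω h => h.ne, ?_⟩
  refine (tendsto_sum_nat_add r).congr fun n => ?_
  unfold chainTail
  rw [integral_toReal (hm n).aemeasurable (hae n), hl n,
    ENNReal.toReal_ofReal (tsum_nonneg fun l => hr0 _)]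

end Chaining

/-! ### Laws of large numbers for the investors -/

section PathLaw

variable {Ω : Type*} {mΩ : MeasurableSpace Ω} {P : Measure Ω} [IsProbabilityMeasure P]

omit [IsProbabilityMeasure P] in
-- A law on path space with the product σ-field is determined by its finite-dimensional
-- distributions.
lemma map_path_eq {B B' : ℝ≥0 → Ω → ℝ} (hB : IsPreBrownianReal B P) (hB' : IsPreBrownianReal B' P)
    (hBm : ∀ t, Measurable (B t)) (hBm' : ∀ t, Measurable (B' t)) :
    P.map (fun ω t => B t ω) = P.map (fun ω t => B' t ω) := by
  have key : ∀ {C : ℝ≥0 → Ω → ℝ}, IsPreBrownianReal C P → (∀ t, Measurable (C t)) →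
      IsProjectiveLimit (P.map fun ω t => C t ω) (α := fun _ : ℝ≥0 => ℝ)
        (fun I => BrownianReal.projectiveFamily I) := by
    intro C hC hCm I
    rw [Measure.map_map (Finset.measurable_restrict I) (measurable_pi_lambda _ hCm)]
    exact (hC.hasLaw I).map_eq
  exact (key hB hBm).unique (key hB' hBm')

variable {Ω' α α' β β' : Type*} {mΩ' : MeasurableSpace Ω'} {Q : Measure Ω'} [IsProbabilityMeasure Q]
  [MeasurableSpace α] [MeasurableSpace α'] [MeasurableSpace β] [MeasurableSpace β']

lemma comap_eq_generateFrom_rectangles {γ : Type*} (f : γ → α × β) :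
    MeasurableSpace.comap f inferInstance = MeasurableSpace.generateFrom
      ((f ⁻¹' ·) '' Set.image2 (· ×ˢ ·) {s : Set α | MeasurableSet s}
        {t : Set β | MeasurableSet t}) := by
  rw [← MeasurableSpace.comap_generateFrom, generateFrom_prod]

lemma isPiSystem_preimage_rectangles {γ : Type*} (f : γ → α × β) :
    IsPiSystem ((f ⁻¹' ·) '' Set.image2 (· ×ˢ ·) {s : Set α | MeasurableSet s}
      {t : Set β | MeasurableSet t}) := by
  exact (isPiSystem_prod (α := α) (β := β)).comap f

/-- Preimages of rectangles form generating π-systems, and on them the product measure reduces the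
claim to the two given independences. -/
lemma indepFun_prodMap {X : Ω → α} {X' : Ω → α'} {Y : Ω' → β} {Y' : Ω' → β'}
    (hX : Measurable X) (hX' : Measurable X') (hY : Measurable Y) (hY' : Measurable Y')
    (hXX : IndepFun X X' P) (hYY : IndepFun Y Y' Q) :
    IndepFun (fun p : Ω × Ω' => (X p.1, Y p.2)) (fun p => (X' p.1, Y' p.2)) (P.prod Q) := by
  refine IndepSets.indep ((hX.comp measurable_fst).prodMk (hY.comp measurable_snd)).comap_le
    ((hX'.comp measurable_fst).prodMk (hY'.comp measurable_snd)).comap_le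
    (isPiSystem_preimage_rectangles _) (isPiSystem_preimage_rectangles _) (comap_eq_generateFrom_rectangles _)
    (comap_eq_generateFrom_rectangles _) ?_
  rw [IndepSets_iff]
  rintro _ _ ⟨_, ⟨s, hs, t, ht, rfl⟩, rfl⟩ ⟨_, ⟨s', hs', t', ht', rfl⟩, rfl⟩
  change (P.prod Q) ((X ⁻¹' s) ×ˢ (Y ⁻¹' t) ∩ (X' ⁻¹' s') ×ˢ (Y' ⁻¹' t'))
    = (P.prod Q) ((X ⁻¹' s) ×ˢ (Y ⁻¹' t)) * (P.prod Q) ((X' ⁻¹' s') ×ˢ (Y' ⁻¹' t'))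
  simp only [Set.prod_inter_prod, Measure.prod_prod]
  rw [indepFun_iff_measure_inter_preimage_eq_mul.1 hXX _ _ hs hs',
    indepFun_iff_measure_inter_preimage_eq_mul.1 hYY _ _ ht ht']
  ring

end PathLaw

section Market

variable {Ω S Ec Ei : Type*} {mΩ : MeasurableSpace Ω} [MeasurableSpace S] [MeasurableSpace Ec]
  [MeasurableSpace Ei]
  {P : Measure Ω} [IsProbabilityMeasure P] {𝕋 : Measure S} {lam : ℝ≥0}
  {νc : Measure Ec} {νi : Measure Ei} [IsProbabilityMeasure νi]
  {τ : ℕ → Ω → S} {W0 : ℝ≥0 → Ω → ℝ} {W : ℕ → ℝ≥0 → Ω → ℝ}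
  {N : Ω → Measure (ℝ≥0 × Ec × (ℕ → Ei))}

omit [IsProbabilityMeasure P] in
lemma IsMarketNoise.measurable_path (h : IsMarketNoise P 𝕋 lam νc νi τ W0 W N) (i : ℕ) :
    Measurable fun ω => (τ i ω, fun t => W i t ω) :=
  (h.measurable_type i).prodMk (measurable_pi_lambda _ fun t => h.measurable_idiosyncratic i t)

omit mΩ in
lemma measurable_path_source (i : ℕ) :
    Measurable[sourceSigma τ W0 W N (.idiosyncratic i)] fun ω t => W i t ω :=
  @measurable_pi_lambda Ω ℝ≥0 (fun _ => ℝ) (sourceSigma τ W0 W N (.idiosyncratic i)) _ _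
    fun t => (comap_measurable (W i t)).mono
    (le_iSup (fun t => MeasurableSpace.comap (W i t) inferInstance) t) le_rfl

omit [IsProbabilityMeasure P] in
lemma IsMarketNoise.indepFun_type_path (h : IsMarketNoise P 𝕋 lam νc νi τ W0 W N) (i : ℕ) :
    IndepFun (τ i) (fun ω t => W i t ω) P :=
  indep_of_indep_of_le_right
    (h.indep.indep (i := Source.type i) (j := Source.idiosyncratic i) (by simp))
    (measurable_path_source i).comap_le

lemma IsMarketNoise.identDistrib_path (h : IsMarketNoise P 𝕋 lam νc νi τ W0 W N) (i : ℕ) :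
    IdentDistrib (fun ω => (τ i ω, fun t => W i t ω)) (fun ω => (τ 0 ω, fun t => W 0 t ω)) P P := by
  have hp : ∀ i, Measurable fun ω t => W i t ω := fun i =>
    measurable_pi_lambda _ fun t => h.measurable_idiosyncratic i t
  refine ⟨(h.measurable_path i).aemeasurable, (h.measurable_path 0).aemeasurable, ?_⟩
  rw [(indepFun_iff_map_prod_eq_prod_map_map (h.measurable_type i).aemeasurable
      (hp i).aemeasurable).1 (h.indepFun_type_path i),
    (indepFun_iff_map_prod_eq_prod_map_map (h.measurable_type 0).aemeasurable
      (hp 0).aemeasurable).1 (h.indepFun_type_path 0), h.type_law, h.type_law,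
    map_path_eq (h.brownian_idiosyncratic i).toIsPreBrownianReal
      (h.brownian_idiosyncratic 0).toIsPreBrownianReal (h.measurable_idiosyncratic i)
      (h.measurable_idiosyncratic 0)]

omit [IsProbabilityMeasure P] in
lemma IsMarketNoise.indepFun_path (h : IsMarketNoise P 𝕋 lam νc νi τ W0 W N) {i k : ℕ}
    (hik : i ≠ k) :
    IndepFun (fun ω => (τ i ω, fun t => W i t ω)) (fun ω => (τ k ω, fun t => W k t ω)) P := by
  have hm : ∀ i, Measurable[⨆ s ∈ ({Source.type i, Source.idiosyncratic i} : Set Source),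
      sourceSigma τ W0 W N s] fun ω => (τ i ω, fun t => W i t ω) := by
    intro i
    refine Measurable.prodMk ?_ ?_
    · exact (comap_measurable (τ i)).mono (le_iSup₂_of_le (f := fun s
        (_ : s ∈ ({Source.type i, Source.idiosyncratic i} : Set Source)) =>
          sourceSigma τ W0 W N s) (Source.type i) (by simp) le_rfl) le_rfl
    · exact (measurable_path_source i).mono (le_iSup₂_of_le (f := fun s
        (_ : s ∈ ({Source.type i, Source.idiosyncratic i} : Set Source)) =>
          sourceSigma τ W0 W N s) (Source.idiosyncratic i) (by simp) le_rfl) le_rfl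
  refine indep_of_indep_of_le_right (indep_of_indep_of_le_left (indep_iSup_of_disjoint
    h.sourceSigma_le h.indep (S := {Source.type i, Source.idiosyncratic i})
    (T := {Source.type k, Source.idiosyncratic k}) ?_) (hm i).comap_le) (hm k).comap_le
  rw [Set.disjoint_left]
  rintro s (rfl | rfl) <;> simp [hik]

/-- The strong law of large numbers for functions of the types and the idiosyncratic noises. -/
theorem IsMarketNoise.strong_law (h : IsMarketNoise P 𝕋 lam νc νi τ W0 W N)
    {f : S × (ℝ≥0 → ℝ) → ℝ} (hf : Measurable f)
    (hint : Integrable (fun ω => f (τ 0 ω, fun t => W 0 t ω)) P) :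
    ∀ᵐ ω ∂P, Tendsto (fun n : ℕ => (∑ i ∈ Finset.range n, f (τ i ω, fun t => W i t ω)) / n) atTop
      (𝓝 (∫ ω, f (τ 0 ω, fun t => W 0 t ω) ∂P)) :=
  strong_law_ae_real (fun i ω => f (τ i ω, fun t => W i t ω)) hint
    (fun _ _ hik => (h.indepFun_path hik).comp hf hf)
    (fun i => (h.identDistrib_path i).comp hf)

theorem IsMarketNoise.strong_law_type (h : IsMarketNoise P 𝕋 lam νc νi τ W0 W N)
    {f : S → ℝ} (hf : Measurable f) (hint : Integrable f 𝕋) :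
    ∀ᵐ ω ∂P, Tendsto (fun n : ℕ => (∑ i ∈ Finset.range n, f (τ i ω)) / n) atTop
      (𝓝 (∫ s, f s ∂𝕋)) := by
  have hint' : Integrable (fun ω => f (τ 0 ω)) P := by
    rw [← h.type_law 0] at hint
    exact hint.comp_measurable (h.measurable_type 0)
  have := h.strong_law (f := fun q => f q.1) (hf.comp measurable_fst) hint'
  rwa [← h.type_law 0, integral_map (h.measurable_type 0).aemeasurable hf.aestronglyMeasurable]

/-- The idiosyncratic noises average out, uniformly in time. -/
theorem IsMarketNoise.strong_law_idiosyncratic (h : IsMarketNoise P 𝕋 lam νc νi τ W0 W N)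
    {T : ℝ≥0} (hT : 0 < T) {b : S → ℝ} (hb : Measurable b) (hint : Integrable b 𝕋) :
    ∀ᵐ ω ∂P, ∀ t ≤ T,
      Tendsto (fun n : ℕ => (∑ i ∈ Finset.range n, b (τ i ω) * W i t ω) / n) atTop (𝓝 0) := by
  have hev : ∀ t : ℝ≥0, Measurable fun w : ℝ≥0 → ℝ => w t := measurable_pi_apply
  have hint' : Integrable (fun ω => b (τ 0 ω)) P := by
    rw [← h.type_law 0] at hint
    exact hint.comp_measurable (h.measurable_type 0)
  have hB0 := (h.brownian_idiosyncratic 0).toIsPreBrownianReal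
  obtain ⟨hci, -, hclim⟩ := lintegral_chainTail hB0 (h.measurable_idiosyncratic 0) T
  -- At a fixed time the summands are i.i.d. with mean zero, the type being independent of the
  -- centered `W 0 t`.
  have hpoint : ∀ t : ℝ≥0, ∀ᵐ ω ∂P,
      Tendsto (fun n : ℕ => (∑ i ∈ Finset.range n, b (τ i ω) * W i t ω) / n) atTop (𝓝 0) := by
    intro t
    have hi : IndepFun (fun ω => b (τ 0 ω)) (W 0 t) P :=
      (h.indepFun_type_path 0).comp hb (hev t)
    have h1 := h.strong_law (f := fun q => b q.1 * q.2 t)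
      ((hb.comp measurable_fst).mul ((hev t).comp measurable_snd))
      (hi.integrable_mul hint' (hB0.integrable_eval t))
    have h2 : ∫ ω, b (τ 0 ω) * W 0 t ω ∂P = 0 := by
      have := hi.integral_mul_eq_mul_integral hint'.aestronglyMeasurable
        (hB0.integrable_eval t).aestronglyMeasurable
      rw [hB0.integral_eval, mul_zero] at this
      exact this
    simpa only [h2] using h1
  -- The chaining bounds for passing from `t` to a dyadic point do not involve `t`. Their weighted
  -- averages converge to a limit that vanishes as `m` grows.
  have htail : ∀ m, ∀ᵐ ω ∂P, Tendsto (fun n : ℕ =>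
      (∑ i ∈ Finset.range n, |b (τ i ω)| * chainTail T m (fun t => W i t ω)) / n) atTop
      (𝓝 ((∫ ω, |b (τ 0 ω)| ∂P) * ∫ ω, chainTail T m (fun t => W 0 t ω) ∂P)) := by
    intro m
    have hi : IndepFun (fun ω => |b (τ 0 ω)|) (fun ω => chainTail T m (fun t => W 0 t ω)) P :=
      (h.indepFun_type_path 0).comp (continuous_abs.measurable.comp hb) (measurable_chainTail T m)
    have h1 := h.strong_law (f := fun q => |b q.1| * chainTail T m q.2)
      (((continuous_abs.measurable.comp hb).comp measurable_fst).mul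
        ((measurable_chainTail T m).comp measurable_snd))
      (hi.integrable_mul hint'.abs (hci m))
    have h2 := hi.integral_mul_eq_mul_integral hint'.abs.aestronglyMeasurable
      (hci m).aestronglyMeasurable
    rw [← h2]
    exact h1
  have hcont : ∀ᵐ ω ∂P, ∀ i, Continuous fun t => W i t ω :=
    ae_all_iff.2 fun i => (h.brownian_idiosyncratic i).cont
  have hfin : ∀ᵐ ω ∂P, ∀ i, ∑' l, ENNReal.ofReal (chainBound T (l + 1) fun t => W i t ω) ≠ ⊤ :=
    ae_all_iff.2 fun i => (lintegral_chainTail (h.brownian_idiosyncratic i).toIsPreBrownianReal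
      (h.measurable_idiosyncratic i) T).2.1
  -- Only countably many events enter, indexed by levels, investors and dyadic points, so the
  -- exceptional set does not depend on `t`.
  filter_upwards [ae_all_iff.2 htail, hcont, hfin,
    ae_all_iff.2 fun m : ℕ => ae_all_iff.2 fun k : ℕ => hpoint (dyadicPoint T m k)]
    with ω h1 h2 h3 h4 t ht
  rw [Metric.tendsto_atTop]
  intro ε hε
  have hlim := (((tendsto_add_atTop_iff_nat 1).2 hclim).const_mul (∫ ω, |b (τ 0 ω)| ∂P))
  rw [mul_zero] at hlim
  obtain ⟨m, hm⟩ := (hlim.eventually (gt_mem_nhds (half_pos hε))).exists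
  set p := dyadicPoint T m (dyadicIndex T m t) with hp
  have e1 := (h1 (m + 1)).eventually (gt_mem_nhds hm)
  have e2 := (Metric.tendsto_nhds.1 (h4 m (dyadicIndex T m t))) (ε / 2) (half_pos hε)
  obtain ⟨n0, hn0⟩ := (e1.and e2).exists_forall_of_atTop
  refine ⟨n0, fun n hn => ?_⟩
  obtain ⟨g1, g2⟩ := hn0 n hn
  rw [Real.dist_eq, sub_zero] at g2 ⊢
  have hdiff : |(∑ i ∈ Finset.range n, b (τ i ω) * W i t ω) / n
      - (∑ i ∈ Finset.range n, b (τ i ω) * W i p ω) / n|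
      ≤ (∑ i ∈ Finset.range n, |b (τ i ω)| * chainTail T (m + 1) (fun t => W i t ω)) / n := by
    rw [← sub_div, ← Finset.sum_sub_distrib, abs_div, Nat.abs_cast]
    gcongr
    refine (Finset.abs_sum_le_sum_abs _ _).trans (Finset.sum_le_sum fun i _ => ?_)
    rw [← mul_sub, abs_mul]
    gcongr
    exact abs_sub_dyadicPoint_le_chainTail hT (h2 i) (h3 i) ht m
  have := abs_sub_abs_le_abs_sub ((∑ i ∈ Finset.range n, b (τ i ω) * W i t ω) / n)
    ((∑ i ∈ Finset.range n, b (τ i ω) * W i p ω) / n)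
  linarith

end Market

/-! ### The law of large numbers for the jumps -/

section Market

variable {Ω S Ec Ei : Type*} {mΩ : MeasurableSpace Ω} [MeasurableSpace S] [MeasurableSpace Ec]
  [MeasurableSpace Ei]
  {P : Measure Ω} [IsProbabilityMeasure P] {𝕋 : Measure S} [IsProbabilityMeasure 𝕋] {lam : ℝ≥0}
  {νc : Measure Ec} [IsProbabilityMeasure νc] {νi : Measure Ei} [IsProbabilityMeasure νi]
  {τ : ℕ → Ω → S} {W0 : ℝ≥0 → Ω → ℝ} {W : ℕ → ℝ≥0 → Ω → ℝ}
  {N : Ω → Measure (ℝ≥0 × Ec × (ℕ → Ei))}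

omit [IsProbabilityMeasure νc] [IsProbabilityMeasure P] [IsProbabilityMeasure 𝕋] in
lemma IsMarketNoise.indepFun_types_poisson (h : IsMarketNoise P 𝕋 lam νc νi τ W0 W N) :
    IndepFun (fun ω j => τ j ω) N P := by
  have h1 := indep_iSup_of_disjoint h.sourceSigma_le h.indep (S := Set.range Source.type)
    (T := {Source.poisson}) (by simp)
  refine indep_of_indep_of_le_right (indep_of_indep_of_le_left h1 ?_) ?_
  · refine Measurable.comap_le ?_
    refine @measurable_pi_lambda Ω ℕ (fun _ => S) (_) _ _ fun j => ?_
    exact (comap_measurable (τ j)).mono (le_iSup₂_of_le (f := fun s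
      (_ : s ∈ Set.range Source.type) => sourceSigma τ W0 W N s) (Source.type j) ⟨j, rfl⟩ le_rfl)
      le_rfl
  · exact le_iSup₂_of_le (f := fun s (_ : s ∈ ({Source.poisson} : Set Source)) =>
      sourceSigma τ W0 W N s) Source.poisson rfl le_rfl

omit [IsProbabilityMeasure νc] [IsProbabilityMeasure 𝕋] in
/-- The strong law of large numbers for functions of the types and the idiosyncratic marks. -/
lemma IsMarketNoise.strong_law_marks (h : IsMarketNoise P 𝕋 lam νc νi τ W0 W N) {f : S × Ei → ℝ}
    (hf : Measurable f) (hint : Integrable f (𝕋.prod νi)) :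
    ∀ᵐ z ∂(P.prod (Measure.infinitePi fun _ : ℕ => νi)),
      Tendsto (fun n : ℕ => (∑ i ∈ Finset.range n, f (τ i z.1, z.2 i)) / n) atTop
        (𝓝 (∫ q, f q ∂(𝕋.prod νi))) := by
  set Q := Measure.infinitePi fun _ : ℕ => νi
  have hmp : ∀ i, MeasurePreserving (fun z : Ω × (ℕ → Ei) => (τ i z.1, z.2 i)) (P.prod Q)
      (𝕋.prod νi) := fun i =>
    (MeasurePreserving.mk (h.measurable_type i) (h.type_law i)).prod
      (measurePreserving_eval_infinitePi (fun _ : ℕ => νi) i)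
  have hind : ∀ i k, i ≠ k → IndepFun (fun z : Ω × (ℕ → Ei) => (τ i z.1, z.2 i))
      (fun z => (τ k z.1, z.2 k)) (P.prod Q) := by
    intro i k hik
    refine indepFun_prodMap (Y := fun e : ℕ → Ei => e i) (Y' := fun e : ℕ → Ei => e k)
      (h.measurable_type i) (h.measurable_type k) (measurable_pi_apply i)
      (measurable_pi_apply k) ?_ ?_
    · exact h.indep.indep (i := Source.type i) (j := Source.type k) (by simpa using hik)
    · exact (iIndepFun_infinitePi (P := fun _ : ℕ => νi) (X := fun _ => id)
        (fun _ => measurable_id)).indepFun hik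
  have h1 := strong_law_ae_real (μ := P.prod Q) (fun i z => f (τ i z.1, z.2 i))
    ((hmp 0).integrable_comp_of_integrable hint) (fun i k hik => (hind i k hik).comp hf hf)
    (fun i => (IdentDistrib.mk (hmp i).measurable.aemeasurable (hmp 0).measurable.aemeasurable
      ((hmp i).map_eq.trans (hmp 0).map_eq.symm)).comp hf)
  have h2 : ∫ z, f (τ 0 z.1, z.2 0) ∂(P.prod Q) = ∫ q, f q ∂(𝕋.prod νi) := by
    rw [← (hmp 0).map_eq, integral_map (hmp 0).measurable.aemeasurable hf.aestronglyMeasurable]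
  rwa [h2] at h1

/-- All investors share the common mark of an atom, so the law is first proved with that mark fixed.
It then transfers to the atoms of `N`, because the marks at which it fails form a null set
determined by the types alone. -/
theorem IsMarketNoise.strong_law_jumps (h : IsMarketNoise P 𝕋 lam νc νi τ W0 W N) {T : ℝ≥0}
    (hfin : ∀ᵐ ω ∂P, ∃ k : ℕ, N ω (strip _ T) = k) {g : S → Ec × Ei → ℝ}
    (hg : Measurable fun p : S × Ec × Ei => g p.1 p.2)
    (hint : ∀ᵐ ec ∂νc, Integrable (fun q : S × Ei => g q.1 (ec, q.2)) (𝕋.prod νi)) :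
    ∀ᵐ ω ∂P, ∀ᵐ q ∂((N ω).restrict (strip _ T)),
      Tendsto (fun n : ℕ => (∑ i ∈ Finset.range n, g (τ i ω) (q.2.1, q.2.2 i)) / n) atTop
        (𝓝 (∫ q', g q'.1 (q.2.1, q'.2) ∂(𝕋.prod νi))) := by
  set p : (ℕ → S) → Ec × (ℕ → Ei) → Prop := fun s e =>
    Tendsto (fun n : ℕ => (∑ i ∈ Finset.range n, g (s i) (e.1, e.2 i)) / n) atTop
        (𝓝 (∫ q', g q'.1 (e.1, q'.2) ∂(𝕋.prod νi))) with hp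
  have hκ : Measurable fun ω j => τ j ω := measurable_pi_lambda _ h.measurable_type
  have hpm : MeasurableSet {q : (ℕ → S) × Ec × (ℕ → Ei) | p q.1 q.2} := by
    have hL : Measurable fun ec : Ec => ∫ q', g q'.1 (ec, q'.2) ∂(𝕋.prod νi) := by
      have : Measurable fun x : Ec × S × Ei => g x.2.1 (x.1, x.2.2) :=
        hg.comp (measurable_snd.fst.prodMk (measurable_fst.prodMk measurable_snd.snd))
      exact this.stronglyMeasurable.integral_prod_right'.measurable
    have hsum : ∀ n : ℕ, Measurable fun q : (ℕ → S) × Ec × (ℕ → Ei) =>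
        (∑ i ∈ Finset.range n, g (q.1 i) (q.2.1, q.2.2 i)) / n
          - ∫ q', g q'.1 (q.2.1, q'.2) ∂(𝕋.prod νi) := by
      intro n
      refine ((Finset.measurable_fun_sum _ fun i _ => ?_).div_const _).sub
        (hL.comp measurable_snd.fst)
      have e1 : Measurable fun s : ℕ → S => s i := measurable_pi_apply i
      have e2 : Measurable fun e : ℕ → Ei => e i := measurable_pi_apply i
      exact hg.comp ((e1.comp measurable_fst).prodMk
        (measurable_snd.fst.prodMk (e2.comp measurable_snd.snd)))
    -- The limit varies with the common mark; subtracting it turns the event into convergence to the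
    -- fixed value zero.
    have := measurableSet_tendsto (l := atTop) (𝓝 (0 : ℝ)) hsum
    simp only [tendsto_sub_nhds_zero_iff] at this
    exact this
  refine h.ae_strip hκ h.indepFun_types_poisson hfin hpm ?_
  set Q := Measure.infinitePi fun _ : ℕ => νi with hQ
  -- The strong law holds for almost every fixed common mark. Two exchanges of null sets turn this
  -- into a statement for almost every `ω` and then almost every full mark.
  have h1 : ∀ᵐ ec ∂νc, ∀ᵐ z ∂(P.prod Q), p (fun j => τ j z.1) (ec, z.2) := by
    filter_upwards [hint] with ec hec
    exact h.strong_law_marks (f := fun q => g q.1 (ec, q.2))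
      (hg.comp (measurable_fst.prodMk (measurable_const.prodMk measurable_snd))) hec
  have h2 : ∀ᵐ z ∂(P.prod Q), ∀ᵐ ec ∂νc, p (fun j => τ j z.1) (ec, z.2) := by
    refine (Measure.ae_ae_comm ?_).1 h1
    exact ((hκ.comp measurable_snd.fst).prodMk (measurable_fst.prodMk measurable_snd.snd)) hpm
  have h3 : ∀ᵐ ω ∂P, ∀ᵐ e ∂(markIntensity lam νc νi), p (fun j => τ j ω) e := by
    filter_upwards [Measure.ae_ae_of_ae_prod h2] with ω hω
    refine Measure.ae_smul_measure ?_ lam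
    have hms : MeasurableSet {e : Ec × (ℕ → Ei) | p (fun j => τ j ω) e} :=
      (measurable_const.prodMk measurable_id) hpm
    refine (Measure.ae_prod_mem_iff_ae_ae_mem hms).2 ?_
    refine (Measure.ae_ae_comm ?_).1 hω
    exact measurable_swap hms
  refine (ae_map_iff hκ.aemeasurable ?_).2 h3
  exact (measurable_measure_prodMk_left (ν := markIntensity lam νc νi) hpm.compl)
    (measurableSet_singleton 0)

end Market

/-! ### The limit of the peer averages -/

section Market

variable {Ω S Ec Ei : Type*} [MeasurableSpace S] [MeasurableSpace Ec] [MeasurableSpace Ei]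
  {𝕋 : Measure S} [IsProbabilityMeasure 𝕋] {νi : Measure Ei} [IsProbabilityMeasure νi]
  {ty : S → InvestorType (Ec × Ei)} {π : S → ℝ → ℝ}

lemma measurable_jumpReturn (hty : IsMeasurableTypeFamily ty)
    (hπ : Measurable fun q : S × ℝ => π q.1 q.2) :
    Measurable fun p : S × Ec × Ei => jumpReturn (ty p.1) (π p.1) p.2 :=
  (hπ.comp (measurable_fst.prodMk hty.zeta)).mul hty.eta

omit [IsProbabilityMeasure 𝕋] [IsProbabilityMeasure νi] in
lemma log_meanJump (ec : Ec) : Real.log (meanJump 𝕋 νi ty π ec) =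
    ∫ q : S × Ei, Real.log (1 + jumpReturn (ty q.1) (π q.1) (ec, q.2)) ∂(𝕋.prod νi) :=
  Real.log_exp _

lemma measurable_log_meanJump (hty : IsMeasurableTypeFamily ty)
    (hπ : Measurable fun q : S × ℝ => π q.1 q.2) :
    Measurable fun ec : Ec => Real.log (meanJump 𝕋 νi ty π ec) := by
  simp only [log_meanJump]
  have : Measurable fun x : Ec × S × Ei =>
      Real.log (1 + jumpReturn (ty x.2.1) (π x.2.1) (x.1, x.2.2)) :=
    Real.measurable_log.comp (measurable_const.add ((measurable_jumpReturn hty hπ).comp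
      (measurable_snd.fst.prodMk (measurable_fst.prodMk measurable_snd.snd))))
  exact this.stronglyMeasurable.integral_prod_right'.measurable

omit [MeasurableSpace S] in
lemma setIntegral_commonJumps {N : Ω → Measure (ℝ≥0 × Ec × (ℕ → Ei))} {ω : Ω} {t : ℝ≥0}
    {f : Ec → ℝ} (hf : Measurable f) :
    ∫ q in Set.Icc 0 t ×ˢ Set.univ, f q.2 ∂(commonJumps N ω)
      = ∫ q in strip (Ec × (ℕ → Ei)) t, f q.2.1 ∂(N ω) := by
  rw [commonJumps, setIntegral_map (f := fun q : ℝ≥0 × Ec => f q.2)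
    (measurableSet_Icc.prod MeasurableSet.univ)
    (hf.comp measurable_snd).aestronglyMeasurable
    (measurable_fst.prodMk measurable_snd.fst).aemeasurable]
  congr 2

end Market

end JumpSignalGame

end

/-! ### The limit theorem for the geometric average wealth -/

open JumpSignalGame

theorem lemma2p10 {Ω S Ec Ei : Type*} [MeasurableSpace Ω] [MeasurableSpace S]
    [TopologicalSpace Ec] [PolishSpace Ec] [MeasurableSpace Ec] [BorelSpace Ec]
    [TopologicalSpace Ei] [PolishSpace Ei] [MeasurableSpace Ei] [BorelSpace Ei]
    (P : Measure Ω) [IsProbabilityMeasure P]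
    (T : ℝ≥0) (hT : 0 < T)
    -- the intensity of marks
    (lam : ℝ≥0) (hlam : 0 < lam)
    (νc : Measure Ec) [IsProbabilityMeasure νc] (νi : Measure Ei) [IsProbabilityMeasure νi]
    -- the type distribution, on admissible types
    (𝕋 : Measure S) [IsProbabilityMeasure 𝕋]
    (ty : S → JumpSignalGame.InvestorType (Ec × Ei))
    (hty : JumpSignalGame.IsMeasurableTypeFamily ty)
    (hadm : ∀ᵐ s ∂𝕋, JumpSignalGame.IsAdmissibleType
      (JumpSignalGame.investorIntensity lam νc νi) (ty s))
    -- the type-determined signal-driven strategies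
    (π : S → ℝ → ℝ) (hπ : Measurable fun q : S × ℝ => π q.1 q.2)
    (hπadm : ∀ᵐ s ∂𝕋, JumpSignalGame.IsAdmissibleSignalStrategy
      (JumpSignalGame.investorIntensity lam νc νi) (ty s) (π s))
    -- the sampled types, the noise and the wealth processes
    (τ : ℕ → Ω → S) (W0 : ℝ≥0 → Ω → ℝ) (W : ℕ → ℝ≥0 → Ω → ℝ)
    (N : Ω → Measure (ℝ≥0 × Ec × (ℕ → Ei)))
    (hnoise : JumpSignalGame.IsMarketNoise P 𝕋 lam νc νi τ W0 W N)
    (X : ℕ → ℝ≥0 → Ω → ℝ)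
    (hX : ∀ j, JumpSignalGame.IsWealthProcess P T ty π τ W0 W N j (X j))
    -- the integrability conditions
    (hx0 : Integrable (fun s => Real.log (ty s).x0) 𝕋)
    (hdrift : Integrable (fun s => JumpSignalGame.logDrift (ty s) (π s)) 𝕋)
    (hsigma : Integrable (fun s => (ty s).sigma * π s 0) 𝕋)
    (hsigma0 : Integrable (fun s => (ty s).sigma0 * π s 0) 𝕋)
    (hjump : ∀ᵐ ec ∂νc, Integrable
      (fun q : S × Ei => Real.log (1 + JumpSignalGame.jumpReturn (ty q.1) (π q.1) (ec, q.2)))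
      (𝕋.prod νi)) :
    ∀ᵐ ω ∂P, ∀ i : ℕ, ∀ t ≤ T,
      Tendsto (fun n => JumpSignalGame.peerAverage X i n t ω) atTop
        (𝓝 (JumpSignalGame.meanInitial 𝕋 ty * Real.exp (
          JumpSignalGame.meanDrift 𝕋 ty π * t
            + JumpSignalGame.meanCommonVol 𝕋 ty π * W0 t ω
            + ∫ q in Set.Icc 0 t ×ˢ Set.univ,
                Real.log (JumpSignalGame.meanJump 𝕋 νi ty π q.2)
                ∂(JumpSignalGame.commonJumps N ω)))) := by
  classical
  have hγ := measurable_jumpReturn hty hπ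
  have hπ0 : Measurable fun s => π s 0 := hπ.comp (measurable_id.prodMk measurable_const)
  have : Nonempty (Ec × (ℕ → Ei)) := by
    have := νc.nonempty_of_neZero
    have := νi.nonempty_of_neZero
    infer_instance
  -- Atoms are selected for every `ω`, with an empty default off the almost sure event, so that `A`
  -- and `e` are genuine functions of `ω`.
  have hex : ∀ ω, ∃ (A : Finset ℝ≥0) (e : ℝ≥0 → Ec × (ℕ → Ei)),
      (∃ (A : Finset ℝ≥0) (e : ℝ≥0 → Ec × (ℕ → Ei)), (∀ u ∈ A, 0 < u ∧ u ≤ T) ∧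
        (N ω).restrict (strip _ T) = ∑ u ∈ A, Measure.dirac (u, e u)) →
      (∀ u ∈ A, 0 < u ∧ u ≤ T) ∧
        (N ω).restrict (strip _ T) = ∑ u ∈ A, Measure.dirac (u, e u) := by
    intro ω
    by_cases h : ∃ (A : Finset ℝ≥0) (e : ℝ≥0 → Ec × (ℕ → Ei)), (∀ u ∈ A, 0 < u ∧ u ≤ T) ∧
        (N ω).restrict (strip _ T) = ∑ u ∈ A, Measure.dirac (u, e u)
    · obtain ⟨A, e, hA⟩ := h
      exact ⟨A, e, fun _ => hA⟩
    · exact ⟨∅, fun _ => Classical.arbitrary _, fun h' => absurd h' h⟩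
  choose A e hAe using hex
  have hA := (hnoise.poisson.ae_exists_sum_dirac T).mono hAe
  have hfin : ∀ᵐ ω ∂P, ∃ k : ℕ, N ω (strip _ T) = k := by
    filter_upwards [hA] with ω hω
    exact ⟨_, measure_strip_eq_card hω.2 le_rfl⟩
  have hpos : ∀ᵐ ω ∂P, ∀ j, ∀ u ∈ A ω,
      0 < 1 + jumpReturn (ty (τ j ω)) (π (τ j ω)) ((e ω u).1, (e ω u).2 j) := by
    refine ae_all_iff.2 fun j => ?_
    have hs : ∀ᵐ s ∂𝕋, ∀ᵐ x ∂(investorIntensity lam νc νi), 0 < 1 + jumpReturn (ty s) (π s) x := by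
      filter_upwards [hadm, hπadm] with s h1 h2
      exact h2.ae_one_add_jumpReturn_pos h1
    filter_upwards [hA, hnoise.ae_strip_one_add_jumpReturn_pos hfin hγ hs j] with ω h1 h2
    exact (ae_restrict_strip_iff h1.2).1 h2
  have hwealth := fun j => hnoise.ae_wealth_eq hA
    (a := fun s => (ty s).r + π s 0 * ((ty s).kappa - (ty s).r))
    (b := fun s => (ty s).sigma * π s 0) (c := fun s => (ty s).sigma0 * π s 0)
    (x0 := fun s => (ty s).x0) (γ := fun s => jumpReturn (ty s) (π s)) (j := j)
    (hty.r.add (hπ0.mul (hty.kappa.sub hty.r))) (hty.sigma.mul hπ0) (hty.sigma0.mul hπ0) hty.x0 hγ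
    (hpos.mono fun ω h => h j) (hX j)
  have hmlogdrift : Measurable fun s => logDrift (ty s) (π s) := by
    unfold logDrift
    exact (hty.r.add (hπ0.mul (hty.kappa.sub hty.r))).sub ((measurable_const.mul
      ((hty.sigma.pow_const 2).add (hty.sigma0.pow_const 2))).mul (hπ0.pow_const 2))
  have hlog : Measurable fun p : S × Ec × Ei => Real.log (1 + jumpReturn (ty p.1) (π p.1) p.2) :=
    Real.measurable_log.comp (hγ.const_add 1)
  -- `i` and `t` are introduced only after all exceptional events have been removed: wealth is
  -- explicit for all times at once, the idiosyncratic law holds for all times, and the jump law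
  -- holds at every atom.
  filter_upwards [hA, hpos, ae_all_iff.2 hwealth,
    hnoise.strong_law_type (Real.measurable_log.comp hty.x0) hx0,
    hnoise.strong_law_type hmlogdrift hdrift,
    hnoise.strong_law_type (f := fun s => (ty s).sigma0 * π s 0) (hty.sigma0.mul hπ0) hsigma0,
    hnoise.strong_law_idiosyncratic hT (b := fun s => (ty s).sigma * π s 0) (hty.sigma.mul hπ0)
      hsigma,
    hnoise.strong_law_jumps hfin (g := fun s x => Real.log (1 + jumpReturn (ty s) (π s) x))
      hlog hjump]
    with ω h1 h2 h3 g1 g2 g3 g4 g5 i t ht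
  rw [ae_restrict_strip_iff h1.2] at g5
  rw [setIntegral_commonJumps (measurable_log_meanJump hty hπ), integral_strip_eq_sum h1.2 ht,
    meanInitial, ← Real.exp_add]
  have hprod : ∀ j, 0 < ∏ u ∈ A ω with u ≤ t,
      (1 + jumpReturn (ty (τ j ω)) (π (τ j ω)) ((e ω u).1, (e ω u).2 j)) := fun j =>
    Finset.prod_pos fun u hu => h2 j u (Finset.mem_filter.1 hu).1
  have hXpos : ∀ j, 0 < X j t ω := fun j => by
    rw [h3 j t ht]
    exact mul_pos (mul_pos (ty (τ j ω)).x0_pos (Real.exp_pos _)) (hprod j)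
  have hXlog : ∀ j, Real.log (X j t ω) = Real.log (ty (τ j ω)).x0
      + logDrift (ty (τ j ω)) (π (τ j ω)) * t
      + (ty (τ j ω)).sigma * π (τ j ω) 0 * W j t ω
      + (ty (τ j ω)).sigma0 * π (τ j ω) 0 * W0 t ω
      + ∑ u ∈ A ω with u ≤ t, Real.log
          (1 + jumpReturn (ty (τ j ω)) (π (τ j ω)) ((e ω u).1, (e ω u).2 j)) := fun j => by
    rw [h3 j t ht, Real.log_mul (mul_pos (ty (τ j ω)).x0_pos (Real.exp_pos _)).ne' (hprod j).ne',
      Real.log_mul (ty (τ j ω)).x0_pos.ne' (Real.exp_pos _).ne', Real.log_exp,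
      Real.log_prod fun u hu => (h2 j u (Finset.mem_filter.1 hu).1).ne']
    simp only [logDrift]
    ring
  refine tendsto_geometricAverage hXpos ?_ i
  -- For fixed `ω` and `t`, the time, the value `W0 t ω` and the finite set of jumps do not depend
  -- on the investor, so the limits simply add up.
  have hsum := ((((g1.add (g2.mul_const (t : ℝ))).add (g4 t ht)).add (g3.mul_const (W0 t ω))).add
    (tendsto_finsetSum ((A ω).filter (· ≤ t)) fun u hu => g5 u (Finset.mem_filter.1 hu).1))
  convert hsum using 1
  · ext n
    rw [Finset.sum_congr rfl fun j _ => hXlog j]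
    simp only [Finset.sum_add_distrib, ← Finset.sum_mul, ← Finset.sum_div]
    rw [Finset.sum_comm]
    simp only [Function.comp_apply]
    ring
  · simp only [log_meanJump, meanDrift, meanCommonVol, Function.comp_apply]
    congr 1
    ring
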